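/- There is a deterministic algorithm that solves every instance $(\mathcal G,s,k)$ of \textsc{$k$-arbitrary TEXP} in time \[(2e)^k\,k^{O(\log k)}\,L\,n^3\log n ,\] and that also returns an optimal solution if the instance is a yes-instance. Here: A temporal graph $\mathcal G=\langle G_1,\dots,G_L\rangle$ with vertex set $V$, $|V|=n\ge 1$, lifetime $L\ge 1$ and underlying graph $G=(V,E)$ is a sequence of simple undirected graphs $G_t=(V,E_t)$ with $E_t\subseteq E$, given by the adjacency matrices of $G_1,\dots,G_L$. A strict temporal walk in $\mathcal G$ with start time $t_0$ is a sequence $W=\langle v_1,(e_1,t_1),v_2,\dots,(e_{l-1},t_{l-1}),v_l\rangle$ with $l\ge 1$, $e_i=\{v_i,v_{i+1}\}\in E_{t_i}$ and $1\le t_0\le t_1<t_2<\dots<t_{l-1}\le L$ (for $l=1$: $1\le t_0\le L$); it visits $v_1$ at time $t_0$ and $v_{i+1}$ at time $t_i+1$. For $s\in V$ and $k\in\{0,1,2,\dots\}$, an $(s,1,k)$-tour is a strict temporal walk that starts at $s$ at time $1$ and visits all vertices of some set $X\subseteq V$ with $|X|=k$; its arrival time is the first time by which all vertices of $X$ have been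 visited. \textsc{$k$-arbitrary TEXP} asks, given $(\mathcal G,s,k)$ with $s\in V$, whether an $(s,1,k)$-tour exists. An optimal solution of a yes-instance is an $(s,1,k)$-tour of minimum arrival time among all $(s,1,k)$-tours, ending as soon as all vertices of $X$ have been visited. The algorithm is one program for a deterministic word RAM with words of $O(k+\log n+\log L)$ bits and unit-cost arithmetic ($+,-,\cdot$, integer division, remainder), comparisons, and indirect memory access. The time bound means that there are constants $A,c$, independent of the instance, such that the program halts within $A\,(2e)^k\,k^{c\log k}\,L\,n^3\log(n+1)$ steps on every instance, where $k^{c\log k}$ is read as $1$ for $k=0$; the use of $\log(n+1)$ instead of $\log n$ matters only for $n=1$. -/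

import Mathlib

/-! ## Temporal graphs, strict temporal walks and tours -/

namespace TExp

/-- A temporal graph with vertex set `V` and lifetime `L`: an underlying simple graph and a sequence
of `L` layers, each of which is a spanning subgraph of it. The layer of timestep `t`, where
`1 ≤ t ≤ L`, is `layer ⟨t - 1, _⟩`. -/
structure TemporalGraph (V : Type*) (L : ℕ) where
  underlying : SimpleGraph V
  layer : Fin L → SimpleGraph V
  layer_le : ∀ i, layer i ≤ underlying

variable {V : Type*} {L : ℕ}

/-- `({u, v}, t)` is a time edge: `1 ≤ t ≤ L` and `{u, v}` is an edge of the layer of timestep `t`. -/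
def TemporalGraph.TimeEdge (G : TemporalGraph V L) (t : ℕ) (u v : V) : Prop :=
  ∃ h : 1 ≤ t ∧ t ≤ L, (G.layer ⟨t - 1, by omega⟩).Adj u v

/-- `G.IsSteps v τ S`: starting at `v` at the beginning of timestep `τ`, one can successively traverse
the moves in `S`, where `(t, u)` stands for "traverse, during timestep `t`, the edge from the
current vertex to `u`", with strictly increasing timesteps. -/
def TemporalGraph.IsSteps (G : TemporalGraph V L) : V → ℕ → List (ℕ × V) → Prop
  | _, _, [] => True
  | v, τ, (t, u) :: S => τ ≤ t ∧ G.TimeEdge t v u ∧ TemporalGraph.IsSteps G u (t + 1) S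

/-- A strict temporal walk `(t₀, ⟨v₁, (e₁, t₁), v₂, …, (e_{l-1}, t_{l-1}), v_l⟩)`: `startTime` is `t₀`,
`start` is `v₁`, and `steps` is the list of the pairs `(t_i, v_{i+1})`, with
`e_i = {v_i, v_{i+1}}` and `1 ≤ t₀ ≤ t₁ < t₂ < ⋯ < t_{l-1} ≤ L`. -/
structure StrictWalk (G : TemporalGraph V L) where
  startTime : ℕ
  start : V
  steps : List (ℕ × V)
  one_le_startTime : 1 ≤ startTime
  startTime_le : startTime ≤ L
  isSteps : G.IsSteps start startTime steps

namespace StrictWalk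

variable {G : TemporalGraph V L}

/-- The pairs `(τ, x)` such that the walk gets to `x` at the beginning of timestep `τ`, in order:
`(t₀, v₁), (t₁ + 1, v₂), …, (t_{l-1} + 1, v_l)`. -/
def stops (W : StrictWalk G) : List (ℕ × V) :=
  (W.startTime, W.start) :: W.steps.map (fun p => (p.1 + 1, p.2))

/-- The walk visits `x`. -/
def Visits (W : StrictWalk G) (x : V) : Prop := ∃ τ, (τ, x) ∈ W.stops

/-- The arrival time `t_{l-1} + 1` of the walk (`t₀` if the walk traverses no edge). -/
def endTime (W : StrictWalk G) : ℕ := (W.stops.getLast (by simp [stops])).1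

/-- A `(v, t, X)`-tour: a strict temporal walk that starts at `v` in timestep `t` and visits
all vertices in `X`. -/
def IsTour (W : StrictWalk G) (v : V) (t : ℕ) (X : Finset V) : Prop :=
  W.start = v ∧ W.startTime = t ∧ ∀ x ∈ X, W.Visits x

/-- The arrival time `α(W)` of `W` as a `(v, t, X)`-tour: the first time `τ` such that at the beginning of
timestep `τ` (that is, at the end of timestep `τ - 1`) all vertices in `X` have been visited. -/
noncomputable def tourArrival (W : StrictWalk G) (X : Finset V) : ℕ :=
  sInf {τ | W.startTime ≤ τ ∧ ∀ x ∈ X, ∃ τ' ≤ τ, (τ', x) ∈ W.stops}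

end StrictWalk

/-- `(G, s, k)` is a yes-instance of `k`-arbitrary TEXP: there is an `(s, 1, k)`-tour, that is, an
`(s, 1, X)`-tour for some `k`-element set `X` of vertices. -/
def KArbitraryTEXP (G : TemporalGraph V L) (s : V) (k : ℕ) : Prop :=
  ∃ (W : StrictWalk G) (X : Finset V), X.card = k ∧ W.IsTour s 1 X

/-- `W` is an optimal solution of the instance `(G, s, k)` of `k`-arbitrary TEXP: an `(s, 1, k)`-tour,
ending as soon as the `k` vertices in question have been visited, whose arrival time
is minimum among all `(s, 1, k)`-tours. -/
def IsOptimalSolution (G : TemporalGraph V L) (s : V) (k : ℕ) (W : StrictWalk G) : Prop :=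
  ∃ X : Finset V, X.card = k ∧ W.IsTour s 1 X ∧ W.endTime = W.tourArrival X ∧
    ∀ (W' : StrictWalk G) (X' : Finset V), X'.card = k → W'.IsTour s 1 X' →
      W.tourArrival X ≤ W'.tourArrival X'

end TExp

/-! ## A deterministic word RAM with unit-cost instructions -/

namespace WordRAM

/-- The state of the machine: registers, which instructions address directly (a program
mentions only finitely many of them), and a memory, addressed through registers. -/
structure State where
  reg : ℕ → ℕ
  mem : ℕ → ℕ

/-- Writing a value into a register. -/
def State.setReg (σ : State) (d x : ℕ) : State := ⟨Function.update σ.reg d x, σ.mem⟩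

/-- Writing a value into a memory cell. -/
def State.setMem (σ : State) (a x : ℕ) : State := ⟨σ.reg, Function.update σ.mem a x⟩

/-- The arithmetic operations. -/
inductive ArithOp
  | add | sub | mul | div | mod

/-- Their values on natural numbers (truncated subtraction, integer division). -/
def ArithOp.eval : ArithOp → ℕ → ℕ → ℕ
  | add, x, y => x + y
  | sub, x, y => x - y
  | mul, x, y => x * y
  | div, x, y => x / y
  | mod, x, y => x % y

/-- Programs: word RAM instructions, with structured control flow in place of jumps. -/
inductive Prog
  /-- do nothing -/
  | skip
  /-- register `d` := the constant `c` -/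
  | const (d c : ℕ)
  /-- register `d` := (register `a`) `o` (register `b`) -/
  | arith (o : ArithOp) (d a b : ℕ)
  /-- register `d` := memory cell whose address is in register `a` -/
  | load (d a : ℕ)
  /-- memory cell whose address is in register `a` := register `b` -/
  | store (a b : ℕ)
  /-- first `p`, then `q` -/
  | seq (p q : Prog)
  /-- if (register `a`) < (register `b`) then `p` else `q` -/
  | ite (a b : ℕ) (p q : Prog)
  /-- while (register `a`) < (register `b`) do `p` -/
  | loop (a b : ℕ) (p : Prog)

/-- `Exec w p σ T σ'`: on a machine with `w`-bit words, the program `p`, started in state `σ`, halts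
after exactly `T` steps in state `σ'`. Every instruction and every evaluation of a test is one step.
A computation that produces a number that does not fit into a word has no execution. -/
inductive Exec (w : ℕ) : Prog → State → ℕ → State → Prop
  | skip (σ : State) : Exec w .skip σ 1 σ
  | const (σ : State) (d c : ℕ) (h : c < 2 ^ w) : Exec w (.const d c) σ 1 (σ.setReg d c)
  | arith (σ : State) (o : ArithOp) (d a b : ℕ) (h : o.eval (σ.reg a) (σ.reg b) < 2 ^ w) :
      Exec w (.arith o d a b) σ 1 (σ.setReg d (o.eval (σ.reg a) (σ.reg b)))
  | load (σ : State) (d a : ℕ) : Exec w (.load d a) σ 1 (σ.setReg d (σ.mem (σ.reg a)))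
  | store (σ : State) (a b : ℕ) : Exec w (.store a b) σ 1 (σ.setMem (σ.reg a) (σ.reg b))
  | seq {p q : Prog} {σ σ₁ σ₂ : State} {T₁ T₂ : ℕ} (h₁ : Exec w p σ T₁ σ₁)
      (h₂ : Exec w q σ₁ T₂ σ₂) : Exec w (.seq p q) σ (T₁ + T₂) σ₂
  | ite_true {a b : ℕ} {p q : Prog} {σ σ' : State} {T : ℕ} (hab : σ.reg a < σ.reg b)
      (h : Exec w p σ T σ') : Exec w (.ite a b p q) σ (T + 1) σ'
  | ite_false {a b : ℕ} {p q : Prog} {σ σ' : State} {T : ℕ} (hab : ¬ σ.reg a < σ.reg b)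
      (h : Exec w q σ T σ') : Exec w (.ite a b p q) σ (T + 1) σ'
  | loop_true {a b : ℕ} {p : Prog} {σ σ₁ σ₂ : State} {T₁ T₂ : ℕ} (hab : σ.reg a < σ.reg b)
      (h₁ : Exec w p σ T₁ σ₁) (h₂ : Exec w (.loop a b p) σ₁ T₂ σ₂) :
      Exec w (.loop a b p) σ (T₁ + T₂ + 1) σ₂
  | loop_false {a b : ℕ} {p : Prog} {σ : State} (hab : ¬ σ.reg a < σ.reg b) :
      Exec w (.loop a b p) σ 1 σ

/-- The machine is deterministic: final state and number of steps are determined by the program and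
the initial state. -/
theorem Exec.deterministic {w : ℕ} {p : Prog} {σ σ₁ : State} {T₁ : ℕ} (h₁ : Exec w p σ T₁ σ₁) :
    ∀ {T₂ : ℕ} {σ₂ : State}, Exec w p σ T₂ σ₂ → T₁ = T₂ ∧ σ₁ = σ₂ := by
  induction h₁ with
  | skip | const | arith | load | store => intro T₂ σ₂ h₂; cases h₂; exact ⟨rfl, rfl⟩
  | seq _ _ ih ih' =>
    intro T₂ σ₂ h₂
    cases h₂ with
    | seq k k' =>
      obtain ⟨rfl, rfl⟩ := ih k
      obtain ⟨rfl, rfl⟩ := ih' k'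
      exact ⟨rfl, rfl⟩
  | ite_true hab _ ih =>
    intro T₂ σ₂ h₂
    cases h₂ with
    | ite_true _ k => obtain ⟨rfl, rfl⟩ := ih k; exact ⟨rfl, rfl⟩
    | ite_false hab' _ => exact absurd hab hab'
  | ite_false hab _ ih =>
    intro T₂ σ₂ h₂
    cases h₂ with
    | ite_true hab' _ => exact absurd hab' hab
    | ite_false _ k => obtain ⟨rfl, rfl⟩ := ih k; exact ⟨rfl, rfl⟩
  | loop_true hab _ _ ih ih' =>
    intro T₂ σ₂ h₂
    cases h₂ with
    | loop_true _ k k' =>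
      obtain ⟨rfl, rfl⟩ := ih k
      obtain ⟨rfl, rfl⟩ := ih' k'
      exact ⟨rfl, rfl⟩
    | loop_false hab' => exact absurd hab hab'
  | loop_false hab =>
    intro T₂ σ₂ h₂
    cases h₂ with
    | loop_true hab' _ _ => exact absurd hab' hab
    | loop_false _ => exact ⟨rfl, rfl⟩

end WordRAM

/-! ## Input and output of an algorithm for `k`-arbitrary TEXP -/

namespace TExp

open scoped Classical in
/-- The initial state for the instance `(G, s, k)` with vertex set `{0, …, n - 1}`: registers `0, 1, 2, 3`
hold `n, L, k, s`, the memory holds the adjacency matrices of the `L` layers one after the other,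
each row by row, and everything else is `0`. -/
noncomputable def inputState {n L : ℕ} (G : TemporalGraph (Fin n) L) (s : Fin n) (k : ℕ) :
    WordRAM.State where
  reg := fun r =>
    if r = 0 then n else if r = 1 then L else if r = 2 then k else if r = 3 then (s : ℕ) else 0
  mem := fun a =>
    if ∃ (i : Fin L) (u v : Fin n), a = ((i : ℕ) * n + u) * n + v ∧ (G.layer i).Adj u v then 1 else 0

/-- The state `σ` describes the walk `W`: register `1` holds the number of edges traversed, and from the
address in register `2` on, the memory holds the numbers `t₁, v₂, t₂, v₃, …, t_{l-1}, v_l`. (The start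
vertex and the start time of a tour are given by the instance.) -/
def DescribesWalk {n L : ℕ} {G : TemporalGraph (Fin n) L} (σ : WordRAM.State)
    (W : StrictWalk G) : Prop :=
  σ.reg 1 = W.steps.length ∧
    ∀ (i : ℕ) (hi : i < W.steps.length),
      σ.mem (σ.reg 2 + 2 * i) = (W.steps[i]).1 ∧
      σ.mem (σ.reg 2 + 2 * i + 1) = ((W.steps[i]).2 : ℕ)

/-- The final state `σ` is a correct answer for the instance `(G, s, k)`: register `0` holds `1` if it is a
yes-instance and `0` otherwise, and for a yes-instance `σ` describes an optimal solution. -/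
def CorrectOutput {n L : ℕ} (G : TemporalGraph (Fin n) L) (s : Fin n) (k : ℕ)
    (σ : WordRAM.State) : Prop :=
  (KArbitraryTEXP G s k →
    σ.reg 0 = 1 ∧ ∃ W : StrictWalk G, IsOptimalSolution G s k W ∧ DescribesWalk σ W) ∧
  (¬ KArbitraryTEXP G s k → σ.reg 0 = 0)

end TExp

/-! Replace each leg of a tour by a foremost journey. A `(s,1,k)`-tour arriving after `τ` time steps
exists exactly when some sequence of `k` distinct vertices, visited one after the other by foremost
journeys from `s`, ends by time `τ`: take the vertices in the order of their first visits
(`Foremost.exists_order`), and use that a later start never gives an earlier arrival. Only the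
distinctness of the `k` vertices is hard to control.

Distinctness is tested algebraically. To a sequence of vertices attach the `k × k` Vandermonde
determinant in the vertex numbers. Its square is a nonnegative integer and vanishes iff a vertex
repeats. So the sum of these squares over all sequences that end at time `t` in `v` is positive iff
a sequence of distinct vertices ends there; nothing can cancel. Laplace expansion of both factors
along the column of the last vertex turns this sum into a dynamic program over pairs `(A, B)` of
sets of rows (`table_eq_sumSeq`). It has `4 ^ k` pairs, and `4 < 2e`, so the stated bound holds with
room: the running time is `O(4 ^ k (k + 1) ^ 5 L n ^ 3)`.

The integers are too long for one word, so the tables are computed modulo `O(k ^ 2)` consecutive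
numbers. A positive integer divisible by all of them would be too large (`exists_not_dvd`), so every
positive entry is nonzero for one of them (`le_place`). The least time `best` with an entry that is
nonzero modulo some modulus is thus a lower bound for every tour.

To attain this bound, a sequence is recovered backwards. Single entries of the table do not suffice
for this, because the sum splits over many pairs `(A, B)`; instead a linear functional on each level
is carried along. Fixing the last vertex contracts the functional (`pairing_table`), and a nonzero
sum over predecessors has a nonzero term. At the end the square of the determinant of the sequence
found is nonzero in `ZMod (Q + 1)`, so its vertices are distinct; this works for composite moduli
(`backtrack_run`). A walk along the foremost journeys is then written out step by step
(`output_run`).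

For the machine model, the algorithm is written in a language whose loop lengths are parameters.
Compilation to the word RAM is verified once (`Cmd.comp_runs`), and word sizes and running time
follow from syntactic bounds that are evaluated by the kernel (`algorithm_ok`, `algorithm_cost`). -/

/-! ## A language of bounded loops, compiled to the word RAM -/

namespace ForProg
open WordRAM

/-- Expressions: parameters, variables, arithmetic, array cells, and selection by a comparison. -/
inductive Expr
  | par (i : ℕ)
  | var (i : ℕ)
  | const (c : ℕ)
  | bin (o : ArithOp) (a b : Expr)
  /-- `a mod (b + 1)` -/
  | modSucc (a b : Expr)
  | load (j : ℕ) (e : Expr)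
  /-- if `a < b` then `x` else `y` -/
  | sel (a b x y : Expr)

/-- Programs whose loops run a number of times given by a parameter. -/
inductive Cmd
  | assign (x : ℕ) (e : Expr)
  | store (j : ℕ) (a e : Expr)
  | seq (c d : Cmd)
  | loop (x p : ℕ) (c : Cmd)

/-- The values of the variables and of the arrays. -/
structure St where
  var : ℕ → ℕ
  arr : ℕ → ℕ → ℕ

def St.setVar (st : St) (x v : ℕ) : St := ⟨Function.update st.var x v, st.arr⟩

def St.setArr (st : St) (j i v : ℕ) : St :=
  ⟨st.var, Function.update st.arr j (Function.update (st.arr j) i v)⟩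

/-- Array `0` is an initial segment, of length `M`, of the memory, and its indices are taken modulo
`M`; the other arrays are unbounded. -/
def ix (M j i : ℕ) : ℕ := if j = 0 then i % M else i

/-- The memory cell of entry `i` of array `j`. -/
def addr (M j i : ℕ) : ℕ := if j = 0 then i % M else i * 16 + j + M

/-- The value of an expression; parameter `2` is the size of array `0`. -/
def Expr.eval (ρ : ℕ → ℕ) (st : St) : Expr → ℕ
  | par i => ρ i
  | var i => st.var i
  | const c => c
  | bin o a b => o.eval (a.eval ρ st) (b.eval ρ st)
  | modSucc a b => a.eval ρ st % (b.eval ρ st + 1)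
  | load j e => st.arr j (ix (ρ 2) j (e.eval ρ st))
  | sel a b x y => if a.eval ρ st < b.eval ρ st then x.eval ρ st else y.eval ρ st

/-- `f (m - 1) (… (f 1 (f 0 st)))`. -/
def iter (f : ℕ → St → St) (st : St) : ℕ → St
  | 0 => st
  | m + 1 => f m (iter f st m)

def Cmd.run (ρ : ℕ → ℕ) : Cmd → St → St
  | assign x e, st => st.setVar x (e.eval ρ st)
  | store j a e, st => st.setArr j (ix (ρ 2) j (a.eval ρ st)) (e.eval ρ st)
  | seq c d, st => d.run ρ (c.run ρ st)
  | loop x p c, st => iter (fun i s => c.run ρ (s.setVar x i)) st (ρ p)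

/-! ### Compilation -/

/-- The program `p` halts within `T` steps, in the state `σ'`. -/
def Runs (w : ℕ) (p : Prog) (σ : State) (T : ℕ) (σ' : State) : Prop :=
  ∃ T' ≤ T, Exec w p σ T' σ'

/-- Adding the address computation for entry (temporary `t`) of array `j`. -/
def toAddr (j t : ℕ) : Prog :=
  if j = 0 then .arith .mod (3 * t + 2) (3 * t + 2) 6
  else .seq (.const (3 * (t + 1) + 2) 16) (.seq (.arith .mul (3 * t + 2) (3 * t + 2) (3 * (t + 1) + 2))
    (.seq (.const (3 * (t + 1) + 2) j) (.seq (.arith .add (3 * t + 2) (3 * t + 2) (3 * (t + 1) + 2))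
      (.arith .add (3 * t + 2) (3 * t + 2) 6))))

/-- Register `d` := register `a`, with the register of temporary `t` as auxiliary register. -/
def move (d a t : ℕ) : Prog := .seq (.const (3 * t + 2) 0) (.arith .add d a (3 * t + 2))

/-- Code that puts the value of an expression into the register of temporary `t`. Parameter `i` is in
register `3 i`, variable `i` in register `3 i + 1` and temporary `i` in register `3 i + 2`. -/
def Expr.comp : Expr → ℕ → Prog
  | par i, t => move (3 * t + 2) (3 * i) (t + 1)
  | var i, t => move (3 * t + 2) (3 * i + 1) (t + 1)
  | const c, t => .const (3 * t + 2) c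
  | bin o a b, t => .seq (a.comp t) (.seq (b.comp (t + 1))
      (.arith o (3 * t + 2) (3 * t + 2) (3 * (t + 1) + 2)))
  | modSucc a b, t => .seq (a.comp t) (.seq (b.comp (t + 1)) (.seq (.const (3 * (t + 2) + 2) 1)
      (.seq (.arith .add (3 * (t + 1) + 2) (3 * (t + 1) + 2) (3 * (t + 2) + 2))
        (.arith .mod (3 * t + 2) (3 * t + 2) (3 * (t + 1) + 2)))))
  | load j e, t => .seq (e.comp t) (.seq (toAddr j t) (.load (3 * t + 2) (3 * t + 2)))
  | sel a b x y, t => .seq (a.comp t) (.seq (b.comp (t + 1)) (.seq (x.comp (t + 2))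
      (.seq (y.comp (t + 3)) (.ite (3 * t + 2) (3 * (t + 1) + 2)
        (move (3 * t + 2) (3 * (t + 2) + 2) (t + 4)) (move (3 * t + 2) (3 * (t + 3) + 2) (t + 4))))))

/-- An upper bound on the time it takes to evaluate an expression. -/
def Expr.cost : Expr → ℕ
  | par _ => 2
  | var _ => 2
  | const _ => 1
  | bin _ a b => a.cost + b.cost + 1
  | modSucc a b => a.cost + b.cost + 3
  | load _ e => e.cost + 6
  | sel a b x y => a.cost + b.cost + x.cost + y.cost + 3

def Cmd.comp : Cmd → ℕ → Prog
  | assign x e, t => .seq (e.comp t) (move (3 * x + 1) (3 * t + 2) (t + 1))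
  | store j a e, t => .seq (a.comp t) (.seq (toAddr j t) (.seq (e.comp (t + 1))
      (.store (3 * t + 2) (3 * (t + 1) + 2))))
  | seq c d, t => .seq (c.comp t) (d.comp t)
  | loop x p c, t => .seq (.const (3 * t + 2) 0) (.loop (3 * t + 2) (3 * p)
      (.seq (move (3 * x + 1) (3 * t + 2) (t + 1)) (.seq (c.comp (t + 1))
        (.seq (.const (3 * (t + 1) + 2) 1) (.arith .add (3 * t + 2) (3 * t + 2) (3 * (t + 1) + 2))))))

/-! ### Sizes of numbers -/

/-- Declared sizes: a number of size `d` is at most `N ^ d`. -/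
structure Degs where
  par : ℕ → ℕ
  var : ℕ → ℕ
  arr : ℕ → ℕ

def Expr.deg (Δ : Degs) : Expr → ℕ
  | par i => Δ.par i
  | var i => Δ.var i
  | const c => c
  | bin .add a b => max (a.deg Δ) (b.deg Δ) + 1
  | bin .sub a _ => a.deg Δ
  | bin .mul a b => a.deg Δ + b.deg Δ
  | bin .div a _ => a.deg Δ
  | bin .mod a _ => a.deg Δ
  | modSucc _ b => b.deg Δ
  | load j _ => Δ.arr j
  | sel _ _ x y => max (x.deg Δ) (y.deg Δ)

/-- Every number that occurs in the evaluation has size less than `D`. -/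
def Expr.ok (Δ : Degs) (D : ℕ) : Expr → Bool
  | par i => Δ.par i < D
  | var i => Δ.var i < D
  | const c => c < D
  | bin o a b => a.ok Δ D && b.ok Δ D && decide ((bin o a b).deg Δ < D)
  | modSucc a b => a.ok Δ D && b.ok Δ D && decide (b.deg Δ + 1 < D)
  | load j e => e.ok Δ D && decide (j < 16) && decide (e.deg Δ + Δ.par 2 + 20 < D) &&
      decide (Δ.arr j < D)
  | sel a b x y => a.ok Δ D && b.ok Δ D && x.ok Δ D && y.ok Δ D

def Cmd.ok (Δ : Degs) (D : ℕ) : Cmd → Bool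
  | assign x e => e.ok Δ D && decide (e.deg Δ ≤ Δ.var x)
  | store j a e => a.ok Δ D && e.ok Δ D && decide (j < 16) &&
      decide (a.deg Δ + Δ.par 2 + 20 < D) && decide (e.deg Δ ≤ Δ.arr j)
  | seq c d => c.ok Δ D && d.ok Δ D
  | loop x p c => decide (Δ.par p ≤ Δ.var x) && decide (Δ.par p < D) && c.ok Δ D

/-- The numbers in a state have the declared sizes. -/
structure Bdd (Δ : Degs) (N : ℕ) (ρ : ℕ → ℕ) (st : St) : Prop where
  par : ∀ i, ρ i ≤ N ^ Δ.par i
  var : ∀ i, st.var i ≤ N ^ Δ.var i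
  arr : ∀ j i, st.arr j i ≤ N ^ Δ.arr j

/-- The assumption `2 ≤ N` is what makes degrees work: one more degree absorbs the factor 2 of a
sum, and a constant satisfies `c ≤ 2 ^ c ≤ N ^ c`. -/
theorem Expr.eval_le {Δ : Degs} {N : ℕ} (hN : 2 ≤ N) {ρ : ℕ → ℕ} {st : St} (h : Bdd Δ N ρ st) :
    ∀ e : Expr, e.eval ρ st ≤ N ^ e.deg Δ := by
  intro e
  have pw : ∀ {a b : ℕ}, a ≤ b → N ^ a ≤ N ^ b := fun h => Nat.pow_le_pow_right (by omega) h
  induction e with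
  | par i => exact h.par i
  | var i => exact h.var i
  | const c => exact (Nat.lt_two_pow_self).le.trans (Nat.pow_le_pow_left hN c)
  | bin o a b iha ihb =>
    cases o with
    | add =>
      simp only [eval, deg, ArithOp.eval, pow_succ]
      have h1 := iha.trans (pw (le_max_left (a.deg Δ) (b.deg Δ)))
      have h2 := ihb.trans (pw (le_max_right (a.deg Δ) (b.deg Δ)))
      nlinarith
    | sub => exact (Nat.sub_le _ _).trans iha
    | mul => simp only [eval, deg, ArithOp.eval, pow_add]; exact Nat.mul_le_mul iha ihb
    | div => exact (Nat.div_le_self _ _).trans iha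
    | mod => exact (Nat.mod_le _ _).trans iha
  | modSucc a b iha ihb =>
    exact (Nat.lt_succ_iff.mp (Nat.mod_lt _ (Nat.succ_pos _))).trans ihb
  | load j e _ => exact h.arr _ _
  | sel a b x y _ _ ihx ihy =>
    simp only [eval, deg]
    split_ifs
    · exact ihx.trans (pw (le_max_left _ _))
    · exact ihy.trans (pw (le_max_right _ _))

/-! ### Correctness of the compilation -/

/-- The machine state `σ` represents the parameters `ρ` and the state `st`. -/
structure Match (ρ : ℕ → ℕ) (st : St) (σ : State) : Prop where
  par : ∀ i, σ.reg (3 * i) = ρ i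
  var : ∀ i, σ.reg (3 * i + 1) = st.var i
  mem : ∀ j < 16, ∀ i, σ.mem (addr (ρ 2) j i) = st.arr j (ix (ρ 2) j i)

/-- Only temporaries from `t` on differ. -/
def Keeps (t : ℕ) (σ σ' : State) : Prop :=
  ∀ r, (r % 3 = 2 → r < 3 * t + 2) → σ'.reg r = σ.reg r

theorem Keeps.trans {t t' : ℕ} {σ σ₁ σ₂ : State} (h₁ : Keeps t σ σ₁) (h₂ : Keeps t' σ₁ σ₂)
    (h : t ≤ t') : Keeps t σ σ₂ :=
  fun r hr => (h₂ r fun h3 => (hr h3).trans_le (by omega)).trans (h₁ r hr)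

theorem Keeps.setReg {t t' : ℕ} (σ : State) (v : ℕ) (h : t ≤ t') :
    Keeps t σ (σ.setReg (3 * t' + 2) v) := by
  intro r hr
  simp only [State.setReg]
  rw [Function.update_of_ne]
  rintro rfl
  have := hr (by omega)
  omega

theorem Match.of_keeps {ρ : ℕ → ℕ} {st : St} {σ σ' : State} {t : ℕ} (h : Match ρ st σ)
    (hk : Keeps t σ σ') (hm : σ'.mem = σ.mem) : Match ρ st σ' where
  par i := by rw [hk _ (by omega)]; exact h.par i
  var i := by rw [hk _ (by omega)]; exact h.var i
  mem := by rw [hm]; exact h.mem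

theorem Runs.seq {w : ℕ} {p q : Prog} {σ σ₁ σ₂ : State} {T₁ T₂ : ℕ} (h₁ : Runs w p σ T₁ σ₁)
    (h₂ : Runs w q σ₁ T₂ σ₂) : Runs w (.seq p q) σ (T₁ + T₂) σ₂ := by
  obtain ⟨a, ha, h₁⟩ := h₁
  obtain ⟨b, hb, h₂⟩ := h₂
  exact ⟨a + b, by omega, .seq h₁ h₂⟩

theorem Runs.mono {w : ℕ} {p : Prog} {σ σ₁ : State} {T₁ T₂ : ℕ} (h₁ : Runs w p σ T₁ σ₁)
    (h : T₁ ≤ T₂) : Runs w p σ T₂ σ₁ := by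
  obtain ⟨a, ha, h₁⟩ := h₁
  exact ⟨a, by omega, h₁⟩

theorem Runs.of_exec {w : ℕ} {p : Prog} {σ σ₁ : State} {T : ℕ} (h : Exec w p σ T σ₁) :
    Runs w p σ T σ₁ := ⟨T, le_rfl, h⟩

theorem Runs.const {w : ℕ} (σ : State) (d c : ℕ) (h : c < 2 ^ w) :
    Runs w (.const d c) σ 1 (σ.setReg d c) := .of_exec (.const σ d c h)

theorem Runs.arith {w : ℕ} (σ : State) (o : ArithOp) (d a b : ℕ) {x y : ℕ} (hx : σ.reg a = x)
    (hy : σ.reg b = y) (h : o.eval x y < 2 ^ w) :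
    Runs w (.arith o d a b) σ 1 (σ.setReg d (o.eval x y)) := by
  subst hx hy
  exact .of_exec (.arith σ o d a b h)

theorem setReg_reg_self (σ : State) (d v : ℕ) : (σ.setReg d v).reg d = v := by simp [State.setReg]

theorem setReg_reg_ne (σ : State) {d r : ℕ} (v : ℕ) (h : r ≠ d) :
    (σ.setReg d v).reg r = σ.reg r := by simp [State.setReg, h]

theorem move_runs {w : ℕ} (σ : State) (d a t : ℕ) (ha : a ≠ 3 * t + 2)
    (h : σ.reg a < 2 ^ w) :
    Runs w (move d a t) σ 2 ((σ.setReg (3 * t + 2) 0).setReg d (σ.reg a)) := by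
  refine Runs.seq (T₁ := 1) (T₂ := 1) (.const σ _ 0 (by positivity)) ?_
  have := Runs.arith (w := w) (σ.setReg (3 * t + 2) 0) .add d a (3 * t + 2)
    (setReg_reg_ne σ 0 ha) (setReg_reg_self _ _ _) (by simpa [ArithOp.eval] using h)
  simpa [ArithOp.eval] using this

theorem toAddr_runs {w M : ℕ} (σ : State) (j t x : ℕ) (hx : σ.reg (3 * t + 2) = x)
    (hM : σ.reg 6 = M) (hj : j < 2 ^ w) (hw : 4 < w) (h : x * 16 + j + M < 2 ^ w) :
    ∃ σ', Runs w (toAddr j t) σ 5 σ' ∧ σ'.reg (3 * t + 2) = addr M j x ∧ σ'.mem = σ.mem ∧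
      Keeps t σ σ' := by
  unfold toAddr addr
  split_ifs with h0
  · refine ⟨_, (Runs.arith σ .mod _ _ _ hx hM ?_).mono (by omega), setReg_reg_self _ _ _, rfl,
      Keeps.setReg _ _ le_rfl⟩
    exact (Nat.mod_le _ _).trans_lt (by omega)
  · have h16 : 16 < 2 ^ w := by
      calc 16 < 2 ^ 5 := by norm_num
        _ ≤ 2 ^ w := Nat.pow_le_pow_right (by norm_num) hw
    set u := 3 * (t + 1) + 2
    set v := 3 * t + 2
    have huv : v ≠ u := by omega
    set σ₁ := σ.setReg u 16
    set σ₂ := σ₁.setReg v (x * 16)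
    set σ₃ := σ₂.setReg u j
    set σ₄ := σ₃.setReg v (x * 16 + j)
    set σ₅ := σ₄.setReg v (x * 16 + j + M)
    refine ⟨σ₅, ?_, setReg_reg_self _ _ _, rfl, ?_⟩
    · refine Runs.seq (T₁ := 1) (T₂ := 4) (.const _ _ _ h16) ?_
      refine Runs.seq (T₁ := 1) (T₂ := 3)
        (Runs.arith σ₁ .mul _ _ _ ((setReg_reg_ne _ _ huv).trans hx) (setReg_reg_self _ _ _)
          (show x * 16 < 2 ^ w by omega)) ?_
      refine Runs.seq (T₁ := 1) (T₂ := 2) (.const σ₂ _ _ hj) ?_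
      refine Runs.seq (T₁ := 1) (T₂ := 1)
        (Runs.arith σ₃ .add _ _ _ ((setReg_reg_ne _ _ huv).trans (setReg_reg_self _ _ _))
          (setReg_reg_self _ _ _) (show x * 16 + j < 2 ^ w by omega)) ?_
      refine Runs.arith σ₄ .add _ _ _ (setReg_reg_self _ _ _) ?_ h
      have hu6 : (6 : ℕ) ≠ u := by omega
      have hv6 : (6 : ℕ) ≠ v := by omega
      simp [σ₄, σ₃, σ₂, σ₁, State.setReg, hu6, hv6, hM]
    · exact ((((Keeps.setReg _ _ (Nat.le_succ t)).trans (Keeps.setReg _ _ le_rfl) le_rfl).trans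
        (Keeps.setReg _ _ (Nat.le_succ t)) le_rfl).trans (Keeps.setReg _ _ le_rfl) le_rfl).trans
        (Keeps.setReg _ _ le_rfl) le_rfl

theorem Expr.deg_lt_of_ok {Δ : Degs} {D : ℕ} : ∀ {e : Expr}, e.ok Δ D = true → e.deg Δ < D := by
  intro e
  induction e with
  | par | var | const => simp [ok, deg]
  | bin o a b _ _ => simp only [ok, Bool.and_eq_true, decide_eq_true_eq]; exact fun h => h.2
  | modSucc a b _ _ => simp only [ok, Bool.and_eq_true, decide_eq_true_eq, deg]; omega
  | load j e _ => simp only [ok, Bool.and_eq_true, decide_eq_true_eq, deg]; omega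
  | sel a b x y _ _ ihx ihy =>
    simp only [ok, Bool.and_eq_true, deg]
    exact fun h => max_lt (ihx h.1.2) (ihy h.2)

theorem addr_lt {N D x j M d d' : ℕ} (hN : 2 ≤ N) (hx : x ≤ N ^ d) (hM : M ≤ N ^ d') (hj : j < 16)
    (h : d + d' + 20 < D) : x * 16 + j + M < N ^ D := by
  have h1 : 1 ≤ N ^ d := Nat.one_le_pow _ _ (by omega)
  have h2 : 1 ≤ N ^ d' := Nat.one_le_pow _ _ (by omega)
  have h3 : 64 ≤ N ^ 6 := (by norm_num : 64 = 2 ^ 6).le.trans (Nat.pow_le_pow_left hN 6)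
  -- The crude factor 64 costs six of the twenty degrees of slack in `h`.
  calc x * 16 + j + M < 64 * (N ^ d * N ^ d') := by nlinarith
    _ ≤ N ^ 6 * (N ^ d * N ^ d') := Nat.mul_le_mul_right _ h3
    _ = N ^ (6 + (d + d')) := by rw [pow_add, pow_add]
    _ ≤ N ^ D := Nat.pow_le_pow_right (by omega) (by omega)

/-- Temporaries form a stack: a subexpression compiled at a higher level leaves the lower
temporaries alone, so operands already computed survive. Nothing overflows, since all values have
degree below `D` and a word holds every number below `N ^ D`. -/
theorem Expr.comp_runs {Δ : Degs} {N D w : ℕ} (hN : 2 ≤ N) (hw : N ^ D = 2 ^ w) (hw4 : 4 < w)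
    {ρ : ℕ → ℕ} {st : St} (hb : Bdd Δ N ρ st) :
    ∀ (e : Expr) (t : ℕ) (σ : State), e.ok Δ D = true → Match ρ st σ →
      ∃ σ', Runs w (e.comp t) σ e.cost σ' ∧ σ'.reg (3 * t + 2) = e.eval ρ st ∧ σ'.mem = σ.mem ∧
        Keeps t σ σ' := by
  have lt : ∀ e : Expr, e.ok Δ D = true → e.eval ρ st < 2 ^ w := by
    intro e he
    rw [← hw]
    exact (e.eval_le hN hb).trans_lt (Nat.pow_lt_pow_right hN (deg_lt_of_ok he))
  have h16 : 16 < 2 ^ w := by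
    calc 16 < 2 ^ 5 := by norm_num
      _ ≤ 2 ^ w := Nat.pow_le_pow_right (by norm_num) hw4
  have mv : ∀ (σ : State) (a t u : ℕ), t < u → a ≠ 3 * u + 2 → σ.reg a < 2 ^ w →
      ∃ σ', Runs w (move (3 * t + 2) a u) σ 2 σ' ∧ σ'.reg (3 * t + 2) = σ.reg a ∧
        σ'.mem = σ.mem ∧ Keeps t σ σ' := fun σ a t u htu ha h =>
    ⟨_, move_runs σ _ a u ha h, setReg_reg_self _ _ _, rfl,
      (Keeps.setReg _ _ htu.le).trans (Keeps.setReg _ _ le_rfl) le_rfl⟩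
  intro e
  induction e with
  | par i =>
    intro t σ he hm
    obtain ⟨σ', h1, h2, h3⟩ := mv σ (3 * i) t (t + 1) (by omega) (by omega)
      (by rw [hm.par]; exact lt _ he)
    exact ⟨σ', h1, h2.trans (hm.par i), h3⟩
  | var i =>
    intro t σ he hm
    obtain ⟨σ', h1, h2, h3⟩ := mv σ (3 * i + 1) t (t + 1) (by omega) (by omega)
      (by rw [hm.var]; exact lt _ he)
    exact ⟨σ', h1, h2.trans (hm.var i), h3⟩
  | const c =>
    intro t σ he hm
    exact ⟨_, .const σ _ c (lt _ he), setReg_reg_self _ _ _, rfl, Keeps.setReg _ _ le_rfl⟩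
  | bin o a b iha ihb =>
    intro t σ he hm
    have he' := he
    simp only [ok, Bool.and_eq_true] at he'
    obtain ⟨σ₁, r1, v1, m1, k1⟩ := iha t σ he'.1.1 hm
    obtain ⟨σ₂, r2, v2, m2, k2⟩ := ihb (t + 1) σ₁ he'.1.2 (hm.of_keeps k1 m1)
    refine ⟨_, ((r1.seq (r2.seq (Runs.arith σ₂ o _ _ _ ((k2 _ (by omega)).trans v1) v2
      (lt _ he)))).mono ?_), setReg_reg_self _ _ _, m2.trans m1, ?_⟩
    · simp only [cost]; omega
    · exact (k1.trans k2 (by omega)).trans (Keeps.setReg _ _ le_rfl) le_rfl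
  | modSucc a b iha ihb =>
    intro t σ he hm
    have he' := he
    simp only [ok, Bool.and_eq_true, decide_eq_true_eq] at he'
    obtain ⟨σ₁, r1, v1, m1, k1⟩ := iha t σ he'.1.1 hm
    obtain ⟨σ₂, r2, v2, m2, k2⟩ := ihb (t + 1) σ₁ he'.1.2 (hm.of_keeps k1 m1)
    have hb1 : b.eval ρ st + 1 < 2 ^ w := by
      rw [← hw]
      have h1 := b.eval_le hN hb
      have h2 : N ^ (b.deg Δ) + 1 ≤ N ^ (b.deg Δ + 1) := by
        have : 1 ≤ N ^ (b.deg Δ) := Nat.one_le_pow _ _ (by omega)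
        rw [pow_succ]; nlinarith
      have h3 := Nat.pow_lt_pow_right hN he'.2
      omega
    set σ₃ := σ₂.setReg (3 * (t + 2) + 2) 1
    set σ₄ := σ₃.setReg (3 * (t + 1) + 2) (b.eval ρ st + 1)
    have r3 : Runs w _ σ₂ 1 σ₃ := Runs.const σ₂ (3 * (t + 2) + 2) 1 (by omega)
    have r4 : Runs w _ σ₃ 1 σ₄ := Runs.arith σ₃ .add (3 * (t + 1) + 2) (3 * (t + 1) + 2) _
      ((setReg_reg_ne _ _ (by omega)).trans v2) (setReg_reg_self _ _ _) hb1
    have k3 : Keeps (t + 1) σ₂ σ₃ := Keeps.setReg _ _ (by omega)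
    have k4 : Keeps (t + 1) σ₃ σ₄ := Keeps.setReg _ _ le_rfl
    refine ⟨_, (r1.seq (r2.seq (r3.seq (r4.seq (Runs.arith σ₄ .mod _ _ _ (x := a.eval ρ st)
      (y := b.eval ρ st + 1) ?_ (setReg_reg_self _ _ _) (lt _ he)))))).mono ?_,
      setReg_reg_self _ _ _, m2.trans m1, ?_⟩
    · rw [k4 _ (by omega), k3 _ (by omega), k2 _ (by omega), v1]
    · simp only [cost]; omega
    · exact (((k1.trans k2 (by omega)).trans k3 (by omega)).trans k4 (by omega)).trans
        (Keeps.setReg _ _ le_rfl) le_rfl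
  | load j e ihe =>
    intro t σ he hm
    have he' := he
    simp only [ok, Bool.and_eq_true, decide_eq_true_eq] at he'
    obtain ⟨⟨⟨h1, h2⟩, h3⟩, h4⟩ := he'
    obtain ⟨σ₁, r1, v1, m1, k1⟩ := ihe t σ h1 hm
    have hm1 := hm.of_keeps k1 m1
    obtain ⟨σ₂, r2, v2, m2, k2⟩ := toAddr_runs (w := w) (M := ρ 2) σ₁ j t _ v1 (hm1.par 2)
      (by omega) hw4 (by rw [← hw]; exact addr_lt hN (e.eval_le hN hb) (hb.par 2) h2 h3)
    refine ⟨_, (r1.seq (r2.seq (.of_exec (.load σ₂ _ _)))).mono ?_, ?_, m2.trans m1, ?_⟩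
    · simp only [cost]; omega
    · rw [setReg_reg_self, v2, m2, hm1.mem j h2]; rfl
    · exact (k1.trans k2 le_rfl).trans (Keeps.setReg _ _ le_rfl) le_rfl
  -- Both alternatives are evaluated before the comparison, so both have to fit into words.
  | sel a b x y iha ihb ihx ihy =>
    intro t σ he hm
    have he' := he
    simp only [ok, Bool.and_eq_true] at he'
    obtain ⟨⟨⟨ha, hb'⟩, hx⟩, hy⟩ := he'
    obtain ⟨σ₁, r1, v1, m1, k1⟩ := iha t σ ha hm
    have hm1 := hm.of_keeps k1 m1
    obtain ⟨σ₂, r2, v2, m2, k2⟩ := ihb (t + 1) σ₁ hb' hm1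
    have hm2 := hm1.of_keeps k2 m2
    obtain ⟨σ₃, r3, v3, m3, k3⟩ := ihx (t + 2) σ₂ hx hm2
    have hm3 := hm2.of_keeps k3 m3
    obtain ⟨σ₄, r4, v4, m4, k4⟩ := ihy (t + 3) σ₃ hy hm3
    have ea : σ₄.reg (3 * t + 2) = a.eval ρ st := by
      rw [k4 _ (by omega), k3 _ (by omega), k2 _ (by omega), v1]
    have eb : σ₄.reg (3 * (t + 1) + 2) = b.eval ρ st := by
      rw [k4 _ (by omega), k3 _ (by omega), v2]
    have ex : σ₄.reg (3 * (t + 2) + 2) = x.eval ρ st := by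
      rw [k4 _ (by omega), v3]
    have k : Keeps t σ σ₄ :=
      ((k1.trans k2 (by omega)).trans k3 (by omega)).trans k4 (by omega)
    have m : σ₄.mem = σ.mem := m4.trans (m3.trans (m2.trans m1))
    have fin : ∃ σ₅, Runs w (.ite (3 * t + 2) (3 * (t + 1) + 2)
        (move (3 * t + 2) (3 * (t + 2) + 2) (t + 4)) (move (3 * t + 2) (3 * (t + 3) + 2) (t + 4)))
        σ₄ 3 σ₅ ∧ σ₅.reg (3 * t + 2) = (sel a b x y).eval ρ st ∧ σ₅.mem = σ₄.mem ∧
        Keeps t σ₄ σ₅ := by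
      by_cases hab : a.eval ρ st < b.eval ρ st
      · obtain ⟨σ₅, ⟨T, hT, r⟩, v, h⟩ := mv σ₄ (3 * (t + 2) + 2) t (t + 4) (by omega) (by omega)
          (by rw [ex]; exact lt _ hx)
        exact ⟨σ₅, ⟨T + 1, by omega, .ite_true (by rwa [ea, eb]) r⟩,
          by rw [v, ex]; simp [eval, hab], h⟩
      · obtain ⟨σ₅, ⟨T, hT, r⟩, v, h⟩ := mv σ₄ (3 * (t + 3) + 2) t (t + 4) (by omega) (by omega)
          (by rw [v4]; exact lt _ hy)
        exact ⟨σ₅, ⟨T + 1, by omega, .ite_false (by rwa [ea, eb]) r⟩,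
          by rw [v, v4]; simp [eval, hab], h⟩
    obtain ⟨σ₅, r5, v5, m5, k5⟩ := fin
    refine ⟨σ₅, (r1.seq (r2.seq (r3.seq (r4.seq r5)))).mono ?_, v5, m5.trans m,
      k.trans k5 le_rfl⟩
    simp only [cost]; omega

end ForProg

/-! ### Running times as monomials, and simulation of whole programs -/

namespace ForProg
open WordRAM

/-- The monomial `c n^n' L^L' K^K' k^k'` in four base quantities. -/
structure Mono where
  c : ℕ
  en : ℕ
  eL : ℕ
  eK : ℕ
  ek : ℕ

/-- The four base quantities. -/
structure Bases where
  n : ℕ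
  L : ℕ
  K : ℕ
  k : ℕ
  n_pos : 1 ≤ n
  L_pos : 1 ≤ L
  K_pos : 1 ≤ K
  k_pos : 1 ≤ k

def Mono.val (b : Bases) (m : Mono) : ℕ := m.c * (b.n ^ m.en * b.L ^ m.eL * b.K ^ m.eK * b.k ^ m.ek)

/-- A bound on the running time, given bounds `lim` on the numbers of iterations of the loops. -/
def Cmd.cost (lim : ℕ → Mono) : Cmd → Mono
  | assign _ e => ⟨e.cost + 2, 0, 0, 0, 0⟩
  | store _ a e => ⟨a.cost + e.cost + 6, 0, 0, 0, 0⟩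
  | seq c d => ⟨(c.cost lim).c + (d.cost lim).c, max (c.cost lim).en (d.cost lim).en,
      max (c.cost lim).eL (d.cost lim).eL, max (c.cost lim).eK (d.cost lim).eK,
      max (c.cost lim).ek (d.cost lim).ek⟩
  | loop _ p c => ⟨(lim p).c * ((c.cost lim).c + 5) + 2, (lim p).en + (c.cost lim).en,
      (lim p).eL + (c.cost lim).eL, (lim p).eK + (c.cost lim).eK, (lim p).ek + (c.cost lim).ek⟩

theorem Mono.val_le_of_le (b : Bases) {m m' : Mono} (hc : m.c ≤ m'.c) (hn : m.en ≤ m'.en)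
    (hL : m.eL ≤ m'.eL) (hK : m.eK ≤ m'.eK) (hk : m.ek ≤ m'.ek) : m.val b ≤ m'.val b := by
  unfold Mono.val
  refine Nat.mul_le_mul hc ?_
  have h1 := Nat.pow_le_pow_right b.n_pos hn
  have h2 := Nat.pow_le_pow_right b.L_pos hL
  have h3 := Nat.pow_le_pow_right b.K_pos hK
  have h4 := Nat.pow_le_pow_right b.k_pos hk
  gcongr

/-- Taking the maximum of each exponent is sound because all bases are at least 1. -/
theorem Cmd.val_cost_seq (b : Bases) (lim : ℕ → Mono) (c d : Cmd) :
    (c.cost lim).val b + (d.cost lim).val b ≤ ((c.seq d).cost lim).val b := by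
  have h1 : (c.cost lim).val b ≤ Mono.val b ⟨(c.cost lim).c, ((c.seq d).cost lim).en,
      ((c.seq d).cost lim).eL, ((c.seq d).cost lim).eK, ((c.seq d).cost lim).ek⟩ :=
    Mono.val_le_of_le b le_rfl (le_max_left _ _) (le_max_left _ _) (le_max_left _ _)
      (le_max_left _ _)
  have h2 : (d.cost lim).val b ≤ Mono.val b ⟨(d.cost lim).c, ((c.seq d).cost lim).en,
      ((c.seq d).cost lim).eL, ((c.seq d).cost lim).eK, ((c.seq d).cost lim).ek⟩ :=
    Mono.val_le_of_le b le_rfl (le_max_right _ _) (le_max_right _ _) (le_max_right _ _)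
      (le_max_right _ _)
  refine (Nat.add_le_add h1 h2).trans (le_of_eq ?_)
  simp only [Mono.val, Cmd.cost]
  ring

/-- An iteration has an overhead of 5: one test, two steps to copy the counter into the loop
variable, two to increment it. The final 2 pays for the initialization and the last test. -/
theorem Cmd.val_cost_loop (b : Bases) (lim : ℕ → Mono) (x p : ℕ) (c : Cmd) {r : ℕ}
    (hr : r ≤ (lim p).val b) :
    r * ((c.cost lim).val b + 5) + 2 ≤ ((Cmd.loop x p c).cost lim).val b := by
  have mon : ∀ m : Mono, 1 ≤ b.n ^ m.en * b.L ^ m.eL * b.K ^ m.eK * b.k ^ m.ek := fun m => by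
    have h1 := Nat.one_le_pow m.en _ b.n_pos
    have h2 := Nat.one_le_pow m.eL _ b.L_pos
    have h3 := Nat.one_le_pow m.eK _ b.K_pos
    have h4 := Nat.one_le_pow m.ek _ b.k_pos
    exact Nat.mul_pos (Nat.mul_pos (Nat.mul_pos h1 h2) h3) h4
  have h1 := mon (lim p)
  have h2 := mon (c.cost lim)
  have e : ((Cmd.loop x p c).cost lim).val b = ((lim p).c * ((c.cost lim).c + 5) + 2) *
      ((b.n ^ (lim p).en * b.L ^ (lim p).eL * b.K ^ (lim p).eK * b.k ^ (lim p).ek) *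
       (b.n ^ (c.cost lim).en * b.L ^ (c.cost lim).eL * b.K ^ (c.cost lim).eK *
        b.k ^ (c.cost lim).ek)) := by
    simp only [Mono.val, Cmd.cost, pow_add]
    ring
  rw [e]
  unfold Mono.val at hr ⊢
  set P := b.n ^ (lim p).en * b.L ^ (lim p).eL * b.K ^ (lim p).eK * b.k ^ (lim p).ek
  set Q := b.n ^ (c.cost lim).en * b.L ^ (c.cost lim).eL * b.K ^ (c.cost lim).eK *
        b.k ^ (c.cost lim).ek
  have h3 : (c.cost lim).c * Q + 5 ≤ ((c.cost lim).c + 5) * Q := by nlinarith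
  have h4 : 1 ≤ P * Q := Nat.mul_pos h1 h2
  calc r * ((c.cost lim).c * Q + 5) + 2 ≤ ((lim p).c * P) * (((c.cost lim).c + 5) * Q) + 2 := by
        gcongr
    _ ≤ _ := by nlinarith

theorem Bdd.setVar {Δ : Degs} {N : ℕ} {ρ : ℕ → ℕ} {st : St} (h : Bdd Δ N ρ st) {x v : ℕ}
    (hv : v ≤ N ^ Δ.var x) : Bdd Δ N ρ (st.setVar x v) where
  par := h.par
  var i := by
    simp only [St.setVar, Function.update_apply]
    split_ifs with hi
    · rw [hi]; exact hv
    · exact h.var i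
  arr := h.arr

theorem Bdd.setArr {Δ : Degs} {N : ℕ} {ρ : ℕ → ℕ} {st : St} (h : Bdd Δ N ρ st) {j i v : ℕ}
    (hv : v ≤ N ^ Δ.arr j) : Bdd Δ N ρ (st.setArr j i v) where
  par := h.par
  var := h.var
  arr j' i' := by
    simp only [St.setArr, Function.update_apply]
    split_ifs with hj
    · subst hj
      rw [Function.update_apply]
      split_ifs
      · exact hv
      · exact h.arr _ _
    · exact h.arr _ _

theorem Match.setVar {ρ : ℕ → ℕ} {st : St} {σ : State} (h : Match ρ st σ) (x v : ℕ) :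
    Match ρ (st.setVar x v) (σ.setReg (3 * x + 1) v) where
  par i := (setReg_reg_ne _ _ (by omega)).trans (h.par i)
  var i := by
    simp only [St.setVar, State.setReg, Function.update_apply]
    by_cases hi : i = x
    · simp [hi]
    · rw [if_neg (by omega), if_neg hi]; exact h.var i
  mem := h.mem

/-- Array 0 occupies the cells below `M`; above `M` the other arrays are interleaved with stride 16,
so the residue modulo 16 tells them apart. -/
theorem addr_inj {M : ℕ} (hM : 0 < M) {j j' : ℕ} (hj : j < 16) (hj' : j' < 16) {i i' : ℕ}
    (h : addr M j i = addr M j' i') : j = j' ∧ ix M j i = ix M j' i' := by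
  have h1 := Nat.mod_lt i hM
  have h2 := Nat.mod_lt i' hM
  unfold addr at h
  unfold ix
  split_ifs at h ⊢ <;> omega

theorem Match.setArr {ρ : ℕ → ℕ} {st : St} {σ : State} (h : Match ρ st σ) (hM : 0 < ρ 2) {j : ℕ}
    (hj : j < 16) (i v : ℕ) :
    Match ρ (st.setArr j (ix (ρ 2) j i) v) (σ.setMem (addr (ρ 2) j i) v) where
  par := h.par
  var := h.var
  mem j' hj' i' := by
    simp only [St.setArr, State.setMem, Function.update_apply]
    by_cases ha : addr (ρ 2) j' i' = addr (ρ 2) j i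
    · obtain ⟨rfl, hi⟩ := addr_inj hM hj' hj ha
      rw [if_pos ha, if_pos rfl, Function.update_apply, if_pos hi]
    · rw [if_neg ha, h.mem j' hj' i']
      split_ifs with hjj
      · subst hjj
        rw [Function.update_of_ne]
        intro hi
        apply ha
        unfold addr
        unfold ix at hi
        split_ifs at hi ⊢ <;> omega
      · rfl

/-- A well-sized program never overflows, and its compilation simulates it within its cost. -/
theorem Cmd.comp_runs {Δ : Degs} {N D w : ℕ} (hN : 2 ≤ N) (hw : N ^ D = 2 ^ w) (hw4 : 4 < w)
    {ρ : ℕ → ℕ} (hM : 0 < ρ 2) (b : Bases) {lim : ℕ → Mono} (hlim : ∀ p, ρ p ≤ (lim p).val b) :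
    ∀ (c : Cmd) (t : ℕ) (st : St) (σ : State), c.ok Δ D = true → Bdd Δ N ρ st → Match ρ st σ →
      ∃ σ', Runs w (c.comp t) σ ((c.cost lim).val b) σ' ∧ Match ρ (c.run ρ st) σ' ∧
        Bdd Δ N ρ (c.run ρ st) ∧ ∀ i < t, σ'.reg (3 * i + 2) = σ.reg (3 * i + 2) := by
  have h16 : 16 < 2 ^ w := by
    calc 16 < 2 ^ 5 := by norm_num
      _ ≤ 2 ^ w := Nat.pow_le_pow_right (by norm_num) hw4
  have lt : ∀ {d x}, x ≤ N ^ d → d < D → x < 2 ^ w := fun h h' => by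
    rw [← hw]; exact h.trans_lt (Nat.pow_lt_pow_right hN h')
  have pw : ∀ {a b : ℕ}, a ≤ b → N ^ a ≤ N ^ b := fun h => Nat.pow_le_pow_right (by omega) h
  intro c
  induction c with
  | assign x e =>
    intro t st σ hok hb hm
    simp only [ok, Bool.and_eq_true, decide_eq_true_eq] at hok
    obtain ⟨σ₁, r1, v1, m1, k1⟩ := e.comp_runs hN hw hw4 hb t σ hok.1 hm
    refine ⟨_, (r1.seq (move_runs σ₁ (3 * x + 1) (3 * t + 2) (t + 1) (by omega) ?_)).mono ?_,
      ?_, hb.setVar ((e.eval_le hN hb).trans (pw hok.2)), ?_⟩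
    · rw [v1]; exact lt (e.eval_le hN hb) (Expr.deg_lt_of_ok hok.1)
    · simp [cost, Mono.val]
    · rw [v1]
      exact ((hm.of_keeps k1 m1).of_keeps (Keeps.setReg _ _ le_rfl) rfl).setVar _ _
    · intro i hi
      rw [setReg_reg_ne _ _ (by omega), setReg_reg_ne _ _ (by omega), k1 _ (by omega)]
  | store j a e =>
    intro t st σ hok hb hm
    simp only [ok, Bool.and_eq_true, decide_eq_true_eq] at hok
    obtain ⟨⟨⟨⟨ha, he⟩, hj⟩, hd⟩, hd'⟩ := hok
    obtain ⟨σ₁, r1, v1, m1, k1⟩ := a.comp_runs hN hw hw4 hb t σ ha hm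
    have hm1 := hm.of_keeps k1 m1
    obtain ⟨σ₂, r2, v2, m2, k2⟩ := toAddr_runs (w := w) (M := ρ 2) σ₁ j t _ v1 (hm1.par 2)
      (by omega) hw4 (by rw [← hw]; exact addr_lt hN (a.eval_le hN hb) (hb.par 2) hj hd)
    have hm2 := hm1.of_keeps k2 m2
    obtain ⟨σ₃, r3, v3, m3, k3⟩ := e.comp_runs hN hw hw4 hb (t + 1) σ₂ he hm2
    have hm3 := hm2.of_keeps k3 m3
    have e1 : σ₃.reg (3 * t + 2) = addr (ρ 2) j (a.eval ρ st) := by rw [k3 _ (by omega), v2]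
    refine ⟨_, (r1.seq (r2.seq (r3.seq (.of_exec (.store σ₃ _ _))))).mono ?_, ?_,
      hb.setArr ((e.eval_le hN hb).trans (pw hd')), ?_⟩
    · simp only [cost, Mono.val, pow_zero]; omega
    · rw [e1, v3]; exact hm3.setArr hM hj _ _
    · intro i hi
      exact (k3 _ (by omega)).trans ((k2 _ (by omega)).trans (k1 _ (by omega)))
  | seq c d ihc ihd =>
    intro t st σ hok hb hm
    simp only [ok, Bool.and_eq_true] at hok
    obtain ⟨σ₁, r1, m1, b1, k1⟩ := ihc t st σ hok.1 hb hm
    obtain ⟨σ₂, r2, m2, b2, k2⟩ := ihd t _ σ₁ hok.2 b1 m1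
    exact ⟨σ₂, (r1.seq r2).mono (val_cost_seq b lim c d), m2, b2,
      fun i hi => (k2 i hi).trans (k1 i hi)⟩
  | loop x p c ih =>
    intro t st σ hok hb hm
    simp only [ok, Bool.and_eq_true, decide_eq_true_eq] at hok
    obtain ⟨⟨hd, hD⟩, hc⟩ := hok
    have hp : ρ p < 2 ^ w := lt (hb.par p) hD
    -- Induction on the number `r` of iterations still to come. The counter is temporary `t`, which
    -- the body, compiled at level `t + 1`, cannot touch; the loop variable is only a copy of it.
    have key : ∀ r i, r + i = ρ p → ∀ σ : State,
        Match ρ (iter (fun i s => c.run ρ (s.setVar x i)) st i) σ →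
        Bdd Δ N ρ (iter (fun i s => c.run ρ (s.setVar x i)) st i) → σ.reg (3 * t + 2) = i →
        ∃ σ', Runs w (.loop (3 * t + 2) (3 * p)
          (.seq (move (3 * x + 1) (3 * t + 2) (t + 1)) (.seq (c.comp (t + 1))
            (.seq (.const (3 * (t + 1) + 2) 1)
              (.arith .add (3 * t + 2) (3 * t + 2) (3 * (t + 1) + 2)))))) σ
          (r * ((c.cost lim).val b + 5) + 1) σ' ∧
          Match ρ (iter (fun i s => c.run ρ (s.setVar x i)) st (ρ p)) σ' ∧
          Bdd Δ N ρ (iter (fun i s => c.run ρ (s.setVar x i)) st (ρ p)) ∧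
          ∀ i < t, σ'.reg (3 * i + 2) = σ.reg (3 * i + 2) := by
      intro r
      induction r with
      | zero =>
        intro i hi σ hm hb hr
        have hi' : i = ρ p := by omega
        subst hi'
        exact ⟨σ, ⟨1, by omega, .loop_false (by rw [hr, hm.par]; omega)⟩, hm, hb, fun _ _ => rfl⟩
      | succ r ihr =>
        intro i hi σ hm hb hr
        set s := iter (fun i s => c.run ρ (s.setVar x i)) st i with hs
        have hiN : i ≤ N ^ Δ.var x := (by omega : i ≤ ρ p).trans ((hb.par p).trans (pw hd))
        have r1 := move_runs (w := w) σ (3 * x + 1) (3 * t + 2) (t + 1) (by omega) (by omega)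
        set σ₁ := (σ.setReg (3 * (t + 1) + 2) 0).setReg (3 * x + 1) (σ.reg (3 * t + 2)) with hσ₁
        have hm1 : Match ρ (s.setVar x i) σ₁ := by
          rw [hσ₁, hr]
          exact (hm.of_keeps (Keeps.setReg _ _ le_rfl) rfl).setVar _ _
        obtain ⟨σ₂, r2, m2, b2, k2⟩ := ih (t + 1) _ σ₁ hc (hb.setVar hiN) hm1
        have r3 : Runs w _ σ₂ 1 _ := Runs.const σ₂ (3 * (t + 1) + 2) 1 (by omega)
        set σ₃ := σ₂.setReg (3 * (t + 1) + 2) 1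
        have e3 : σ₃.reg (3 * t + 2) = i := by
          rw [setReg_reg_ne _ _ (by omega), k2 t (by omega), hσ₁, setReg_reg_ne _ _ (by omega),
            setReg_reg_ne _ _ (by omega), hr]
        have r4 := Runs.arith (w := w) σ₃ .add (3 * t + 2) (3 * t + 2) (3 * (t + 1) + 2) e3
          (setReg_reg_self _ _ _) (show i + 1 < 2 ^ w by omega)
        set σ₄ := σ₃.setReg (3 * t + 2) (ArithOp.add.eval i 1)
        have hm4 : Match ρ (iter (fun i s => c.run ρ (s.setVar x i)) st (i + 1)) σ₄ :=
          m2.of_keeps ((Keeps.setReg (t := t) _ _ (Nat.le_succ t)).trans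
            (Keeps.setReg _ _ le_rfl) le_rfl) rfl
        obtain ⟨σ₅, ⟨T, hT, r5⟩, m5, b5, k5⟩ := ihr (i + 1) (by omega) σ₄ hm4 b2
          (setReg_reg_self _ _ _)
        obtain ⟨T', hT', r6⟩ := r1.seq (r2.seq (r3.seq r4))
        refine ⟨σ₅, ⟨T' + T + 1, ?_, .loop_true (by rw [hr, hm.par]; omega) r6 r5⟩, m5, b5, ?_⟩
        · have : (r + 1) * ((c.cost lim).val b + 5) + 1 =
            (r * ((c.cost lim).val b + 5) + 1) + ((c.cost lim).val b + 5) := by ring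
          omega
        · intro l hl
          rw [k5 l hl, setReg_reg_ne _ _ (by omega), setReg_reg_ne _ _ (by omega),
            k2 l (by omega), hσ₁, setReg_reg_ne _ _ (by omega), setReg_reg_ne _ _ (by omega)]
    obtain ⟨σ₁, r1, m1, b1, k1⟩ := key (ρ p) 0 (by omega) (σ.setReg (3 * t + 2) 0)
      (hm.of_keeps (Keeps.setReg _ _ le_rfl) rfl) hb (setReg_reg_self _ _ _)
    refine ⟨σ₁, ((Runs.const σ (3 * t + 2) 0 (by omega)).seq r1).mono ?_, m1, b1, ?_⟩
    · have := val_cost_loop b lim x p c (hlim p)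
      omega
    · intro i hi
      rw [k1 i hi, setReg_reg_ne _ _ (by omega)]

/-- Setting a parameter. -/
theorem setPar_runs {Δ : Degs} {N D w : ℕ} (hN : 2 ≤ N) (hw : N ^ D = 2 ^ w) (hw4 : 4 < w)
    {ρ : ℕ → ℕ} {st : St} {σ : State} (hb : Bdd Δ N ρ st) (hm : Match ρ st σ) (p : ℕ) (hp : p ≠ 2)
    (e : Expr) (he : e.ok Δ D = true) (hd : e.deg Δ ≤ Δ.par p) :
    ∃ σ', Runs w (.seq (e.comp 0) (move (3 * p) 2 1)) σ (e.cost + 2) σ' ∧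
      Match (Function.update ρ p (e.eval ρ st)) st σ' ∧
      Bdd Δ N (Function.update ρ p (e.eval ρ st)) st := by
  obtain ⟨σ₁, r1, v1, m1, k1⟩ := e.comp_runs hN hw hw4 hb 0 σ he hm
  have hle := e.eval_le hN hb
  have v1 : σ₁.reg 2 = e.eval ρ st := v1
  have hm1 := hm.of_keeps k1 m1
  refine ⟨_, r1.seq (move_runs σ₁ (3 * p) 2 1 (by omega) ?_), ⟨fun i => ?_, fun i => ?_, ?_⟩,
    ⟨fun i => ?_, hb.var, hb.arr⟩⟩
  · rw [v1, ← hw]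
    exact hle.trans_lt (Nat.pow_lt_pow_right hN (Expr.deg_lt_of_ok he))
  · rw [v1, Function.update_apply]
    simp only [State.setReg, Function.update_apply]
    by_cases h : i = p
    · simp [h]
    · rw [if_neg (by omega), if_neg (by omega), if_neg h]; exact hm1.par i
  · rw [setReg_reg_ne _ _ (by omega), setReg_reg_ne _ _ (by omega)]; exact hm1.var i
  -- Parameter 2 fixes the layout of the memory, which is why it may not be changed here.
  · rw [Function.update_of_ne (Ne.symm hp)]
    exact hm1.mem
  · rw [Function.update_apply]
    split_ifs with h
    · rw [h]; exact hle.trans (Nat.pow_le_pow_right (by omega) hd)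
    · exact hb.par i

end ForProg

namespace TExp

open Finset

/-! ## Vandermonde minors and sums of their squares -/

section Minors

variable {S : Type*} [CommRing S]

/-- The coefficient of the minor on the rows `A ∖ {a}` in the expansion, along the column of `x`, of the
minor on the rows `A` (a set of exponents given by its bit mask) of a Vandermonde matrix. -/
def coef (S : Type*) [CommRing S] (x : ℕ) : ℕ → ℕ → S
  | 0, A => ((A % 2 : ℕ) : S)
  | a + 1, A => (if 0 < A % 2 then -1 else 1) * x * coef S x a (A / 2)

/-- The minor on the rows `A` of the Vandermonde matrix whose columns belong to the entries of a
list. -/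
def minor (S : Type*) [CommRing S] (k : ℕ) : List ℕ → ℕ → S
  | [], A => if A = 0 then 1 else 0
  | x :: l, A => ∑ a ∈ range k, coef S x a A * minor S k l (A - 2 ^ a)

/-- Halving the mask lowers every exponent by one, and an odd mask contributes a sign for the row 0
that lies before `a`. The value 0 for `a ∉ A` makes the truncated difference `A - 2 ^ a` harmless
wherever it is multiplied by a coefficient. -/
theorem coef_eq (x : ℕ) : ∀ a A : ℕ, coef S x a A =
    if A.testBit a then (-1) ^ #{i ∈ range a | A.testBit i} * (x : S) ^ a else 0 := by
  intro a
  induction a with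
  | zero =>
    intro A
    rcases Nat.mod_two_eq_zero_or_one A with h | h <;> simp [coef, h, Nat.testBit_zero]
  | succ a ih =>
    intro A
    rw [coef, ih, Nat.testBit_add_one]
    have hc : #{i ∈ range (a + 1) | A.testBit i} =
        #{i ∈ range a | (A / 2).testBit i} + A % 2 := by
      rw [card_filter, sum_range_succ', card_filter]
      simp only [Nat.testBit_add_one, Nat.testBit_zero]
      congr 1
      rcases Nat.mod_two_eq_zero_or_one A with h | h <;> simp [h]
    rw [hc]
    rcases Nat.mod_two_eq_zero_or_one A with h | h
    · simp only [h]
      split_ifs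
      all_goals first | omega | skip
      · simp; ring
      · simp
    · simp only [h]
      split_ifs
      all_goals first | omega | skip
      · rw [pow_succ, pow_succ]; ring
      · simp

/-- Subtracting a power of two whose bit is set causes no borrow. -/
theorem testBit_sub_two_pow : ∀ (a A i : ℕ), A.testBit a = true →
    (A - 2 ^ a).testBit i = (A.testBit i && decide (i ≠ a)) := by
  intro a
  induction a with
  | zero =>
    intro A i h
    have h1 : A % 2 = 1 := by simpa [Nat.testBit_zero] using h
    cases i with
    | zero =>
      have : (A - 2 ^ 0) % 2 = 0 := by omega
      simp [Nat.testBit_zero]; omega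
    | succ i =>
      have : (A - 2 ^ 0) / 2 = A / 2 := by omega
      rw [Nat.testBit_add_one, this, Nat.testBit_add_one]; simp
  | succ a ih =>
    intro A i h
    rw [Nat.testBit_add_one] at h
    have hp : 2 ^ (a + 1) = 2 * 2 ^ a := by ring
    have hge := Nat.ge_two_pow_of_testBit h
    cases i with
    | zero =>
      have : (A - 2 ^ (a + 1)) % 2 = A % 2 := by omega
      simp [Nat.testBit_zero, this]
    | succ i =>
      have : (A - 2 ^ (a + 1)) / 2 = A / 2 - 2 ^ a := by omega
      rw [Nat.testBit_add_one, this, ih _ _ h, Nat.testBit_add_one]; simp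

/-- The set with a given bit mask. -/
def bits (k A : ℕ) : Finset ℕ := {i ∈ range k | A.testBit i}

theorem mem_bits {k A i : ℕ} : i ∈ bits k A ↔ i < k ∧ A.testBit i = true := by simp [bits]

theorem bits_sub {k A a : ℕ} (ha : A.testBit a = true) :
    bits k (A - 2 ^ a) = (bits k A).erase a := by
  ext i
  simp only [mem_bits, mem_erase, testBit_sub_two_pow a A i ha, Bool.and_eq_true,
    decide_eq_true_eq]
  tauto

/-- The minor as a determinant. -/
def vdet {p : ℕ} (f : Fin p → S) (B : Finset ℕ) : S :=
  if h : #B = p then Matrix.det (Matrix.of fun i j : Fin p => f j ^ (B.orderEmbOfFin h i)) else 0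

theorem card_filter_lt_orderEmbOfFin {B : Finset ℕ} {p : ℕ} (h : #B = p) (i : Fin p) :
    #{b ∈ B | b < B.orderEmbOfFin h i} = i := by
  have : {b ∈ B | b < B.orderEmbOfFin h i} =
      (univ.filter fun j : Fin p => j < i).map (B.orderEmbOfFin h).toEmbedding := by
    ext b
    simp only [mem_filter, mem_map, mem_univ, true_and, RelEmbedding.coe_toEmbedding]
    constructor
    · rintro ⟨hb, hlt⟩
      rw [← B.map_orderEmbOfFin_univ h] at hb
      simp only [mem_map, mem_univ, true_and, RelEmbedding.coe_toEmbedding] at hb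
      obtain ⟨j, rfl⟩ := hb
      exact ⟨j, by simpa using hlt, rfl⟩
    · rintro ⟨j, hj, rfl⟩
      exact ⟨orderEmbOfFin_mem _ _ _, by simpa using hj⟩
  have hI : (univ.filter fun j : Fin p => j < i) = Iio i := by ext; simp
  rw [this, card_map, hI, Fin.card_Iio]

/-- Laplace expansion along the first column: the sign of row `a` is given by its rank in `B`. If
`B` has the wrong size, so has each `B.erase a`, and both sides vanish. -/
theorem vdet_succ {p : ℕ} (f : Fin (p + 1) → S) (B : Finset ℕ) :
    vdet f B = ∑ a ∈ B, (-1) ^ #{b ∈ B | b < a} * f 0 ^ a * vdet (fun i => f i.succ) (B.erase a) := by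
  by_cases h : #B = p + 1
  · rw [vdet, dif_pos h, Matrix.det_succ_column_zero]
    conv_rhs => rw [← sum_coe_sort, ← (B.orderIsoOfFin h).toEquiv.sum_comp]
    refine sum_congr rfl fun i _ => ?_
    have hi : ((B.orderIsoOfFin h).toEquiv i : ℕ) = B.orderEmbOfFin h i := rfl
    have hc : #(B.erase (B.orderEmbOfFin h i)) = p := by
      rw [card_erase_of_mem (orderEmbOfFin_mem _ _ _), h]; rfl
    have hu : (fun j => B.orderEmbOfFin h (i.succAbove j)) =
        (B.erase (B.orderEmbOfFin h i)).orderEmbOfFin hc := by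
      refine orderEmbOfFin_unique hc (fun j => mem_erase.2 ⟨?_, orderEmbOfFin_mem _ _ _⟩) ?_
      · simp
      · exact (B.orderEmbOfFin h).strictMono.comp (Fin.strictMono_succAbove i)
    rw [hi, card_filter_lt_orderEmbOfFin, vdet, dif_pos hc]
    congr 2
    ext j l
    simp only [Matrix.submatrix_apply, Matrix.of_apply]
    rw [← hu]
  · rw [vdet, dif_neg h, sum_eq_zero]
    intro a ha
    rw [vdet, dif_neg, mul_zero]
    rw [card_erase_of_mem ha]
    have := card_pos.2 ⟨a, ha⟩
    omega

theorem minor_eq_vdet (k : ℕ) : ∀ (p : ℕ) (f : Fin p → ℕ) (A : ℕ), A < 2 ^ k →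
    minor S k (List.ofFn f) A = vdet (fun i => (f i : S)) (bits k A) := by
  intro p
  induction p with
  | zero =>
    intro f A hA
    simp only [List.ofFn_zero, minor, vdet]
    by_cases h : A = 0
    · subst h
      have : #(bits k 0) = 0 := by simp [bits]
      simp [this]
    · have : #(bits k A) ≠ 0 := by
        obtain ⟨i, hi⟩ := Nat.exists_testBit_of_ne_zero h
        refine card_ne_zero_of_mem (a := i) (mem_bits.2 ⟨?_, hi⟩)
        -- A set bit at position `k` or higher would contradict `A < 2 ^ k`.
        by_contra hik
        have := Nat.ge_two_pow_of_testBit hi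
        have := Nat.pow_le_pow_right (n := 2) (by norm_num) (not_lt.1 hik)
        omega
      simp [h, this]
  | succ p ih =>
    intro f A hA
    rw [List.ofFn_succ, minor, vdet_succ]
    conv_rhs => rw [bits, sum_filter]
    refine sum_congr rfl fun a ha => ?_
    rw [coef_eq]
    by_cases hb : A.testBit a = true
    · rw [if_pos hb, if_pos hb, ih _ _ (lt_of_le_of_lt (Nat.sub_le _ _) hA), bits_sub hb]
      congr 4
      ext i
      simp only [mem_filter, mem_range] at ha ⊢
      constructor
      · exact fun h => ⟨⟨h.1.trans ha, h.2⟩, h.1⟩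
      · exact fun h => ⟨h.2, h.1.2⟩
    · simp [hb]

/-- Two equal columns kill a determinant over any commutative ring, in particular modulo a composite
number. This is what certifies distinctness during backtracking. -/
theorem minor_eq_zero {k : ℕ} {l : List ℕ} {A : ℕ} (hA : A < 2 ^ k) (hl : ¬ l.Nodup) :
    minor S k l A = 0 := by
  rw [← List.ofFn_get l, minor_eq_vdet k _ _ _ hA, vdet]
  split_ifs
  · rw [List.nodup_iff_injective_get] at hl
    simp only [Function.Injective, not_forall] at hl
    obtain ⟨i, j, hij, hne⟩ := hl
    exact Matrix.det_zero_of_column_eq hne fun r => by simp only [Matrix.of_apply, hij]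
  · rfl

/-- The full mask selects the exponents `0, …, k - 1`, so this is a genuine Vandermonde determinant
with distinct integer nodes. -/
theorem minor_ne_zero {k : ℕ} {l : List ℕ} (hk : l.length = k) (hl : l.Nodup) :
    minor ℤ k l (2 ^ k - 1) ≠ 0 := by
  have hpos : 0 < 2 ^ k := by positivity
  subst hk
  set k := l.length with hk
  have hm := minor_eq_vdet (S := ℤ) k _ l.get (2 ^ k - 1) (by omega)
  rw [List.ofFn_get] at hm
  have hb : bits k (2 ^ k - 1) = range k := by ext i; simp [mem_bits]
  have hc : #(range k) = k := card_range k
  rw [hm, hb, vdet, dif_pos hc, ← Matrix.det_transpose]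
  have hu : (fun i : Fin k => (i : ℕ)) = (range k).orderEmbOfFin hc :=
    orderEmbOfFin_unique hc (fun i => mem_range.2 i.2) (fun i j h => h)
  have : (Matrix.of fun i j : Fin k => (l.get j : ℤ) ^ ((range k).orderEmbOfFin hc i)).transpose =
      Matrix.vandermonde fun i => (l.get i : ℤ) := by
    ext i j
    simp only [Matrix.transpose_apply, Matrix.of_apply, Matrix.vandermonde_apply]
    rw [← hu]
  rw [this, Matrix.det_vandermonde_ne_zero_iff]
  intro i j hij
  simp only [Nat.cast_inj] at hij
  exact List.nodup_iff_injective_get.1 hl hij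

theorem map_coef {T : Type*} [CommRing T] (φ : S →+* T) (x : ℕ) :
    ∀ a A : ℕ, φ (coef S x a A) = coef T x a A := by
  intro a
  induction a with
  | zero => intro A; simp [coef]
  | succ a ih => intro A; simp only [coef, map_mul, ih, map_natCast]; split_ifs <;> simp

theorem abs_coef_le (x : ℕ) : ∀ a A : ℕ, |coef ℤ x a A| ≤ (x : ℤ) ^ a := by
  intro a A
  rw [coef_eq]
  split_ifs
  · rw [abs_mul, abs_pow, abs_pow]; simp
  · simp

end Minors

/-! ## Summing over sequences of vertices by dynamic programming -/

section Tables

variable {S : Type*} [CommRing S]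

/-- The sum of `g l` over all lists `l` of length `p` with entries less than `n`. -/
def sumSeq (n : ℕ) : ℕ → (List ℕ → S) → S
  | 0, g => g []
  | p + 1, g => ∑ v ∈ range n, sumSeq n p fun l => g (v :: l)

theorem sumSeq_congr {n : ℕ} : ∀ {p : ℕ} {g h : List ℕ → S},
    (∀ l : List ℕ, l.length = p → (∀ x ∈ l, x < n) → g l = h l) → sumSeq n p g = sumSeq n p h := by
  intro p
  induction p with
  | zero => intro g h H; exact H [] rfl (by simp)
  | succ p ih =>
    intro g h H
    refine sum_congr rfl fun v hv => ih fun l hl hlt => H _ (by simp [hl]) ?_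
    simpa using ⟨mem_range.1 hv, hlt⟩

theorem sumSeq_zero (n : ℕ) : ∀ p : ℕ, sumSeq n p (fun _ => (0 : S)) = 0 := by
  intro p
  induction p with
  | zero => rfl
  | succ p ih => simp [sumSeq, ih]

theorem sumSeq_sum {ι : Type*} (n : ℕ) (s : Finset ι) : ∀ (p : ℕ) (g : ι → List ℕ → S),
    ∑ i ∈ s, sumSeq n p (g i) = sumSeq n p fun l => ∑ i ∈ s, g i l := by
  intro p
  induction p with
  | zero => intro g; rfl
  | succ p ih => intro g; simp only [sumSeq]; rw [sum_comm]; exact sum_congr rfl fun v _ => ih _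

theorem mul_sumSeq (n : ℕ) (c : S) : ∀ (p : ℕ) (g : List ℕ → S),
    c * sumSeq n p g = sumSeq n p fun l => c * g l := by
  intro p
  induction p with
  | zero => intro g; rfl
  | succ p ih => intro g; simp only [sumSeq, mul_sum, ih]

theorem sumSeq_nonneg {n : ℕ} : ∀ {p : ℕ} {g : List ℕ → ℤ}, (∀ l, 0 ≤ g l) → 0 ≤ sumSeq n p g := by
  intro p
  induction p with
  | zero => intro g h; exact h []
  | succ p ih => intro g h; exact sum_nonneg fun v _ => ih fun l => h _

theorem le_sumSeq {n : ℕ} : ∀ {p : ℕ} {g : List ℕ → ℤ}, (∀ l, 0 ≤ g l) → ∀ l : List ℕ,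
    l.length = p → (∀ x ∈ l, x < n) → g l ≤ sumSeq n p g := by
  intro p
  induction p with
  | zero => intro g h l hl _; rw [List.length_eq_zero_iff.1 hl]; rfl
  | succ p ih =>
    intro g h l hl hlt
    cases l with
    | nil => simp at hl
    | cons v l =>
      simp only [List.mem_cons, forall_eq_or_imp] at hlt
      refine (ih (g := fun l => g (v :: l)) (fun l => h _) l (by simpa using hl) hlt.2).trans ?_
      exact single_le_sum (f := fun v => sumSeq n p fun l => g (v :: l))
        (fun v _ => sumSeq_nonneg fun l => h _) (mem_range.2 hlt.1)

/-- The time and the place after having gone from one entry of a list to the next (the first entry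
being the last one to be visited), starting at time `0` in `s`; `R t u v` is the time at which one gets to
`v` from `u`, starting at time `t`. -/
def place (R : ℕ → ℕ → ℕ → ℕ) (s : ℕ) : List ℕ → ℕ × ℕ
  | [] => (0, s)
  | v :: l => (R (place R s l).1 (place R s l).2 v, v)

/-- The recursion for the sum, over all sequences that lead to `v` at time `t`, of the product of
the minors on the rows `A` and `B`. -/
def table (S : Type*) [CommRing S] (k n Θ s : ℕ) (R : ℕ → ℕ → ℕ → ℕ) : ℕ → ℕ → ℕ → ℕ → ℕ → S
  | 0, t, v, A, B => if t = 0 ∧ v = s ∧ A = 0 ∧ B = 0 then 1 else 0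
  | p + 1, t, v, A, B => ∑ t₀ ∈ range Θ, ∑ u ∈ range n, ∑ a ∈ range k, ∑ b ∈ range k,
      if R t₀ u v = t then coef S v a A * coef S v b B *
        table S k n Θ s R p t₀ u (A - 2 ^ a) (B - 2 ^ b) else 0

variable {k n Θ s : ℕ} {R : ℕ → ℕ → ℕ → ℕ}

theorem place_lt (hΘ : 0 < Θ) (hs : s < n) (hR : ∀ t < Θ, ∀ u < n, ∀ v < n, R t u v < Θ) :
    ∀ l : List ℕ, (∀ x ∈ l, x < n) → (place R s l).1 < Θ ∧ (place R s l).2 < n := by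
  intro l
  induction l with
  | nil => exact fun _ => ⟨hΘ, hs⟩
  | cons v l ih =>
    intro h
    simp only [List.mem_cons, forall_eq_or_imp] at h
    obtain ⟨h1, h2⟩ := ih h.2
    exact ⟨hR _ h1 _ h2 _ h.1, h.1⟩

/-- A shorter sequence determines its final time and place, so summing over `(t₀, u)` merely sorts
the shorter sequences by where they end. Expanding both minors along the column of the newest vertex
then gives the recursion. -/
theorem table_eq_sumSeq (hΘ : 0 < Θ) (hs : s < n) (hR : ∀ t < Θ, ∀ u < n, ∀ v < n, R t u v < Θ) :
    ∀ (p t v A B : ℕ), v < n → table S k n Θ s R p t v A B =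
      sumSeq n p fun l => if place R s l = (t, v) then minor S k l A * minor S k l B else 0 := by
  intro p
  induction p with
  | zero =>
    intro t v A B _
    simp only [table, sumSeq, place, minor, Prod.mk.injEq, ite_mul, one_mul, zero_mul]
    by_cases h1 : t = 0 <;> by_cases h2 : v = s <;> by_cases h3 : A = 0 <;> by_cases h4 : B = 0 <;>
      simp [h1, h2, h3, h4, eq_comm]
    all_goals simp_all [eq_comm]
  | succ p ih =>
    intro t v A B hv
    -- Only sequences whose first entry, the last vertex visited, is `v` end in `v`.
    have hr : sumSeq n (p + 1) (fun l => if place R s l = (t, v) then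
        minor S k l A * minor S k l B else 0) = sumSeq n p (fun l =>
        if R (place R s l).1 (place R s l).2 v = t then
          minor S k (v :: l) A * minor S k (v :: l) B else 0) := by
      simp only [sumSeq]
      rw [sum_eq_single_of_mem v (mem_range.2 hv)]
      · simp [place]
      · intro w _ hw
        simp [place, hw, sumSeq_zero]
    rw [hr]
    have hl : table S k n Θ s R (p + 1) t v A B = ∑ t₀ ∈ range Θ, ∑ u ∈ range n, ∑ a ∈ range k,
        ∑ b ∈ range k, sumSeq n p fun l => if R t₀ u v = t then coef S v a A * coef S v b B *
          (if place R s l = (t₀, u) then minor S k l (A - 2 ^ a) * minor S k l (B - 2 ^ b) else 0)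
          else 0 := by
      simp only [table]
      refine sum_congr rfl fun t₀ _ => sum_congr rfl fun u hu => sum_congr rfl fun a _ =>
        sum_congr rfl fun b _ => ?_
      split_ifs with h
      · rw [ih _ _ _ _ (mem_range.1 hu), mul_sumSeq]
      · rw [sumSeq_zero]
    rw [hl]
    simp only [sumSeq_sum]
    refine sumSeq_congr fun l _ hlt => ?_
    obtain ⟨h1, h2⟩ := place_lt hΘ hs hR l hlt
    -- For a fixed `l` only its own `(t₀, u)` contributes.
    rw [sum_eq_single_of_mem _ (mem_range.2 h1), sum_eq_single_of_mem _ (mem_range.2 h2)]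
    · by_cases h : R (place R s l).1 (place R s l).2 v = t
      · simp only [if_pos h, minor, sum_mul_sum]
        refine sum_congr rfl fun a _ => sum_congr rfl fun b _ => ?_
        rw [if_pos trivial]; ring
      · simp [if_neg h]
    · intro u _ hu
      refine sum_eq_zero fun a _ => sum_eq_zero fun b _ => ?_
      rw [if_neg (c := place R s l = _)]
      · simp
      · exact fun h => hu (congrArg Prod.snd h).symm
    · intro u _ hu
      refine sum_eq_zero fun _ _ => sum_eq_zero fun a _ => sum_eq_zero fun b _ => ?_
      rw [if_neg (c := place R s l = _)]
      · simp
      · exact fun h => hu (congrArg Prod.fst h).symm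

theorem map_table {T : Type*} [CommRing T] (φ : S →+* T) : ∀ p t v A B : ℕ,
    φ (table S k n Θ s R p t v A B) = table T k n Θ s R p t v A B := by
  intro p
  induction p with
  | zero => intro t v A B; simp only [table]; split_ifs <;> simp
  | succ p ih =>
    intro t v A B
    simp only [table, map_sum]
    refine sum_congr rfl fun t₀ _ => sum_congr rfl fun u _ => sum_congr rfl fun a _ =>
      sum_congr rfl fun b _ => ?_
    split_ifs
    · simp only [map_mul, map_coef, ih]
    · exact map_zero φ

/-- Each level adds up at most `Θ n k ^ 2` terms, each with two coefficients of absolute value at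
most `n ^ k`. -/
theorem abs_table_le : ∀ p t v A B : ℕ, v < n →
    |table ℤ k n Θ s R p t v A B| ≤ ((Θ * n * (k * k) * (n ^ k * n ^ k) : ℕ) : ℤ) ^ p := by
  intro p
  induction p with
  | zero => intro t v A B _; simp only [table]; split_ifs <;> simp
  | succ p ih =>
    intro t v A B hv
    set X : ℤ := ((Θ * n * (k * k) * (n ^ k * n ^ k) : ℕ) : ℤ) with hX
    have hn : (1 : ℤ) ≤ n := by exact_mod_cast (by omega : 1 ≤ n)
    have hc : ∀ a ∈ range k, ∀ A, |coef ℤ v a A| ≤ (n : ℤ) ^ k := fun a ha A =>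
      (abs_coef_le v a A).trans ((pow_le_pow_left₀ (by positivity)
        (by exact_mod_cast hv.le) a).trans (pow_le_pow_right₀ hn (mem_range.1 ha).le))
    have step : ∀ {m : ℕ} {g : ℕ → ℤ} {Y : ℤ}, (∀ i ∈ range m, |g i| ≤ Y) →
        |∑ i ∈ range m, g i| ≤ m * Y := fun {m g Y} h => by
      refine (abs_sum_le_sum_abs _ _).trans ((sum_le_sum h).trans ?_)
      simp
    have : |table ℤ k n Θ s R (p + 1) t v A B| ≤
        Θ * (n * (k * (k * ((n : ℤ) ^ k * (n : ℤ) ^ k * X ^ p)))) := by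
      simp only [table]
      refine step fun t₀ _ => step fun u hu => step fun a ha => step fun b hb => ?_
      split_ifs
      · rw [abs_mul, abs_mul]
        have h1 := hc a ha A
        have h2 := hc b hb B
        have h3 := ih t₀ u (A - 2 ^ a) (B - 2 ^ b) (mem_range.1 hu)
        gcongr
      · simp only [abs_zero]; positivity
    refine this.trans (le_of_eq ?_)
    rw [pow_succ, hX]
    push_cast
    ring

end Tables

/-! ## Divisors in an interval -/

/-- This is the partial fraction expansion of `m! / (x (x + 1) ⋯ (x + m))`, whose denominators are
the single factors, freed of division. The induction uses that the fraction for `m + 1` is the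
difference of the fractions for `m` at `x` and at `x + 1`. -/
theorem prod_dvd_mul_factorial : ∀ (m : ℕ) (x Z : ℤ), (∀ j ≤ m, (x + j) ∣ Z) →
    ∏ j ∈ range (m + 1), (x + j) ∣ Z * (m.factorial : ℤ) := by
  intro m
  induction m with
  | zero => intro x Z h; simpa using h 0 le_rfl
  | succ m ih =>
    intro x Z h
    obtain ⟨α, hα⟩ := ih x Z fun j hj => h j (by omega)
    obtain ⟨β, hβ⟩ := ih (x + 1) Z fun j hj => by
      have := h (j + 1) (by omega)
      push_cast at this
      rwa [add_assoc, add_comm (1 : ℤ)]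
    have e1 : ∏ j ∈ range (m + 1 + 1), (x + j) =
        (∏ j ∈ range (m + 1), (x + j)) * (x + (m + 1)) := by rw [prod_range_succ]; push_cast; rfl
    have e2 : ∏ j ∈ range (m + 1 + 1), (x + j) = (∏ j ∈ range (m + 1), (x + 1 + j)) * x := by
      rw [prod_range_succ']; push_cast; rw [add_zero]
      congr 1; exact prod_congr rfl fun j _ => by ring
    refine ⟨α - β, ?_⟩
    have : Z * ((m + 1).factorial : ℤ) = Z * m.factorial * (x + (m + 1)) - Z * m.factorial * x := by
      rw [Nat.factorial_succ]; push_cast; ring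
    rw [this]
    nth_rewrite 1 [hα]
    rw [hβ, mul_sub]
    nth_rewrite 1 [e1]
    rw [e2]
    ring

/-- A positive number that is not too large has a nondivisor among few consecutive numbers. -/
theorem exists_not_dvd {Z : ℤ} {X e m : ℕ} (hZ : 0 < Z) (hX : 1 ≤ X) (hZX : Z ≤ (X : ℤ) ^ e)
    (hem : e < m) : ∃ j < m, ¬ ((m * X + 1 + j : ℕ) : ℤ) ∣ Z := by
  obtain ⟨m, rfl⟩ : ∃ m', m = m' + 1 := ⟨m - 1, by omega⟩
  by_contra! H
  set x := (m + 1) * X + 1 with hx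
  have h1 := prod_dvd_mul_factorial m x Z fun j hj => by
    have := H j (by omega)
    push_cast at this ⊢
    exact this
  have h2 : ((x : ℤ)) ^ (m + 1) ≤ ∏ j ∈ range (m + 1), ((x : ℤ) + j) := by
    calc ((x : ℤ)) ^ (m + 1) = ∏ j ∈ range (m + 1), (x : ℤ) := by simp
      _ ≤ _ := prod_le_prod (fun _ _ => by positivity) (fun j _ => by simp)
  have h3 := Int.le_of_dvd (by positivity) h1
  have h4 : Z * (m.factorial : ℤ) ≤ (X : ℤ) ^ m * (m : ℤ) ^ m := by
    have : (m.factorial : ℤ) ≤ (m : ℤ) ^ m := by exact_mod_cast Nat.factorial_le_pow m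
    have h5 : (X : ℤ) ^ e ≤ (X : ℤ) ^ m :=
      pow_le_pow_right₀ (by exact_mod_cast hX) (by omega)
    exact mul_le_mul (hZX.trans h5) this (by positivity) (by positivity)
  -- The product of the `m + 1` candidates is at least `x ^ (m + 1)`, and `x` exceeds `X m`, so it
  -- is larger than the positive multiple `Z m!` that it would divide.
  have h6 : (X : ℤ) ^ m * (m : ℤ) ^ m < (x : ℤ) ^ (m + 1) := by
    rw [← mul_pow, pow_succ]
    have h7 : ((X : ℤ) * m) ≤ x := by rw [hx]; push_cast; nlinarith
    have h8 : ((X : ℤ) * m) ^ m ≤ (x : ℤ) ^ m := pow_le_pow_left₀ (by positivity) h7 m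
    have h9 : (2 : ℤ) ≤ x := by
      have : 1 ≤ (m + 1) * X := Nat.mul_pos (by omega) hX
      exact_mod_cast (by omega : 2 ≤ x)
    have h10 : (0 : ℤ) < (x : ℤ) ^ m := by positivity
    nlinarith
  exact absurd (h2.trans (h3.trans h4)) (not_le.2 h6)

end TExp

namespace TExp

/-! ## Foremost arrivals -/

/-- `R i u v` is the number of time steps after which one gets to `v` when one is at `u` after `i` time
steps; it is `L + 1` if one does not get to `v`. -/
structure Foremost {n L : ℕ} (G : TemporalGraph (Fin n) L) (R : ℕ → ℕ → ℕ → ℕ) : Prop where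
  top : ∀ u v : Fin n, R (L + 1) u v = L + 1
  last : ∀ u v : Fin n, u ≠ v → R L u v = L + 1
  self : ∀ i ≤ L, ∀ u : Fin n, R i u u = i
  wait : ∀ i < L, ∀ u v : Fin n, u ≠ v → R i u v ≤ R (i + 1) u v
  move : ∀ (i : ℕ) (h : i < L) (u x v : Fin n), u ≠ v → (G.layer ⟨i, h⟩).Adj u x →
    R i u v ≤ R (i + 1) x v
  cases : ∀ (i : ℕ) (h : i < L) (u v : Fin n), u ≠ v → R i u v = R (i + 1) u v ∨
    ∃ x, (G.layer ⟨i, h⟩).Adj u x ∧ R i u v = R (i + 1) x v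

section Foremost

variable {n L : ℕ} {G : TemporalGraph (Fin n) L} {R : ℕ → ℕ → ℕ → ℕ}

theorem Foremost.bounds (h : Foremost G R) : ∀ d i : ℕ, i + d = L + 1 → ∀ u v : Fin n,
    i ≤ R i u v ∧ R i u v ≤ L + 1 := by
  intro d
  induction d with
  | zero =>
    intro i hi u v
    obtain rfl : i = L + 1 := hi
    rw [h.top]; simp
  | succ d ih =>
    intro i hi u v
    by_cases huv : u = v
    · subst huv; rw [h.self i (by omega)]; omega
    · by_cases hL : i = L
      · subst hL; rw [h.last u v huv]; omega
      · rcases h.cases i (by omega) u v huv with e | ⟨x, _, e⟩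
        · rw [e]; have := ih (i + 1) (by omega) u v; omega
        · rw [e]; have := ih (i + 1) (by omega) x v; omega

theorem Foremost.le (h : Foremost G R) {i : ℕ} (hi : i ≤ L + 1) (u v : Fin n) : i ≤ R i u v :=
  (h.bounds (L + 1 - i) i (by omega) u v).1

theorem Foremost.le_top (h : Foremost G R) {i : ℕ} (hi : i ≤ L + 1) (u v : Fin n) :
    R i u v ≤ L + 1 :=
  (h.bounds (L + 1 - i) i (by omega) u v).2

theorem Foremost.mono (h : Foremost G R) {i i' : ℕ} (hi : i ≤ i') (hi' : i' ≤ L + 1)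
    (u v : Fin n) : R i u v ≤ R i' u v := by
  induction i', hi using Nat.le_induction with
  | base => rfl
  | succ j hj ih =>
    refine (ih (by omega)).trans ?_
    by_cases huv : u = v
    · subst huv; rw [h.self j (by omega)]; have := h.le hi' u u; omega
    · by_cases hL : j = L
      · subst hL; rw [h.last u v huv, h.top]
      · exact h.wait j (by omega) u v huv

/-- Going on from a time and a place to a vertex. -/
def goTo (R : ℕ → ℕ → ℕ → ℕ) (z : ℕ × ℕ) (v : ℕ) : ℕ × ℕ := (R z.1 z.2 v, v)

/-- `place` reads a list from its end, whereas a walk yields the vertices in the order of visits. -/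
theorem place_reverse (s : ℕ) (l : List ℕ) : place R s l.reverse = l.foldl (goTo R) (0, s) := by
  have : ∀ l, place R s l = l.foldr (fun v z => goTo R z v) (0, s) := by
    intro l
    induction l with
    | nil => rfl
    | cons v l ih => rw [List.foldr_cons, ← ih]; rfl
  rw [this, List.foldr_reverse]

/-- Being at the same vertex earlier never delays any later arrival, since one may wait. -/
theorem Foremost.foldl_mono (h : Foremost G R) (l : List (Fin n)) : ∀ (u : Fin n) (i i' : ℕ),
    i ≤ i' → i' ≤ L + 1 → ((l.map Fin.val).foldl (goTo R) (i, (u : ℕ))).1 ≤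
      ((l.map Fin.val).foldl (goTo R) (i', (u : ℕ))).1 := by
  induction l with
  | nil => intro u i i' hi _; exact hi
  | cons v l ih =>
    intro u i i' hi hi'
    exact ih v _ _ (h.mono hi hi' u v) (h.le_top hi' u v)

/-- The last stop of a sequence of steps. -/
def finish {V : Type*} : V → ℕ → List (ℕ × V) → ℕ × V
  | v, τ, [] => (τ, v)
  | _, _, (t, u) :: S => finish u (t + 1) S

theorem finish_append {V : Type*} (t : ℕ) (x : V) (S : List (ℕ × V)) : ∀ (v : V) (τ : ℕ),
    finish v τ (S ++ [(t, x)]) = (t + 1, x) := by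
  induction S with
  | nil => intro v τ; rfl
  | cons a S ih => intro v τ; exact ih _ _

theorem isSteps_append (t : ℕ) (x : Fin n) (S : List (ℕ × Fin n)) : ∀ (v : Fin n) (τ : ℕ),
    G.IsSteps v τ S → (finish v τ S).1 ≤ t → G.TimeEdge t (finish v τ S).2 x →
      G.IsSteps v τ (S ++ [(t, x)]) := by
  induction S with
  | nil => intro v τ _ h1 h2; exact ⟨h1, h2, trivial⟩
  | cons a S ih => intro v τ h0 h1 h2; exact ⟨h0.1, h0.2.1, ih _ _ h0.2.2 h1 h2⟩

theorem stops_bounds (S : List (ℕ × Fin n)) : ∀ (v : Fin n) (τ : ℕ), G.IsSteps v τ S →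
    ∀ p ∈ (τ, v) :: S.map (fun p => (p.1 + 1, p.2)), τ ≤ p.1 ∧ p.1 ≤ (finish v τ S).1 := by
  induction S with
  | nil => intro v τ _ p hp; simp at hp; subst hp; simp [finish]
  | cons a S ih =>
    intro v τ h p hp
    have h1 := ih a.2 (a.1 + 1) h.2.2
    have h2 := h.1
    simp only [List.map_cons, List.mem_cons] at hp
    rcases hp with rfl | hp
    · have := h1 (a.1 + 1, a.2) (by simp)
      simp only [finish] at this ⊢
      omega
    · have := h1 p (by simpa using hp)
      simp only [finish] at this ⊢
      omega

theorem finish_le (S : List (ℕ × Fin n)) : ∀ (v : Fin n) (τ : ℕ), G.IsSteps v τ S → τ ≤ L + 1 →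
    (finish v τ S).1 ≤ L + 1 := by
  induction S with
  | nil => intro v τ _ h; exact h
  | cons a S ih =>
    intro v τ h _
    obtain ⟨⟨_, h1⟩, _⟩ := h.2.1
    exact ih _ _ h.2.2 (by omega)

theorem getLast_stops (S : List (ℕ × Fin n)) : ∀ (v : Fin n) (τ : ℕ),
    ((τ, v) :: S.map (fun p => (p.1 + 1, p.2))).getLast (by simp) = finish v τ S := by
  induction S with
  | nil => intro v τ; rfl
  | cons a S ih =>
    intro v τ
    rw [finish, ← ih a.2 (a.1 + 1)]
    simp only [List.map_cons]
    rw [List.getLast_cons (by simp)]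

/-- A walk that has visited the vertices of `X` after `τ` time steps gives an order of `X` in which
the vertices can be reached one after the other within that time. -/
theorem Foremost.exists_order (h : Foremost G R) (τ : ℕ) (S : List (ℕ × Fin n)) :
    ∀ (u : Fin n) (i : ℕ) (X : Finset (Fin n)), G.IsSteps u (i + 1) S → i ≤ τ → i ≤ L →
      (∀ x ∈ X, ∃ τ' ≤ τ + 1, (τ', x) ∈ (i + 1, u) :: S.map (fun p => (p.1 + 1, p.2))) →
      ∃ l : List (Fin n), l.Nodup ∧ l.toFinset = X ∧
        ((l.map Fin.val).foldl (goTo R) (i, (u : ℕ))).1 ≤ τ := by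
  -- If at most the current vertex is still wanted, the walk is no longer consulted; its remaining
  -- steps may lie beyond `τ`.
  have base : ∀ (u : Fin n) (i : ℕ) (X : Finset (Fin n)), i ≤ τ → i ≤ L → X.erase u = ∅ →
      ∃ l : List (Fin n), l.Nodup ∧ l.toFinset = X ∧
        ((l.map Fin.val).foldl (goTo R) (i, (u : ℕ))).1 ≤ τ := by
    intro u i X hi hL hX
    by_cases hu : u ∈ X
    · refine ⟨[u], by simp, ?_, ?_⟩
      · rw [← Finset.insert_erase hu, hX]; simp
      · simp [goTo, h.self i hL, hi]
    · rw [Finset.erase_eq_of_notMem hu] at hX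
      exact ⟨[], by simp, by simp [hX], hi⟩
  induction S with
  | nil =>
    intro u i X _ hi hL hX
    refine base u i X hi hL ?_
    ext x
    simp only [Finset.mem_erase, Finset.notMem_empty, iff_false, not_and]
    intro hxu hx
    obtain ⟨τ', _, hm⟩ := hX x hx
    simp at hm
    exact hxu hm.2
  | cons a S ih =>
    intro u i X hS hi hL hX
    obtain ⟨t, x⟩ := a
    obtain ⟨hit, ⟨⟨ht1, htL⟩, hadj⟩, hS'⟩ := hS
    by_cases hXe : X.erase u = ∅
    · exact base u i X hi hL hXe
    have hX' : ∀ y ∈ X.erase u, ∃ τ' ≤ τ + 1,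
        (τ', y) ∈ (t + 1, x) :: S.map (fun p => (p.1 + 1, p.2)) := by
      intro y hy
      obtain ⟨hyu, hy⟩ := Finset.mem_erase.1 hy
      obtain ⟨τ', hτ', hm⟩ := hX y hy
      refine ⟨τ', hτ', ?_⟩
      simp only [List.map_cons, List.mem_cons, Prod.mk.injEq] at hm ⊢
      rcases hm with ⟨_, e⟩ | hm
      · exact absurd e hyu
      · exact hm
    -- Some wanted vertex is reached by this step or a later one, and still by time `τ`.
    have htτ : t ≤ τ := by
      obtain ⟨y, hy⟩ := Finset.nonempty_iff_ne_empty.2 hXe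
      obtain ⟨τ', hτ', hm⟩ := hX' y hy
      have := (stops_bounds S x (t + 1) hS' _ hm).1
      simp only at this
      omega
    obtain ⟨l, hl, hlX, hlt⟩ := ih x t (X.erase u) hS' htτ htL hX'
    -- The foremost arrival at the next vertex of the list from `u` is no later than waiting for the
    -- edge to `x` and going on from there.
    have key : ((l.map Fin.val).foldl (goTo R) (i, (u : ℕ))).1 ≤ τ := by
      refine le_trans ?_ hlt
      cases l with
      | nil => simp; omega
      | cons v l =>
        have hvu : u ≠ v := by
          rintro rfl
          have : u ∈ X.erase u := by rw [← hlX]; simp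
          simp at this
        refine h.foldl_mono l v _ _ ?_ (h.le_top (by omega) x v)
        have h1 := h.mono (i := i) (i' := t - 1) (by omega) (by omega) u v
        have h2 := h.move (t - 1) (by omega) u x v hvu hadj
        rw [Nat.sub_add_cancel ht1] at h2
        exact h1.trans h2
    by_cases hu : u ∈ X
    · refine ⟨u :: l, ?_, ?_, ?_⟩
      · refine List.nodup_cons.2 ⟨fun hul => ?_, hl⟩
        rw [← List.mem_toFinset, hlX] at hul
        simp at hul
      · rw [List.toFinset_cons, hlX, Finset.insert_erase hu]
      · simp only [List.map_cons, List.foldl_cons, goTo, h.self i hL]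
        exact key
    · exact ⟨l, hl, by rw [hlX, Finset.erase_eq_of_notMem hu], key⟩

variable {s : Fin n} {k best : ℕ}

/-- Walks start at time 1 but `R` counts time steps from 0; this shift makes the inequality strict.
-/
theorem Foremost.lt_tourArrival (h : Foremost G R)
    (hmin : ∀ l : List (Fin n), l.Nodup → l.length = k → best ≤ (place R s (l.map Fin.val)).1)
    {τ : ℕ} (hτ : 1 ≤ τ) {W : StrictWalk G} {X : Finset (Fin n)} (hk : X.card = k)
    (hW : W.start = s ∧ W.startTime = 1) (hv : ∀ x ∈ X, ∃ τ' ≤ τ, (τ', x) ∈ W.stops) :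
    best < τ := by
  obtain ⟨rfl, ht⟩ := hW
  obtain ⟨τ, rfl⟩ : ∃ τ₀, τ = τ₀ + 1 := ⟨τ - 1, by omega⟩
  have hS := W.isSteps
  have hv' : ∀ x ∈ X, ∃ τ' ≤ τ + 1, (τ', x) ∈ (0 + 1, W.start) ::
      W.steps.map (fun p => (p.1 + 1, p.2)) := by
    simpa [StrictWalk.stops, ht] using hv
  rw [ht] at hS
  obtain ⟨l, hl, hlX, hle⟩ := h.exists_order τ W.steps W.start 0 X hS (by omega) (by omega) hv'
  have h1 := hmin l.reverse (List.nodup_reverse.2 hl)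
    (by rw [List.length_reverse, ← List.toFinset_card_of_nodup hl, hlX, hk])
  rw [List.map_reverse, place_reverse] at h1
  omega

/-- Every tour arrives at `best + 1` or later, and the given walk ends by `best + 1`; hence its
arrival time and its end both equal `best + 1`. -/
theorem Foremost.isOptimalSolution (h : Foremost G R)
    (hmin : ∀ l : List (Fin n), l.Nodup → l.length = k → best ≤ (place R s (l.map Fin.val)).1)
    (hL : 1 ≤ L) {S : List (ℕ × Fin n)} (hS : G.IsSteps s 1 S) (hf : (finish s 1 S).1 ≤ best + 1)
    {X : Finset (Fin n)} (hX : X.card = k)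
    (hv : ∀ x ∈ X, ∃ τ, (τ, x) ∈ (1, s) :: S.map (fun p => (p.1 + 1, p.2))) :
    IsOptimalSolution G s k ⟨1, s, S, le_rfl, hL, hS⟩ := by
  have tour : ∀ (W' : StrictWalk G) (X' : Finset (Fin n)), X'.card = k → W'.IsTour s 1 X' →
      best + 1 ≤ W'.tourArrival X' := by
    intro W' X' hX' hW'
    -- Nonemptiness matters: the infimum of the empty set would be 0.
    have hne : {τ | W'.startTime ≤ τ ∧ ∀ x ∈ X', ∃ τ' ≤ τ, (τ', x) ∈ W'.stops}.Nonempty := by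
      refine ⟨(finish W'.start W'.startTime W'.steps).1,
        (stops_bounds _ _ _ W'.isSteps (W'.startTime, W'.start) (by simp)).2, fun x hx => ?_⟩
      obtain ⟨τ, hτ⟩ := hW'.2.2 x hx
      exact ⟨τ, (stops_bounds _ _ _ W'.isSteps _ hτ).2, hτ⟩
    have hm := Nat.sInf_mem hne
    refine h.lt_tourArrival hmin ?_ hX' ⟨hW'.1, hW'.2.1⟩ hm.2
    exact W'.one_le_startTime.trans hm.1
  set W : StrictWalk G := ⟨1, s, S, le_rfl, hL, hS⟩ with hWdef
  have hW : W.IsTour s 1 X := ⟨rfl, rfl, hv⟩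
  have he : W.endTime = (finish s 1 S).1 := congrArg Prod.fst (getLast_stops S s 1)
  have hle : W.tourArrival X ≤ W.endTime := by
    refine Nat.sInf_le ⟨?_, fun x hx => ?_⟩
    · rw [he]; exact (stops_bounds S s 1 hS (1, s) (by simp)).2
    · obtain ⟨τ, hτ⟩ := hv x hx
      refine ⟨τ, ?_, hτ⟩
      rw [he]; exact (stops_bounds S s 1 hS _ hτ).2
  have h1 := tour W X hX hW
  refine ⟨X, hX, hW, by omega, fun W' X' hX' hW' => ?_⟩
  have := tour W' X' hX' hW'
  omega

theorem Foremost.not_kArbitraryTEXP (h : Foremost G R)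
    (hmin : ∀ l : List (Fin n), l.Nodup → l.length = k → L + 1 ≤ (place R s (l.map Fin.val)).1) :
    ¬ KArbitraryTEXP G s k := by
  rintro ⟨W, X, hX, hW⟩
  have := h.lt_tourArrival (τ := L + 1) hmin (by omega) hX ⟨hW.1, hW.2.1⟩ fun x hx => by
    obtain ⟨τ, hτ⟩ := hW.2.2 x hx
    exact ⟨τ, ((stops_bounds _ _ _ W.isSteps _ hτ).2).trans
      (finish_le _ _ _ W.isSteps (W.startTime_le.trans (by omega))), hτ⟩
  omega

end Foremost

end TExp

namespace ForProg
open WordRAM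

/-! ### Notation and rules for programs -/

instance : Add Expr := ⟨.bin .add⟩
instance : Sub Expr := ⟨.bin .sub⟩
instance : Mul Expr := ⟨.bin .mul⟩
instance : Div Expr := ⟨.bin .div⟩
instance : Mod Expr := ⟨.bin .mod⟩
instance (c : ℕ) : OfNat Expr c := ⟨.const c⟩

/-- If `a = b` then `x` else `y`. -/
def Expr.selEq (a b x y : Expr) : Expr := .sel a b y (.sel b a y x)

section Eval

variable (ρ : ℕ → ℕ) (st : St) (a b x y : Expr)

@[simp] theorem eval_add : (a + b).eval ρ st = a.eval ρ st + b.eval ρ st := rfl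
@[simp] theorem eval_sub : (a - b).eval ρ st = a.eval ρ st - b.eval ρ st := rfl
@[simp] theorem eval_mul : (a * b).eval ρ st = a.eval ρ st * b.eval ρ st := rfl
@[simp] theorem eval_div : (a / b).eval ρ st = a.eval ρ st / b.eval ρ st := rfl
@[simp] theorem eval_mod : (a % b).eval ρ st = a.eval ρ st % b.eval ρ st := rfl
@[simp] theorem eval_ofNat (c : ℕ) : (ofNat(c) : Expr).eval ρ st = c := rfl
@[simp] theorem eval_par (i : ℕ) : (Expr.par i).eval ρ st = ρ i := rfl
@[simp] theorem eval_var (i : ℕ) : (Expr.var i).eval ρ st = st.var i := rfl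
@[simp] theorem eval_modSucc : (Expr.modSucc a b).eval ρ st = a.eval ρ st % (b.eval ρ st + 1) := rfl
@[simp] theorem eval_sel : (Expr.sel a b x y).eval ρ st =
    if a.eval ρ st < b.eval ρ st then x.eval ρ st else y.eval ρ st := rfl

@[simp] theorem eval_selEq : (Expr.selEq a b x y).eval ρ st =
    if a.eval ρ st = b.eval ρ st then x.eval ρ st else y.eval ρ st := by
  simp only [Expr.selEq, eval_sel]
  split_ifs <;> first | rfl | omega

@[simp] theorem eval_load_zero : (Expr.load 0 a).eval ρ st = st.arr 0 (a.eval ρ st % ρ 2) := rfl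
@[simp] theorem eval_load_of_ne {j : ℕ} (h : j ≠ 0) : (Expr.load j a).eval ρ st = st.arr j (a.eval ρ st) := by
  simp [Expr.eval, ix, h]

end Eval

section Run

variable {ρ : ℕ → ℕ}

@[simp] theorem run_assign (x : ℕ) (e : Expr) (st : St) :
    (Cmd.assign x e).run ρ st = st.setVar x (e.eval ρ st) := rfl
@[simp] theorem run_seq (c d : Cmd) (st : St) : (c.seq d).run ρ st = d.run ρ (c.run ρ st) := rfl
@[simp] theorem run_store_zero (a e : Expr) (st : St) : (Cmd.store 0 a e).run ρ st =
    st.setArr 0 (a.eval ρ st % ρ 2) (e.eval ρ st) := rfl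
@[simp] theorem run_store_of_ne {j : ℕ} (h : j ≠ 0) (a e : Expr) (st : St) : (Cmd.store j a e).run ρ st =
    st.setArr j (a.eval ρ st) (e.eval ρ st) := by
  simp [Cmd.run, ix, h]

@[simp] theorem setVar_var (st : St) (x v y : ℕ) :
    (st.setVar x v).var y = if y = x then v else st.var y := by
  simp [St.setVar, Function.update_apply]
@[simp] theorem setVar_arr (st : St) (x v : ℕ) : (st.setVar x v).arr = st.arr := rfl
@[simp] theorem setArr_var (st : St) (j i v : ℕ) : (st.setArr j i v).var = st.var := rfl
@[simp] theorem setArr_arr (st : St) (j i v j' i' : ℕ) : (st.setArr j i v).arr j' i' =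
    if j' = j then (if i' = i then v else st.arr j' i') else st.arr j' i' := by
  simp only [St.setArr, Function.update_apply]
  split_ifs with h1 h2
  · simp [h2]
  · subst h1; simp [h2]
  · rfl

theorem setArr_arr_ne (st : St) (j i v j' : ℕ) (h : j' ≠ j) : (st.setArr j i v).arr j' = st.arr j' := by
  simp [St.setArr, h]

theorem run_loop_induct (x p : ℕ) (c : Cmd) (st : St) (I : ℕ → St → Prop) (h0 : I 0 st)
    (hs : ∀ i < ρ p, ∀ s, I i s → I (i + 1) (c.run ρ (s.setVar x i))) :
    I (ρ p) ((Cmd.loop x p c).run ρ st) := by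
  have : ∀ m ≤ ρ p, I m (iter (fun i s => c.run ρ (s.setVar x i)) st m) := by
    intro m
    induction m with
    | zero => exact fun _ => h0
    | succ m ih => exact fun hm => hs m (by omega) _ (ih (by omega))
  exact this _ le_rfl

/-- The variables that a program assigns to. -/
def Cmd.vars : Cmd → List ℕ
  | assign x _ => [x]
  | store _ _ _ => []
  | seq c d => c.vars ++ d.vars
  | loop x _ c => x :: c.vars

/-- The arrays that a program writes to. -/
def Cmd.arrs : Cmd → List ℕ
  | assign _ _ => []
  | store j _ _ => [j]
  | seq c d => c.arrs ++ d.arrs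
  | loop _ _ c => c.arrs

theorem run_var_of_notMem {y : ℕ} : ∀ {c : Cmd} (st : St), y ∉ c.vars →
    (c.run ρ st).var y = st.var y := by
  intro c
  induction c with
  | assign x e => intro st h; rw [run_assign, setVar_var, if_neg (by simpa [Cmd.vars] using h)]
  | store j a e => intro st _; rfl
  | seq c d ihc ihd =>
    intro st h
    simp only [Cmd.vars, List.mem_append, not_or] at h
    rw [run_seq, ihd _ h.2, ihc _ h.1]
  | loop x p c ih =>
    intro st h
    simp only [Cmd.vars, List.mem_cons, not_or] at h
    refine run_loop_induct x p c st (fun _ s => s.var y = st.var y) rfl fun i _ s hs => ?_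
    rw [ih _ h.2, setVar_var, if_neg h.1, hs]

theorem run_arr_of_notMem {j : ℕ} : ∀ {c : Cmd} (st : St), j ∉ c.arrs →
    (c.run ρ st).arr j = st.arr j := by
  intro c
  induction c with
  | assign x e => intro st _; rfl
  | store j' a e =>
    intro st h
    simp only [Cmd.arrs, List.mem_singleton] at h
    exact setArr_arr_ne _ _ _ _ _ h
  | seq c d ihc ihd =>
    intro st h
    simp only [Cmd.arrs, List.mem_append, not_or] at h
    rw [run_seq, ihd _ h.2, ihc _ h.1]
  | loop x p c ih =>
    intro st h
    refine run_loop_induct x p c st (fun _ s => s.arr j = st.arr j) rfl fun i _ s hs => ?_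
    rw [ih _ h, setVar_arr, hs]

/-- Started in a state that satisfies `I`, the program `c` maintains `I` and adds `δ` to the values `val`. -/
def Adds {Z S : Type*} [AddCommMonoid S] (ρ : ℕ → ℕ) (val : St → Z → S) (c : Cmd)
    (I : St → Prop) (δ : Z → S) : Prop :=
  ∀ st, I st → I (c.run ρ st) ∧ ∀ z, val (c.run ρ st) z = val st z + δ z

/-- This turns a nest of accumulating loops into the corresponding nested sum; the invariant of the
body records the loop variables. -/
theorem Adds.loop {Z S : Type*} [AddCommMonoid S] {val : St → Z → S} {c : Cmd} {I : St → Prop}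
    (x p : ℕ) {δ : ℕ → Z → S} (hval : ∀ st i, val (st.setVar x i) = val st)
    (hI : ∀ st i, I st → I (st.setVar x i))
    (h : ∀ i < ρ p, Adds ρ val c (fun st => I st ∧ st.var x = i) (δ i)) :
    Adds ρ val (.loop x p c) I (fun z => ∑ i ∈ Finset.range (ρ p), δ i z) := by
  intro st hst
  refine run_loop_induct x p c st (fun m s => I s ∧ ∀ z, val s z = val st z +
    ∑ i ∈ Finset.range m, δ i z) ⟨hst, fun z => by simp⟩ fun i hi s ⟨h1, h2⟩ => ?_
  obtain ⟨⟨h3, _⟩, h4⟩ := h i hi (s.setVar x i) ⟨hI s i h1, by simp⟩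
  refine ⟨h3, fun z => ?_⟩
  rw [h4 z, hval, h2 z, Finset.sum_range_succ, add_assoc]

end Run

end ForProg

namespace TExp

open ForProg ForProg.Expr ForProg.Cmd

/-! ## The algorithm

Arrays: `0` input and output, `1` foremost arrivals, `2` powers of two, `3` coefficients, `4` tables, `5` the
linear functional for backtracking, `6` and `7` times and places on an optimal walk. Variables: `0` number
of steps of the walk, `1` modulus minus one, `2` level, `3` to `9` times, vertices and sets, `12` to `14` optimal
arrival time, the last vertex and the modulus, `15` to `18` current and next time and place, `26`
answer. -/

/-- The parameters of the algorithm. -/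
def params (n L k s : ℕ) : ℕ → ℕ
  | 0 => n
  | 1 => s
  | 2 => L * n * n + 2 * L + 2
  | 3 => L
  | 4 => k
  | 5 => 2 ^ k
  | 6 => L + 2
  | 7 => (2 * k + 4) * k + 2
  | 8 => k + 1
  | 9 => n * n
  | 10 => n * k * 2 ^ k
  | 11 => (k + 1) * (L + 2) * n * 2 ^ k * 2 ^ k
  | 12 => (k + 1) * 2 ^ k * 2 ^ k
  | 13 => (L + 2) * n
  | _ => 0

/-- Indices of arrays. -/
def arrivalIx (t u v : Expr) : Expr := (t * par 0 + u) * par 0 + v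
def coefIx (v a A : Expr) : Expr := (v * par 4 + a) * par 5 + A
def tableIx (p t v A B : Expr) : Expr :=
  (((p * par 6 + t) * par 0 + v) * par 5 + A) * par 5 + B
def functionalIx (j A B : Expr) : Expr := (j * par 5 + A) * par 5 + B

def initArrivals : Cmd :=
  loop 10 9 (seq (store 1 ((par 3 + 1) * par 9 + var 10) (par 3 + 1))
    (store 1 (par 3 * par 9 + var 10)
      (selEq (var 10 / par 0) (var 10 % par 0) (par 3) (par 3 + 1))))

def minArrival : Cmd :=
  loop 22 0 (assign 11 (sel 0 (load 0 (arrivalIx (var 21) (var 4) (var 22)))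
    (sel (load 1 ((var 21 + 1) * par 9 + (var 22 * par 0 + var 5))) (var 11)
      (load 1 ((var 21 + 1) * par 9 + (var 22 * par 0 + var 5))) (var 11)) (var 11)))

/-- Variable 10 encodes the pair `(u, v)`. The minimum starts with the value for waiting at `u` and
is improved by the neighbours of `u`. -/
def arrivalsAt : Cmd :=
  loop 10 9 (seq (assign 4 (var 10 / par 0)) (seq (assign 5 (var 10 % par 0))
    (seq (assign 11 (load 1 ((var 21 + 1) * par 9 + var 10))) (seq minArrival
      (store 1 (var 21 * par 9 + var 10) (selEq (var 4) (var 5) (var 21) (var 11)))))))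

def arrivals : Cmd :=
  seq initArrivals (loop 2 3 (seq (assign 21 (par 3 - 1 - var 2)) arrivalsAt))

def powers : Cmd :=
  loop 8 4 (store 2 (var 8) (sel 0 (var 8) (modSucc (2 * load 2 (var 8 - 1)) (par 5)) 1))

/-- Increasing flat order guarantees that the entry for `(v, a - 1, A / 2)` is there when needed.
Variable 1, the modulus minus one, serves as `-1`. -/
def coefs : Cmd :=
  loop 10 10 (seq (assign 6 (var 10 % par 5)) (seq (assign 8 (var 10 / par 5 % par 4))
    (seq (assign 5 (var 10 / par 5 / par 4)) (store 3 (var 10) (sel 0 (var 8)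
      (modSucc (sel 0 (var 6 % 2) (var 1) 1 * var 5 *
        load 3 (coefIx (var 5) (var 8 - 1) (var 6 / 2))) (var 1))
      (modSucc (var 6 % 2) (var 1)))))))

/-- Clearing is necessary because the tables are accumulated afresh for each modulus. -/
def initTables : Cmd :=
  seq (loop 10 11 (store 4 (var 10) 0)) (store 4 (tableIx 0 0 (par 1) 0 0) 1)

/-- The time of the target entry is not looped over but looked up from the source time, which keeps
the running time linear in `L`. -/
def relaxBody : Cmd :=
  store 4 (tableIx (var 2 + 1) (load 1 (arrivalIx (var 3) (var 4) (var 5))) (var 5) (var 6) (var 7))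
    (modSucc (load 4 (tableIx (var 2 + 1) (load 1 (arrivalIx (var 3) (var 4) (var 5))) (var 5)
        (var 6) (var 7)) +
      load 3 (coefIx (var 5) (var 8) (var 6)) * load 3 (coefIx (var 5) (var 9) (var 7)) *
        load 4 (tableIx (var 2) (var 3) (var 4) (var 6 - load 2 (var 8)) (var 7 - load 2 (var 9))))
      (var 1))

def relax : Cmd :=
  loop 5 0 (loop 6 5 (loop 7 5 (loop 3 6 (loop 4 0 (loop 8 4 (loop 9 4 relaxBody))))))

def tables : Cmd := seq coefs (seq initTables (loop 2 4 relax))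

def search : Cmd :=
  loop 10 13 (seq (assign 3 (var 10 / par 0)) (seq (assign 5 (var 10 % par 0))
    (seq (assign 24 (sel (var 3) (var 12)
      (modSucc (load 4 (tableIx (par 4) (var 3) (var 5) (par 5 - 1) (par 5 - 1))) (var 1)) 0))
    (seq (assign 13 (sel 0 (var 24) (var 5) (var 13))) (seq (assign 14 (sel 0 (var 24) (var 1) (var 14)))
      (assign 12 (sel 0 (var 24) (var 3) (var 12))))))))

/-- Time `L + 1` stands for "not reachable". The moduli are consecutive and begin just above the
number of moduli times `(k + 1) n (L + 2)`, as `exists_not_dvd` requires. -/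
def optimum : Cmd :=
  seq (assign 12 (par 3 + 1)) (loop 21 7 (seq
    (assign 1 (par 7 * (par 8 * par 0 * par 6) + var 21)) (seq tables search)))

def initFunctional : Cmd :=
  seq (loop 10 12 (store 5 (var 10) 0)) (store 5 (functionalIx 0 (par 5 - 1) (par 5 - 1)) 1)

/-- Several `(A, B, a, b)` may lead to the same cell, hence the accumulation. Each level of the
functional has its own block, so that the source is never overwritten. -/
def contractBody : Cmd :=
  store 5 (functionalIx (var 2 + 1) (var 6 - load 2 (var 8)) (var 7 - load 2 (var 9)))
    (modSucc (load 5 (functionalIx (var 2 + 1) (var 6 - load 2 (var 8)) (var 7 - load 2 (var 9))) +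
      load 3 (coefIx (var 16) (var 8) (var 6)) * load 3 (coefIx (var 16) (var 9) (var 7)) *
        load 5 (functionalIx (var 2) (var 6) (var 7))) (var 1))

def contract : Cmd := loop 6 5 (loop 7 5 (loop 8 4 (loop 9 4 contractBody)))

def evaluate : Cmd :=
  seq (assign 19 0) (loop 6 5 (loop 7 5 (assign 19 (modSucc (var 19 +
    load 5 (functionalIx (var 2 + 1) (var 6) (var 7)) *
      load 4 (tableIx (par 4 - 1 - var 2) (var 3) (var 4) (var 6) (var 7))) (var 1)))))

/-- Every hit overwrites the previous one, so the last predecessor with nonzero value is kept; any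
would do. -/
def predecessor : Cmd :=
  loop 10 13 (seq (assign 3 (var 10 / par 0)) (seq (assign 4 (var 10 % par 0)) (seq evaluate
    (seq (assign 24 (selEq (load 1 (arrivalIx (var 3) (var 4) (var 16))) (var 15)
        (modSucc (var 19) (var 1)) 0))
      (seq (assign 17 (sel 0 (var 24) (var 3) (var 17)))
        (assign 18 (sel 0 (var 24) (var 4) (var 18))))))))

def backtrack : Cmd :=
  loop 2 4 (seq (assign 15 (load 6 (par 4 - var 2))) (seq (assign 16 (load 7 (par 4 - var 2)))
    (seq contract (seq predecessor (seq (store 6 (par 4 - 1 - var 2) (var 17))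
      (store 7 (par 4 - 1 - var 2) (var 18)))))))

def solution : Cmd :=
  seq (assign 1 (var 14)) (seq tables (seq initFunctional (seq (store 6 (par 4) (var 12))
    (seq (store 7 (par 4) (var 13)) backtrack))))

def nextVertex : Cmd :=
  seq (assign 23 (par 0)) (loop 22 0 (assign 23
    (sel 0 (load 0 (arrivalIx (var 21) (var 20) (var 22)))
      (selEq (load 1 (arrivalIx (var 21 + 1) (var 22) (var 5))) (var 3) (var 22) (var 23)) (var 23))))

/-- The move is always written after the end of the walk, but the length grows only if the flag in
variable 25 is set. As the length is at most `L`, the `2 L + 2` cells behind the input suffice;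
reducing it modulo `L + 1` never changes it and only serves the size bounds. -/
def outputStep : Cmd :=
  seq (assign 5 (load 7 (var 2 + 1))) (seq (assign 3 (load 6 (var 2 + 1))) (seq nextVertex
    (seq (assign 25 (sel (var 21) (load 6 (var 2)) 0 (sel (var 21) (var 3)
      (selEq (load 1 (arrivalIx (var 21 + 1) (var 20) (var 5))) (var 3) 0 1) 0)))
    (seq (store 0 (par 3 * par 0 * par 0 + 2 * var 0) (var 21 + 1))
    (seq (store 0 (par 3 * par 0 * par 0 + 2 * var 0 + 1) (var 23))
    (seq (assign 0 (sel 0 (var 25) (modSucc (var 0 + 1) (par 3)) (var 0)))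
      (assign 20 (sel 0 (var 25) (var 23) (var 20)))))))))

def output : Cmd :=
  seq (assign 20 (par 1)) (seq (assign 0 0) (seq (loop 2 4 (loop 21 3 outputStep))
    (assign 26 (sel (var 12) (par 3 + 1) 1 0))))

def algorithm : Cmd := seq arrivals (seq powers (seq optimum (seq solution output)))

/-- The sizes of the numbers in the algorithm. -/
def degs : Degs where
  par i := [1, 1, 6, 1, 1, 1, 3, 7, 2, 2, 3, 8, 4, 4].getD i 0
  -- Variable 21 is a summand of the modulus in variable 1; with degree 20 that sum would get degree
  -- 21.
  var i := if i = 21 then 10 else 20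
  arr _ := 20

/-- Bounds on the parameters. -/
def limits (p : ℕ) : Mono :=
  [⟨1, 1, 0, 0, 0⟩, ⟨1, 1, 0, 0, 0⟩, ⟨5, 2, 1, 0, 0⟩, ⟨1, 0, 1, 0, 0⟩, ⟨1, 0, 0, 0, 1⟩,
    ⟨1, 0, 0, 1, 0⟩, ⟨3, 0, 1, 0, 0⟩, ⟨2, 0, 0, 0, 2⟩, ⟨1, 0, 0, 0, 1⟩, ⟨1, 2, 0, 0, 0⟩,
    ⟨1, 1, 0, 1, 1⟩, ⟨3, 1, 1, 2, 1⟩, ⟨1, 0, 0, 2, 1⟩, ⟨3, 1, 1, 0, 0⟩].getD p ⟨0, 0, 0, 0, 0⟩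

theorem algorithm_ok : algorithm.ok degs 100 = true := by decide +kernel

/-- The factor `n ^ 3` comes from the arrivals, with `L n ^ 2` entries and `n` neighbours each. The
other exponents come from the tables: `O(k ^ 2)` moduli, `k` levels, `4 ^ k` pairs of masks and `k ^
2` pairs of rows, for `O(L n ^ 2)` choices of a time and two vertices. -/
theorem algorithm_cost : (algorithm.cost limits).en ≤ 3 ∧ (algorithm.cost limits).eL ≤ 1 ∧
    (algorithm.cost limits).eK ≤ 2 ∧ (algorithm.cost limits).ek ≤ 5 := by decide +kernel

end TExp

/-! ### Verification: foremost arrivals -/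

namespace TExp
open ForProg ForProg.Expr ForProg.Cmd

section Verification

variable {n L k s : ℕ}

theorem run_loop_params {x p m : ℕ} {c : Cmd} {st : St} (I : ℕ → St → Prop)
    (hm : params n L k s p = m) (h0 : I 0 st)
    (hs : ∀ i < m, ∀ s', I i s' → I (i + 1) (c.run (params n L k s) (s'.setVar x i))) :
    I m ((Cmd.loop x p c).run (params n L k s) st) := by
  subst hm
  exact run_loop_induct x p c st I h0 hs

@[simp] theorem params_zero : params n L k s 0 = n := rfl
@[simp] theorem params_one : params n L k s 1 = s := rfl
@[simp] theorem params_two : params n L k s 2 = L * n * n + 2 * L + 2 := rfl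
@[simp] theorem params_three : params n L k s 3 = L := rfl
@[simp] theorem params_four : params n L k s 4 = k := rfl
@[simp] theorem params_five : params n L k s 5 = 2 ^ k := rfl
@[simp] theorem params_six : params n L k s 6 = L + 2 := rfl
@[simp] theorem params_seven : params n L k s 7 = (2 * k + 4) * k + 2 := rfl
@[simp] theorem params_eight : params n L k s 8 = k + 1 := rfl
@[simp] theorem params_nine : params n L k s 9 = n * n := rfl

theorem flat_lt {m n i j : ℕ} (hi : i < m) (hj : j < n) : i * n + j < m * n := by
  calc i * n + j < i * n + n := by omega
    _ = (i + 1) * n := by ring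
    _ ≤ m * n := Nat.mul_le_mul_right _ hi

theorem flat_inj {n i j i' j' : ℕ} (hj : j < n) (hj' : j' < n) :
    i * n + j = i' * n + j' ↔ i = i' ∧ j = j' := by
  constructor
  · intro h
    have h1 : (i * n + j) / n = i := by
      rw [mul_comm, Nat.mul_add_div (by omega), Nat.div_eq_of_lt hj, add_zero]
    have h2 : (i' * n + j') / n = i' := by
      rw [mul_comm, Nat.mul_add_div (by omega), Nat.div_eq_of_lt hj', add_zero]
    have h3 : i = i' := by rw [← h1, ← h2, h]
    subst h3
    exact ⟨rfl, by omega⟩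
  · rintro ⟨rfl, rfl⟩; rfl

theorem flat_div {n i j : ℕ} (hj : j < n) : (i * n + j) / n = i := by
  rw [mul_comm, Nat.mul_add_div (by omega), Nat.div_eq_of_lt hj, add_zero]

theorem flat_mod {n i j : ℕ} (hj : j < n) : (i * n + j) % n = j := by
  rw [mul_comm, Nat.mul_add_mod, Nat.mod_eq_of_lt hj]

theorem arrival_lt {i u v : ℕ} (hi : i < L) (hu : u < n) (hv : v < n) :
    (i * n + u) * n + v < L * n * n := flat_lt (flat_lt hi hu) hv

theorem input_mod {i u v : ℕ} (hi : i < L) (hu : u < n) (hv : v < n) :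
    ((i * n + u) * n + v) % (L * n * n + 2 * L + 2) = (i * n + u) * n + v :=
  Nat.mod_eq_of_lt (by have := arrival_lt hi hu hv; omega)

theorem minArrival_run {st : St} {i u v : ℕ} (hi : i < L) (h21 : st.var 21 = i) (h4 : st.var 4 = u)
    (h5 : st.var 5 = v) (hu : u < n) :
    let c := (minArrival.run (params n L k s) st).var 11
    let next := fun x => st.arr 1 ((i + 1) * (n * n) + (x * n + v))
    c ≤ st.var 11 ∧ (∀ x < n, 0 < st.arr 0 ((i * n + u) * n + x) → c ≤ next x) ∧
      (c = st.var 11 ∨ ∃ x < n, 0 < st.arr 0 ((i * n + u) * n + x) ∧ c = next x) := by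
  intro c next
  have := run_loop_params (n := n) (L := L) (k := k) (s := s) (x := 22) (p := 0) (m := n) (st := st)
    (c := assign 11 (sel 0 (load 0 (arrivalIx (var 21) (var 4) (var 22)))
    (sel (load 1 ((var 21 + 1) * par 9 + (var 22 * par 0 + var 5))) (var 11)
      (load 1 ((var 21 + 1) * par 9 + (var 22 * par 0 + var 5))) (var 11)) (var 11)))
    (fun m s' => s'.arr = st.arr ∧ s'.var 21 = i ∧ s'.var 4 = u ∧ s'.var 5 = v ∧
      s'.var 11 ≤ st.var 11 ∧
      (∀ x < m, 0 < st.arr 0 ((i * n + u) * n + x) → s'.var 11 ≤ next x) ∧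
      (s'.var 11 = st.var 11 ∨ ∃ x < m, 0 < st.arr 0 ((i * n + u) * n + x) ∧ s'.var 11 = next x))
    rfl ⟨rfl, h21, h4, h5, le_rfl, by simp, .inl rfl⟩ ?_
  · exact this.2.2.2.2
  · rintro x hx s' ⟨ha, e21, e4, e5, h1, h2, h3⟩
    have hm := input_mod hi hu hx
    refine ⟨ha, by simpa, by simpa, by simpa, ?_⟩
    simp only [run_assign, eval_sel, eval_ofNat, eval_load_zero, arrivalIx, eval_add, eval_mul,
      eval_var, eval_par, setVar_var, setVar_arr, ha, e21, e4, e5, params_zero, params_two, hm,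
      ne_eq, one_ne_zero, not_false_eq_true, eval_load_of_ne, params_nine, if_true, Nat.reduceEqDiff, if_false]
    have hnext : st.arr 1 ((i + 1) * (n * n) + (x * n + v)) = next x := rfl
    simp only [hnext]
    have h2' : ∀ y < x + 1, 0 < st.arr 0 ((i * n + u) * n + y) →
        y = x ∨ s'.var 11 ≤ next y := fun y hy h => by
      by_cases hyx : y = x
      · exact .inl hyx
      · exact .inr (h2 y (by omega) h)
    split_ifs with hadj hlt
    · refine ⟨by omega, fun y hy h => ?_, .inr ⟨x, by omega, hadj, rfl⟩⟩
      rcases h2' y hy h with rfl | h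
      · rfl
      · omega
    · refine ⟨h1, fun y hy h => ?_, h3.imp_right fun ⟨y, hy, h⟩ => ⟨y, by omega, h⟩⟩
      rcases h2' y hy h with rfl | h
      · omega
      · omega
    · refine ⟨h1, fun y hy h => ?_, h3.imp_right fun ⟨y, hy, h⟩ => ⟨y, by omega, h⟩⟩
      rcases h2' y hy h with rfl | h'
      · exact absurd h hadj
      · exact h'

/-- The recursion for the arrival time `c` at `v` from `u`, starting at time `i`. -/
def ArrivalStep (n : ℕ) (adj next : ℕ → ℕ) (i u v c : ℕ) : Prop :=
  (u = v → c = i) ∧ (u ≠ v → c ≤ next (u * n + v) ∧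
    (∀ x < n, 0 < adj ((i * n + u) * n + x) → c ≤ next (x * n + v)) ∧
    (c = next (u * n + v) ∨ ∃ x < n, 0 < adj ((i * n + u) * n + x) ∧ c = next (x * n + v)))

theorem arrivalsAt_run {st : St} {i : ℕ} (hi : i < L) (h21 : st.var 21 = i) :
    let a := ((arrivalsAt.run (params n L k s) st).arr 1)
    (∀ y, (i + 1) * (n * n) ≤ y → a y = st.arr 1 y) ∧
    ∀ u < n, ∀ v < n, ArrivalStep n (st.arr 0) (fun y => st.arr 1 ((i + 1) * (n * n) + y)) i u v
      (a (i * (n * n) + (u * n + v))) := by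
  intro a
  have := run_loop_params (n := n) (L := L) (k := k) (s := s) (x := 10) (p := 9) (st := st)
    (c := (seq (assign 4 (var 10 / par 0)) (seq (assign 5 (var 10 % par 0))
    (seq (assign 11 (load 1 ((var 21 + 1) * par 9 + var 10))) (seq minArrival
      (store 1 (var 21 * par 9 + var 10) (selEq (var 4) (var 5) (var 21) (var 11))))))))
    (fun m s' => s'.var 21 = i ∧ s'.arr 0 = st.arr 0 ∧
      (∀ y, (i + 1) * (n * n) ≤ y → s'.arr 1 y = st.arr 1 y) ∧
      ∀ z < m, ArrivalStep n (st.arr 0) (fun y => st.arr 1 ((i + 1) * (n * n) + y)) i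
        (z / n) (z % n) (s'.arr 1 (i * (n * n) + z))) rfl
    ⟨h21, rfl, fun _ _ => rfl, by simp⟩ ?_
  · refine ⟨this.2.2.1, fun u hu v hv => ?_⟩
    have h := this.2.2.2 (u * n + v) (flat_lt hu hv)
    rwa [flat_div hv, flat_mod hv] at h
  · rintro z hz s' ⟨e21, e0, h1, h2⟩
    have hz' : z < n * n := hz
    have hn : 0 < n := Nat.pos_of_ne_zero (by rintro rfl; simp at hz')
    have hu : z / n < n := Nat.div_lt_of_lt_mul hz'
    have hv : z % n < n := Nat.mod_lt _ hn
    set s₁ := (assign 11 (load 1 ((var 21 + 1) * par 9 + var 10))).run (params n L k s)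
      ((assign 5 (var 10 % par 0)).run (params n L k s)
        ((assign 4 (var 10 / par 0)).run (params n L k s) (s'.setVar 10 z))) with hs₁
    have a1 : s₁.arr = s'.arr := rfl
    have v21 : s₁.var 21 = i := by simp [hs₁, e21]
    have v4 : s₁.var 4 = z / n := by simp [hs₁]
    have v5 : s₁.var 5 = z % n := by simp [hs₁]
    have v10 : s₁.var 10 = z := by simp [hs₁]
    have v11 : s₁.var 11 = s'.arr 1 ((i + 1) * (n * n) + z) := by simp [hs₁, e21]
    obtain ⟨c1, c2, c3⟩ := minArrival_run (k := k) (s := s) hi v21 v4 v5 hu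
    have f : ∀ y, y ∉ minArrival.vars → (minArrival.run (params n L k s) s₁).var y = s₁.var y :=
      fun y hy => run_var_of_notMem _ hy
    have f0 : (minArrival.run (params n L k s) s₁).arr 0 = s₁.arr 0 :=
      run_arr_of_notMem _ (by decide)
    have f1 : (minArrival.run (params n L k s) s₁).arr 1 = s₁.arr 1 :=
      run_arr_of_notMem _ (by decide)
    have key : ∀ y, s'.arr 1 ((i + 1) * (n * n) + y) = st.arr 1 ((i + 1) * (n * n) + y) :=
      fun y => h1 _ (by omega)
    rw [v11, key] at c1 c3
    simp only [a1, e0, key] at c2 c3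
    have hzn : z / n * n + z % n = z := Nat.div_add_mod' z n
    rw [run_seq, run_seq, run_seq, run_seq, ← hs₁]
    simp only [run_store_of_ne, ne_eq, one_ne_zero, not_false_eq_true, eval_add, eval_mul, eval_var,
      eval_par, eval_selEq, setArr_var, setArr_arr, f 21 (by decide), f 10 (by decide),
      f 4 (by decide), f 5 (by decide), f1, v21, v4, v5, v10, params_nine, a1, if_true]
    refine ⟨trivial, ?_, fun y hy => ?_, fun w hw => ?_⟩
    · funext y; simp [f0, a1, e0]
    · rw [if_neg, h1 y hy]
      have : (i + 1) * (n * n) = i * (n * n) + n * n := by ring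
      omega
    · by_cases hwz : w = z
      · subst hwz
        rw [if_pos rfl]
        refine ⟨fun h => by rw [if_pos h], fun h => ?_⟩
        rw [if_neg h]
        simp only [hzn]
        exact ⟨c1, c2, c3⟩
      · rw [if_neg (by omega)]
        exact h2 w (by omega)

theorem initArrivals_run (st : St) :
    let a := ((initArrivals.run (params n L k s) st).arr 1)
    ∀ u < n, ∀ v < n, a ((L + 1) * (n * n) + (u * n + v)) = L + 1 ∧
      a (L * (n * n) + (u * n + v)) = if u = v then L else L + 1 := by
  intro a
  have := run_loop_params (n := n) (L := L) (k := k) (s := s) (x := 10) (p := 9) (st := st)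
    (c := (seq (store 1 ((par 3 + 1) * par 9 + var 10) (par 3 + 1))
    (store 1 (par 3 * par 9 + var 10)
      (selEq (var 10 / par 0) (var 10 % par 0) (par 3) (par 3 + 1)))))
    (fun m s' => ∀ z < m, s'.arr 1 ((L + 1) * (n * n) + z) = L + 1 ∧
      s'.arr 1 (L * (n * n) + z) = if z / n = z % n then L else L + 1) rfl
    (by simp) ?_
  · intro u hu v hv
    have h := this (u * n + v) (flat_lt hu hv)
    rwa [flat_div hv, flat_mod hv] at h
  · intro z hz s' h w hw
    have hz' : z < n * n := hz
    have e : (L + 1) * (n * n) = L * (n * n) + n * n := by ring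
    simp only [run_seq, run_store_of_ne, ne_eq, one_ne_zero, not_false_eq_true, eval_add, eval_mul,
      eval_var, eval_par, eval_selEq, eval_div, eval_mod, eval_ofNat, setArr_var, setArr_arr,
      setVar_var, setVar_arr, params_nine, params_three, params_zero, if_true]
    by_cases hwz : w = z
    · subst hwz
      rw [if_neg (by omega), if_pos rfl, if_pos rfl]
      exact ⟨rfl, rfl⟩
    · rw [if_neg (by omega), if_neg (by omega), if_neg (by omega), if_neg (by omega)]
      exact h w (by omega)

/-- Layers are treated from the last to the first. After `m` rounds the layers from `L - m` on
satisfy the recursion, and later rounds do not touch them. -/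
theorem foremost_arrivals {G : TemporalGraph (Fin n) L} {st : St}
    (hadj : ∀ (i : Fin L) (u v : Fin n),
      0 < st.arr 0 (((i : ℕ) * n + u) * n + v) ↔ (G.layer i).Adj u v) :
    Foremost G fun t u v => (arrivals.run (params n L k s) st).arr 1 ((t * n + u) * n + v) := by
  set s₁ := initArrivals.run (params n L k s) st with hs₁
  have h0 := initArrivals_run (n := n) (L := L) (k := k) (s := s) st
  have e0 : s₁.arr 0 = st.arr 0 := run_arr_of_notMem _ (by decide)
  have := run_loop_params (n := n) (L := L) (k := k) (s := s) (x := 2) (p := 3) (m := L) (st := s₁)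
    (c := (seq (assign 21 (par 3 - 1 - var 2)) arrivalsAt))
    (fun m s' => s'.arr 0 = st.arr 0 ∧ (∀ y, L * (n * n) ≤ y → s'.arr 1 y = s₁.arr 1 y) ∧
      ∀ i, L - m ≤ i → i < L → ∀ u < n, ∀ v < n, ArrivalStep n (st.arr 0)
        (fun y => s'.arr 1 ((i + 1) * (n * n) + y)) i u v (s'.arr 1 (i * (n * n) + (u * n + v)))) rfl
    ⟨e0, fun _ _ => rfl, fun i h1 h2 => by omega⟩ ?_
  · obtain ⟨-, h1, h2⟩ := this
    set a := (arrivals.run (params n L k s) st).arr 1 with ha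
    have e : ∀ t u v, (t * n + u) * n + v = t * (n * n) + (u * n + v) := fun t u v => by ring
    have hL1 : (L + 1) * (n * n) = L * (n * n) + n * n := by ring
    simp only [e]
    constructor
    · intro u v
      exact (h1 _ (by omega)).trans (h0 u u.2 v v.2).1
    · intro u v huv
      refine (h1 _ (by omega)).trans ((h0 u u.2 v v.2).2.trans (if_neg fun h => huv (Fin.ext h)))
    · intro i hi u
      rcases Nat.lt_or_ge i L with h | h
      · exact (h2 i (by omega) h u u.2 u u.2).1 rfl
      · obtain rfl : i = L := by omega
        exact (h1 _ (by omega)).trans ((h0 u u.2 u u.2).2.trans (if_pos rfl))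
    · intro i hi u v huv
      exact ((h2 i (by omega) hi u u.2 v v.2).2 fun h => huv (Fin.ext h)).1
    · intro i hi u x v huv hx
      exact ((h2 i (by omega) hi u u.2 v v.2).2 fun h => huv (Fin.ext h)).2.1 x x.2
        ((hadj ⟨i, hi⟩ u x).2 hx)
    · intro i hi u v huv
      rcases ((h2 i (by omega) hi u u.2 v v.2).2 fun h => huv (Fin.ext h)).2.2 with h | ⟨x, hx, h, h'⟩
      · exact .inl h
      · exact .inr ⟨⟨x, hx⟩, (hadj ⟨i, hi⟩ u ⟨x, hx⟩).1 h, h'⟩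
  · rintro m hm s' ⟨a0, h1, h2⟩
    rw [run_seq]
    set s₂ := (assign 21 (par 3 - 1 - var 2)).run (params n L k s) (s'.setVar 2 m) with hs₂
    have v21 : s₂.var 21 = L - 1 - m := by simp [hs₂]
    have a2 : s₂.arr = s'.arr := rfl
    obtain ⟨g1, g2⟩ := arrivalsAt_run (n := n) (L := L) (k := k) (s := s) (by omega) v21
    rw [a2] at g1 g2
    rw [show L - 1 - m + 1 = L - m by omega] at g1 g2
    have mon : ∀ {i}, L - m ≤ i → (L - m) * (n * n) ≤ i * (n * n) :=
      fun h => Nat.mul_le_mul_right _ h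
    refine ⟨?_, fun y hy => ?_, fun i h3 h4 u hu v hv => ?_⟩
    · rw [run_arr_of_notMem _ (by decide), a2, a0]
    · rw [g1 y ((mon (by omega)).trans hy), h1 y hy]
    · by_cases hi : i = L - 1 - m
      · have h5 := g2 u hu v hv
        rw [← hi, a0] at h5
        have e1 : i + 1 = L - m := by omega
        rw [e1]
        convert h5 using 2 with y
        exact g1 _ (by omega)
      · have h5 := h2 i (by omega) h4 u hu v hv
        have h6 := mon (i := i) (by omega)
        have h7 := mon (i := i + 1) (by omega)
        rwa [g1 _ (by omega), show (fun y => (arrivalsAt.run (params n L k s) s₂).arr 1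
          ((i + 1) * (n * n) + y)) = fun y => s'.arr 1 ((i + 1) * (n * n) + y) from
            funext fun y => g1 _ (by omega)]

end Verification

end TExp

/-! ### Verification: coefficients and tables modulo `Q + 1` -/

namespace TExp
open ForProg ForProg.Expr ForProg.Cmd

section Verification

variable {n L k s : ℕ}


theorem powers_run (st : St) : ∀ a < k, (powers.run (params n L k s) st).arr 2 a = 2 ^ a := by
  refine run_loop_params (fun m s' => ∀ a < m, s'.arr 2 a = 2 ^ a) rfl (by simp) ?_
  intro a ha s' h b hb
  have ha' : a < k := ha
  simp only [run_store_of_ne, ne_eq, OfNat.ofNat_ne_zero, not_false_eq_true, eval_var, eval_sel,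
    eval_ofNat, eval_modSucc, eval_mul, eval_load_of_ne, eval_sub, eval_par, setVar_var, setVar_arr,
    setArr_arr, params_five, if_true]
  by_cases hba : b = a
  · subst hba
    rw [if_pos rfl]
    split_ifs with h0
    · obtain ⟨c, rfl⟩ : ∃ c, b = c + 1 := ⟨b - 1, by omega⟩
      have hlt : (2 : ℕ) ^ (c + 1) ≤ 2 ^ k := Nat.pow_le_pow_right (by norm_num) ha'.le
      rw [show c + 1 - 1 = c from rfl, h c (by omega), ← pow_succ', Nat.mod_eq_of_lt (by omega)]
    · obtain rfl : b = 0 := by omega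
      rfl
  · rw [if_neg hba]; exact h b (by omega)

/-- The array holds the coefficients modulo `Q + 1`. -/
def CoefTable (n k Q : ℕ) (c : ℕ → ℕ) : Prop :=
  ∀ v < n, ∀ a < k, ∀ A < 2 ^ k, (c ((v * k + a) * 2 ^ k + A) : ZMod (Q + 1)) = coef _ v a A

theorem neg_one_eq_natCast (Q : ℕ) : (Q : ZMod (Q + 1)) = -1 := by
  have : ((Q + 1 : ℕ) : ZMod (Q + 1)) = 0 := ZMod.natCast_self _
  push_cast at this
  exact eq_neg_of_add_eq_zero_left this

theorem coefs_run {st : St} {Q : ℕ} (hQ : st.var 1 = Q) :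
    CoefTable n k Q ((coefs.run (params n L k s) st).arr 3) := by
  have := run_loop_params (n := n) (L := L) (k := k) (s := s) (x := 10) (p := 10) (st := st)
    (c := (seq (assign 6 (var 10 % par 5)) (seq (assign 8 (var 10 / par 5 % par 4))
    (seq (assign 5 (var 10 / par 5 / par 4)) (store 3 (var 10) (sel 0 (var 8)
      (modSucc (sel 0 (var 6 % 2) (var 1) 1 * var 5 *
        load 3 (coefIx (var 5) (var 8 - 1) (var 6 / 2))) (var 1))
      (modSucc (var 6 % 2) (var 1))))))))
    (fun m s' => s'.var 1 = Q ∧ ∀ z < m, (s'.arr 3 z : ZMod (Q + 1)) =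
      coef _ (z / 2 ^ k / k) (z / 2 ^ k % k) (z % 2 ^ k)) rfl ⟨hQ, by simp⟩ ?_
  · intro v hv a ha A hA
    have h := this.2 ((v * k + a) * 2 ^ k + A) (flat_lt (flat_lt hv ha) hA)
    rwa [flat_div hA, flat_mod hA, flat_div ha, flat_mod ha] at h
  · rintro z hz s' ⟨h1, h⟩
    have hz' : z < n * k * 2 ^ k := hz
    have hK : 0 < 2 ^ k := by positivity
    have hk : 0 < k := Nat.pos_of_ne_zero (by rintro rfl; simp at hz')
    refine ⟨by simpa, fun y hy => ?_⟩
    simp only [run_seq, run_assign, run_store_of_ne, ne_eq, OfNat.ofNat_ne_zero, not_false_eq_true,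
      eval_var, eval_sel, eval_ofNat, eval_modSucc, eval_mul, eval_div, eval_mod, eval_load_of_ne,
      eval_sub, eval_par, setVar_var, setVar_arr, setArr_arr, params_five, params_four, if_true,
      coefIx, eval_add, Nat.reduceEqDiff, if_false, OfNat.one_ne_ofNat]
    by_cases hyz : y = z
    · subst hyz
      rw [if_pos rfl]
      set A := y % 2 ^ k with hA
      set a := y / 2 ^ k % k with ha
      set v := y / 2 ^ k / k with hv
      have hA' : A < 2 ^ k := Nat.mod_lt _ hK
      have ha' : a < k := Nat.mod_lt _ hk
      have hy : y = (v * k + a) * 2 ^ k + A := by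
        rw [hv, ha, Nat.div_add_mod', hA, Nat.div_add_mod']
      split_ifs with h0 h2
      all_goals first
        -- Lowering `a` by one moves the index back by a full block of `2 ^ k`, whatever the mask,
        -- so the entry read has already been computed.
        | (have hlt : (v * k + (a - 1)) * 2 ^ k + A / 2 < y := by
            rw [hy]
            have : (v * k + (a - 1)) * 2 ^ k + 2 ^ k = (v * k + a) * 2 ^ k := by
              obtain ⟨c, hc⟩ : ∃ c, a = c + 1 := ⟨a - 1, by omega⟩
              rw [hc]; simp only [Nat.add_sub_cancel]; ring
            omega
           have hA2 : A / 2 < 2 ^ k := by omega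
           have ha2 : a - 1 < k := by omega
           have hprev := h _ hlt
           rw [flat_div hA2, flat_mod hA2, flat_div ha2, flat_mod ha2] at hprev
           obtain ⟨c, hc⟩ : ∃ c, a = c + 1 := ⟨a - 1, by omega⟩
           rw [hc] at hprev ⊢
           simp only [Nat.add_sub_cancel] at hprev ⊢
           rw [coef, h1]
           first
             | rw [if_pos h2, ZMod.natCast_mod]; push_cast
               rw [hprev, neg_one_eq_natCast]
             | rw [if_neg h2, ZMod.natCast_mod]; push_cast
               rw [hprev])
        | (rw [show a = 0 by omega, coef, h1, ZMod.natCast_mod])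
    · rw [if_neg hyz]; exact h y (by omega)

/-- The position of an entry in the table. -/
def tableAt (n L k p t v A B : ℕ) : ℕ :=
  (((p * (L + 2) + t) * n + v) * 2 ^ k + A) * 2 ^ k + B

theorem tableAt_lt {p t v A B : ℕ} (hp : p ≤ k) (ht : t < L + 2) (hv : v < n) (hA : A < 2 ^ k)
    (hB : B < 2 ^ k) : tableAt n L k p t v A B < (k + 1) * (L + 2) * n * 2 ^ k * 2 ^ k :=
  flat_lt (flat_lt (flat_lt (flat_lt (Nat.lt_succ_of_le hp) ht) hv) hA) hB

theorem tableAt_inj {p t v A B p' t' v' A' B' : ℕ} (ht : t < L + 2) (hv : v < n) (hA : A < 2 ^ k)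
    (hB : B < 2 ^ k) (ht' : t' < L + 2) (hv' : v' < n) (hA' : A' < 2 ^ k) (hB' : B' < 2 ^ k) :
    tableAt n L k p t v A B = tableAt n L k p' t' v' A' B' ↔
      (((p = p' ∧ t = t') ∧ v = v') ∧ A = A') ∧ B = B' := by
  unfold tableAt
  rw [flat_inj hB hB', flat_inj hA hA', flat_inj hv hv', flat_inj ht ht']

/-- The array holds the first `m` levels of the table modulo `Q + 1`, and zeros otherwise. -/
def TableUpTo (n L k s Q : ℕ) (R : ℕ → ℕ → ℕ → ℕ) (m : ℕ) (c : ℕ → ℕ) : Prop :=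
  ∀ p ≤ k, ∀ t < L + 2, ∀ v < n, ∀ A < 2 ^ k, ∀ B < 2 ^ k,
    (c (tableAt n L k p t v A B) : ZMod (Q + 1)) =
      if p ≤ m then table _ k n (L + 2) s R p t v A B else 0

theorem initTables_run (st : St) {Q : ℕ} {R : ℕ → ℕ → ℕ → ℕ} (hs : s < n) :
    TableUpTo n L k s Q R 0 ((initTables.run (params n L k s) st).arr 4) := by
  have := run_loop_params (n := n) (L := L) (k := k) (s := s) (x := 10) (p := 11) (st := st)
    (c := store 4 (var 10) 0) (fun m s' => ∀ z < m, s'.arr 4 z = 0) rfl (by simp) ?_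
  · intro p hp t ht v hv A hA B hB
    have hK : 0 < 2 ^ k := by positivity
    have h := this _ (tableAt_lt hp ht hv hA hB)
    have e : (((0 * (L + 2) + 0) * n + s) * 2 ^ k + 0) * 2 ^ k + 0 = tableAt n L k 0 0 s 0 0 := rfl
    simp only [initTables, run_seq, run_store_of_ne, ne_eq, OfNat.ofNat_ne_zero, not_false_eq_true,
      tableIx, eval_add, eval_mul, eval_ofNat, eval_par, setArr_arr, params_one, params_five,
      params_six, params_zero, if_true, e, h]
    simp only [tableAt_inj ht hv hA hB (show 0 < L + 2 by omega) hs hK hK]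
    by_cases hp0 : p ≤ 0
    · obtain rfl : p = 0 := by omega
      simp only [le_refl, if_true, table, true_and]
      push_cast
      simp only [and_assoc]
    · rw [if_neg hp0, if_neg (by omega)]; simp
  · intro z hz s' h y hy
    simp only [run_store_of_ne, ne_eq, OfNat.ofNat_ne_zero, not_false_eq_true, eval_var, eval_ofNat,
      setVar_var, setVar_arr, setArr_arr, if_true]
    split_ifs with h'
    · rfl
    · exact h y (by omega)

/-- What the program relies on when it computes level `p + 1` of the table. -/
structure RelaxInv (n L k s Q : ℕ) (c : ℕ → ℕ) (p : ℕ) (st : St) : Prop where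
  modulus : st.var 1 = Q
  level : st.var 2 = p
  arrival : st.arr 1 = c
  pow : ∀ a < k, st.arr 2 a = 2 ^ a
  coef : CoefTable n k Q (st.arr 3)
  prev : ∀ t < L + 2, ∀ v < n, ∀ A < 2 ^ k, ∀ B < 2 ^ k,
    (st.arr 4 (tableAt n L k p t v A B) : ZMod (Q + 1)) =
      table _ k n (L + 2) s (fun t u v => c ((t * n + u) * n + v)) p t v A B

theorem RelaxInv.setVar {Q : ℕ} {c : ℕ → ℕ} {p : ℕ} {st : St} (h : RelaxInv n L k s Q c p st)
    {x : ℕ} (i : ℕ) (h1 : x ≠ 1) (h2 : x ≠ 2) : RelaxInv n L k s Q c p (st.setVar x i) where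
  modulus := by rw [setVar_var, if_neg h1.symm, h.modulus]
  level := by rw [setVar_var, if_neg h2.symm, h.level]
  arrival := h.arrival
  pow := h.pow
  coef := h.coef
  prev := h.prev

/-- The indices of the entries of the table. -/
def Entry (n L k : ℕ) : Type :=
  {z : ℕ × ℕ × ℕ × ℕ × ℕ //
    z.1 ≤ k ∧ z.2.1 < L + 2 ∧ z.2.2.1 < n ∧ z.2.2.2.1 < 2 ^ k ∧ z.2.2.2.2 < 2 ^ k}

/-- An entry of the table. -/
def entryVal (Q : ℕ) (st : St) (z : Entry n L k) : ZMod (Q + 1) :=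
  st.arr 4 (tableAt n L k z.1.1 z.1.2.1 z.1.2.2.1 z.1.2.2.2.1 z.1.2.2.2.2)

/-- The store hits level `p + 1` and all table values used as sources lie in level `p`, so the
values in `RelaxInv` persist and exactly one entry grows. -/
theorem adds_relaxBody {Q p t u v A B a b : ℕ} {c : ℕ → ℕ}
    (hc : ∀ t < L + 2, ∀ u < n, ∀ v < n, c ((t * n + u) * n + v) < L + 2) (ht : t < L + 2)
    (hu : u < n) (hv : v < n) (hA : A < 2 ^ k) (hB : B < 2 ^ k) (ha : a < k) (hb : b < k) :
    Adds (params n L k s) (entryVal (n := n) (L := L) (k := k) Q) relaxBody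
      (fun st => (((((((RelaxInv n L k s Q c p st ∧ st.var 5 = v) ∧ st.var 6 = A) ∧ st.var 7 = B) ∧
        st.var 3 = t) ∧ st.var 4 = u) ∧ st.var 8 = a) ∧ st.var 9 = b))
      (fun z => if z.1.1 = p + 1 ∧ z.1.2.2.1 = v ∧ z.1.2.2.2.1 = A ∧ z.1.2.2.2.2 = B ∧
        c ((t * n + u) * n + v) = z.1.2.1 then
        coef _ v a A * coef _ v b B * table _ k n (L + 2) s (fun t u v => c ((t * n + u) * n + v)) p t u
          (A - 2 ^ a) (B - 2 ^ b) else 0) := by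
  rintro st ⟨⟨⟨⟨⟨⟨⟨hI, h5⟩, h6⟩, h7⟩, h3⟩, h4⟩, h8⟩, h9⟩
  have hr := hc t ht u hu v hv
  have hAa : A - 2 ^ a < 2 ^ k := (Nat.sub_le _ _).trans_lt hA
  have hBb : B - 2 ^ b < 2 ^ k := (Nat.sub_le _ _).trans_lt hB
  set r := c ((t * n + u) * n + v) with hrdef
  set X := st.arr 4 (tableAt n L k (p + 1) r v A B) + st.arr 3 ((v * k + a) * 2 ^ k + A) *
    st.arr 3 ((v * k + b) * 2 ^ k + B) *
      st.arr 4 (tableAt n L k p t u (A - 2 ^ a) (B - 2 ^ b)) with hX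
  have hrun : relaxBody.run (params n L k s) st =
      st.setArr 4 (tableAt n L k (p + 1) r v A B) (X % (Q + 1)) := by
    simp only [relaxBody, run_store_of_ne, ne_eq, OfNat.ofNat_ne_zero, one_ne_zero,
      not_false_eq_true, eval_var, eval_ofNat, eval_modSucc, eval_mul, eval_load_of_ne, eval_sub,
      eval_par, eval_add, tableIx, arrivalIx, coefIx, hI.modulus, hI.level, hI.arrival, h5, h6, h7,
      h3, h4, h8, h9, params_zero, params_four, params_five, params_six, hI.pow a ha, hI.pow b hb,
      hX, hrdef, tableAt]
  have hne : ∀ (p' t' v' A' B' : ℕ), t' < L + 2 → v' < n → A' < 2 ^ k → B' < 2 ^ k →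
      (st.setArr 4 (tableAt n L k (p + 1) r v A B) (X % (Q + 1))).arr 4 (tableAt n L k p' t' v' A' B')
        = if (((p' = p + 1 ∧ t' = r) ∧ v' = v) ∧ A' = A) ∧ B' = B then X % (Q + 1)
          else st.arr 4 (tableAt n L k p' t' v' A' B') := by
    intro p' t' v' A' B' h1 h2 h3 h4
    rw [setArr_arr, if_pos rfl]
    simp only [tableAt_inj h1 h2 h3 h4 hr hv hA hB]
  rw [hrun]
  refine ⟨⟨⟨⟨⟨⟨⟨⟨⟨hI.modulus, hI.level, ?_, ?_, ?_, ?_⟩, h5⟩, h6⟩, h7⟩, h3⟩, h4⟩, h8⟩, h9⟩, ?_⟩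
  · rw [setArr_arr_ne _ _ _ _ _ (by decide)]; exact hI.arrival
  · rw [setArr_arr_ne _ _ _ _ _ (by decide)]; exact hI.pow
  · rw [setArr_arr_ne _ _ _ _ _ (by decide)]; exact hI.coef
  · intro t' ht' v' hv' A' hA' B' hB'
    rw [hne p t' v' A' B' ht' hv' hA' hB', if_neg (by omega)]
    exact hI.prev t' ht' v' hv' A' hA' B' hB'
  · rintro ⟨⟨p', t', v', A', B'⟩, hp', ht', hv', hA', hB'⟩
    simp only at hp' ht' hv' hA' hB'
    simp only [entryVal]
    rw [hne p' t' v' A' B' ht' hv' hA' hB']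
    by_cases h : p' = p + 1 ∧ v' = v ∧ A' = A ∧ B' = B ∧ r = t'
    · obtain ⟨rfl, rfl, rfl, rfl, rfl⟩ := h
      simp only [and_self, if_true]
      rw [ZMod.natCast_mod, hX]
      push_cast
      rw [hI.coef _ hv' _ ha _ hA', hI.coef _ hv' _ hb _ hB', hI.prev _ ht _ hu _ hAa _ hBb]
    · rw [if_neg h, if_neg, add_zero]
      tauto

theorem adds_relax {Q p : ℕ} {c : ℕ → ℕ}
    (hc : ∀ t < L + 2, ∀ u < n, ∀ v < n, c ((t * n + u) * n + v) < L + 2) :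
    Adds (params n L k s) (entryVal (n := n) (L := L) (k := k) Q) relax (RelaxInv n L k s Q c p)
      (fun z => if z.1.1 = p + 1 then
        table _ k n (L + 2) s (fun t u v => c ((t * n + u) * n + v)) z.1.1 z.1.2.1 z.1.2.2.1
          z.1.2.2.2.1 z.1.2.2.2.2 else 0) := by
  have H : Adds (params n L k s) (entryVal (n := n) (L := L) (k := k) Q) relax
      (RelaxInv n L k s Q c p) fun z => ∑ v ∈ Finset.range n, ∑ A ∈ Finset.range (2 ^ k),
        ∑ B ∈ Finset.range (2 ^ k), ∑ t ∈ Finset.range (L + 2), ∑ u ∈ Finset.range n,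
        ∑ a ∈ Finset.range k, ∑ b ∈ Finset.range k,
        if z.1.1 = p + 1 ∧ z.1.2.2.1 = v ∧ z.1.2.2.2.1 = A ∧ z.1.2.2.2.2 = B ∧
          c ((t * n + u) * n + v) = z.1.2.1 then
          coef _ v a A * coef _ v b B * table _ k n (L + 2) s
            (fun t u v => c ((t * n + u) * n + v)) p t u (A - 2 ^ a) (B - 2 ^ b) else 0 := by
    refine Adds.loop 5 0 (fun _ _ => rfl) (fun st i h => h.setVar i (by decide) (by decide))
      fun v hv => ?_
    refine Adds.loop 6 5 (fun _ _ => rfl) ?_ fun A hA => ?_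
    · rintro st i ⟨h, h5⟩; exact ⟨h.setVar i (by decide) (by decide), by simpa⟩
    refine Adds.loop 7 5 (fun _ _ => rfl) ?_ fun B hB => ?_
    · rintro st i ⟨⟨h, h5⟩, h6⟩; exact ⟨⟨h.setVar i (by decide) (by decide), by simpa⟩, by simpa⟩
    refine Adds.loop 3 6 (fun _ _ => rfl) ?_ fun t ht => ?_
    · rintro st i ⟨⟨⟨h, h5⟩, h6⟩, h7⟩
      exact ⟨⟨⟨h.setVar i (by decide) (by decide), by simpa⟩, by simpa⟩, by simpa⟩
    refine Adds.loop 4 0 (fun _ _ => rfl) ?_ fun u hu => ?_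
    · rintro st i ⟨⟨⟨⟨h, h5⟩, h6⟩, h7⟩, h3⟩
      exact ⟨⟨⟨⟨h.setVar i (by decide) (by decide), by simpa⟩, by simpa⟩, by simpa⟩, by simpa⟩
    refine Adds.loop 8 4 (fun _ _ => rfl) ?_ fun a ha => ?_
    · rintro st i ⟨⟨⟨⟨⟨h, h5⟩, h6⟩, h7⟩, h3⟩, h4⟩
      exact ⟨⟨⟨⟨⟨h.setVar i (by decide) (by decide), by simpa⟩, by simpa⟩, by simpa⟩, by simpa⟩,
        by simpa⟩
    refine Adds.loop 9 4 (fun _ _ => rfl) ?_ fun b hb => ?_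
    · rintro st i ⟨⟨⟨⟨⟨⟨h, h5⟩, h6⟩, h7⟩, h3⟩, h4⟩, h8⟩
      exact ⟨⟨⟨⟨⟨⟨h.setVar i (by decide) (by decide), by simpa⟩, by simpa⟩, by simpa⟩, by simpa⟩,
        by simpa⟩, by simpa⟩
    exact adds_relaxBody hc ht hu hv hA hB ha hb
  intro st hst
  refine ⟨(H st hst).1, fun z => ((H st hst).2 z).trans ?_⟩
  congr 1
  obtain ⟨⟨p', t', v', A', B'⟩, hp', ht', hv', hA', hB'⟩ := z
  simp only at hp' ht' hv' hA' hB'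
  dsimp only
  -- For a given entry, the loops over `v`, `A` and `B` contribute only at its own indices; what
  -- remains is the defining recursion.
  by_cases hpp : p' = p + 1
  · subst hpp
    rw [if_pos rfl, table, Finset.sum_eq_single_of_mem v' (Finset.mem_range.2 hv'),
      Finset.sum_eq_single_of_mem A' (Finset.mem_range.2 hA'),
      Finset.sum_eq_single_of_mem B' (Finset.mem_range.2 hB')]
    · simp only [true_and]
    · intro B _ hB
      simp [Ne.symm hB]
    · intro A _ hA
      simp [Ne.symm hA]
    · intro v _ hv
      simp [Ne.symm hv]
  · simp [hpp]

/-- The array holds the table modulo `Q + 1`. -/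
def TableFull (n L k s Q : ℕ) (R : ℕ → ℕ → ℕ → ℕ) (c : ℕ → ℕ) : Prop :=
  ∀ p ≤ k, ∀ t < L + 2, ∀ v < n, ∀ A < 2 ^ k, ∀ B < 2 ^ k,
    (c (tableAt n L k p t v A B) : ZMod (Q + 1)) = table _ k n (L + 2) s R p t v A B

theorem tables_run {st : St} {Q : ℕ} {c : ℕ → ℕ} (hs : s < n) (hQ : st.var 1 = Q)
    (h1 : st.arr 1 = c) (h2 : ∀ a < k, st.arr 2 a = 2 ^ a)
    (hc : ∀ t < L + 2, ∀ u < n, ∀ v < n, c ((t * n + u) * n + v) < L + 2) :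
    CoefTable n k Q ((tables.run (params n L k s) st).arr 3) ∧
      TableFull n L k s Q (fun t u v => c ((t * n + u) * n + v))
        ((tables.run (params n L k s) st).arr 4) := by
  set s₁ := coefs.run (params n L k s) st with hs₁
  set s₂ := initTables.run (params n L k s) s₁ with hs₂
  have c1 : CoefTable n k Q (s₁.arr 3) := coefs_run hQ
  have v2 : s₂.var 1 = Q := by
    rw [hs₂, run_var_of_notMem _ (by decide), hs₁, run_var_of_notMem _ (by decide), hQ]
  have a1 : s₂.arr 1 = c := by
    rw [hs₂, run_arr_of_notMem _ (by decide), hs₁, run_arr_of_notMem _ (by decide), h1]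
  have a2 : s₂.arr 2 = st.arr 2 := by
    rw [hs₂, run_arr_of_notMem _ (by decide), hs₁, run_arr_of_notMem _ (by decide)]
  have a3 : s₂.arr 3 = s₁.arr 3 := by rw [hs₂, run_arr_of_notMem _ (by decide)]
  have := run_loop_params (n := n) (L := L) (k := k) (s := s) (x := 2) (p := 4) (st := s₂)
    (c := relax) (m := k)
    (fun m s' => s'.var 1 = Q ∧ s'.arr 1 = c ∧ (∀ a < k, s'.arr 2 a = 2 ^ a) ∧
      CoefTable n k Q (s'.arr 3) ∧
      TableUpTo n L k s Q (fun t u v => c ((t * n + u) * n + v)) m (s'.arr 4)) rfl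
    ⟨v2, a1, by rw [a2]; exact h2, by rw [a3]; exact c1, initTables_run s₁ hs⟩ ?_
  · refine ⟨this.2.2.2.1, fun p hp t ht v hv A hA B hB => ?_⟩
    exact (this.2.2.2.2 p hp t ht v hv A hA B hB).trans (if_pos hp)
  · rintro p hp s' ⟨g1, g2, g3, g4, g5⟩
    have hI : RelaxInv n L k s Q c p (s'.setVar 2 p) :=
      ⟨by simpa, by simp, g2, g3, g4, fun t ht v hv A hA B hB =>
        (g5 p hp.le t ht v hv A hA B hB).trans (if_pos le_rfl)⟩
    obtain ⟨hI', hv⟩ := adds_relax hc _ hI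
    refine ⟨hI'.modulus, hI'.arrival, hI'.pow, hI'.coef, ?_⟩
    intro p' hp' t ht v hv' A hA B hB
    refine (hv ⟨(p', t, v, A, B), hp', ht, hv', hA, hB⟩).trans ?_
    have := g5 p' hp' t ht v hv' A hA B hB
    simp only [entryVal, setVar_arr]
    rw [this]
    split_ifs <;> first | omega | simp

end Verification

end TExp

/-! ### Verification: the optimal arrival time -/

namespace TExp
open ForProg ForProg.Expr ForProg.Cmd

section Verification

variable {n L k s : ℕ}

/-- The entry of the table that is a sum of squares of determinants. -/
def topEntry (S : Type*) [CommRing S] (n L k s : ℕ) (R : ℕ → ℕ → ℕ → ℕ) (t v : ℕ) : S :=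
  table S k n (L + 2) s R k t v (2 ^ k - 1) (2 ^ k - 1)

/-- The time `t`, the vertex `v` and the modulus `Q + 1` prove that one can visit `k` vertices, the last of
them `v`, in time `t`. -/
def Witness (n L k s : ℕ) (R : ℕ → ℕ → ℕ → ℕ) (t v Q : ℕ) : Prop :=
  t ≤ L + 1 ∧ (t ≤ L → v < n ∧ topEntry (ZMod (Q + 1)) n L k s R t v ≠ 0)

theorem mod_pos_iff (x Q : ℕ) : 0 < x % (Q + 1) ↔ (x : ZMod (Q + 1)) ≠ 0 := by
  rw [Ne, ZMod.natCast_eq_zero_iff, Nat.dvd_iff_mod_eq_zero, Nat.pos_iff_ne_zero]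

/-- An entry can be nonzero modulo `Q + 1` only at times that the search takes into account: either
it is not below the current best, or it becomes the new best, stored together with its vertex and
modulus. -/
theorem search_run {st : St} {Q : ℕ} {R : ℕ → ℕ → ℕ → ℕ} (hQ : st.var 1 = Q)
    (hT : TableFull n L k s Q R (st.arr 4))
    (hw : Witness n L k s R (st.var 12) (st.var 13) (st.var 14)) :
    let st' := search.run (params n L k s) st
    Witness n L k s R (st'.var 12) (st'.var 13) (st'.var 14) ∧ st'.var 12 ≤ st.var 12 ∧
      ∀ t < L + 2, ∀ v < n, topEntry (ZMod (Q + 1)) n L k s R t v ≠ 0 → st'.var 12 ≤ t := by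
  intro st'
  have := run_loop_params (n := n) (L := L) (k := k) (s := s) (x := 10) (p := 13) (st := st)
    (c := (seq (assign 3 (var 10 / par 0)) (seq (assign 5 (var 10 % par 0))
    (seq (assign 24 (sel (var 3) (var 12)
      (modSucc (load 4 (tableIx (par 4) (var 3) (var 5) (par 5 - 1) (par 5 - 1))) (var 1)) 0))
    (seq (assign 13 (sel 0 (var 24) (var 5) (var 13))) (seq (assign 14 (sel 0 (var 24) (var 1) (var 14)))
      (assign 12 (sel 0 (var 24) (var 3) (var 12)))))))))
    (fun m s' => s'.var 1 = Q ∧ s'.arr = st.arr ∧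
      Witness n L k s R (s'.var 12) (s'.var 13) (s'.var 14) ∧ s'.var 12 ≤ st.var 12 ∧
      ∀ z < m, topEntry (ZMod (Q + 1)) n L k s R (z / n) (z % n) ≠ 0 → s'.var 12 ≤ z / n) rfl
    ⟨hQ, rfl, hw, le_rfl, by simp⟩ ?_
  · refine ⟨this.2.2.1, this.2.2.2.1, fun t ht v hv h => ?_⟩
    have h' := this.2.2.2.2 (t * n + v) (flat_lt ht hv)
    rw [flat_div hv, flat_mod hv] at h'
    exact h' h
  · rintro z hz s' ⟨h1, h2, h3, h4, h5⟩
    have hz' : z < (L + 2) * n := hz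
    have hn : 0 < n := Nat.pos_of_ne_zero (by rintro rfl; simp at hz')
    have ht : z / n < L + 2 := Nat.div_lt_of_lt_mul (by rwa [mul_comm])
    have hv : z % n < n := Nat.mod_lt _ hn
    have hK : 2 ^ k - 1 < 2 ^ k := Nat.sub_lt (by positivity) one_pos
    have hF := hT k le_rfl _ ht _ hv _ hK _ hK
    have hF' : 0 < st.arr 4 (tableAt n L k k (z / n) (z % n) (2 ^ k - 1) (2 ^ k - 1)) % (Q + 1) ↔
        topEntry (ZMod (Q + 1)) n L k s R (z / n) (z % n) ≠ 0 := by
      rw [mod_pos_iff, hF]; rfl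
    simp only [run_seq, run_assign, eval_sel, eval_var, eval_ofNat, eval_div, eval_mod, eval_par,
      eval_modSucc, eval_load_of_ne, ne_eq, OfNat.ofNat_ne_zero, not_false_eq_true, tableIx,
      eval_add, eval_mul, eval_sub, setVar_var, setVar_arr, Nat.reduceEqDiff, if_true, if_false,
      OfNat.one_ne_ofNat, h1, h2, params_zero, params_four, params_five, params_six, true_and]
    rw [show ((((k * (L + 2) + z / n) * n + z % n) * 2 ^ k + (2 ^ k - 1)) * 2 ^ k + (2 ^ k - 1)) =
      tableAt n L k k (z / n) (z % n) (2 ^ k - 1) (2 ^ k - 1) from rfl]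
    have h5' : ∀ y < z + 1, topEntry (ZMod (Q + 1)) n L k s R (y / n) (y % n) ≠ 0 →
        y = z ∨ s'.var 12 ≤ y / n := fun y hy h => by
      by_cases hyz : y = z
      · exact .inl hyz
      · exact .inr (h5 y (by omega) h)
    by_cases hlt : z / n < s'.var 12
    · simp only [hlt, if_true]
      by_cases hpos : 0 < st.arr 4 (tableAt n L k k (z / n) (z % n) (2 ^ k - 1) (2 ^ k - 1)) % (Q + 1)
      · simp only [hpos, if_true]
        refine ⟨⟨by omega, fun _ => ⟨hv, hF'.1 hpos⟩⟩, by omega, fun y hy h => ?_⟩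
        rcases h5' y hy h with rfl | h
        · rfl
        · omega
      · simp only [hpos, if_false]
        refine ⟨h3, h4, fun y hy h => ?_⟩
        rcases h5' y hy h with rfl | h'
        · exact absurd (hF'.2 h) hpos
        · exact h'
    · simp only [hlt, if_false, lt_irrefl]
      refine ⟨h3, h4, fun y hy h => ?_⟩
      rcases h5' y hy h with rfl | h'
      · omega
      · exact h'

theorem optimum_run {st : St} {c : ℕ → ℕ} (hs : s < n) (h1 : st.arr 1 = c)
    (h2 : ∀ a < k, st.arr 2 a = 2 ^ a)
    (hc : ∀ t < L + 2, ∀ u < n, ∀ v < n, c ((t * n + u) * n + v) < L + 2) :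
    let R := fun t u v => c ((t * n + u) * n + v)
    let st' := optimum.run (params n L k s) st
    Witness n L k s R (st'.var 12) (st'.var 13) (st'.var 14) ∧
      ∀ j < (2 * k + 4) * k + 2, ∀ t < L + 2, ∀ v < n,
        topEntry (ZMod (((2 * k + 4) * k + 2) * ((k + 1) * n * (L + 2)) + j + 1)) n L k s R t v ≠ 0 →
          st'.var 12 ≤ t := by
  intro R st'
  have := run_loop_params (n := n) (L := L) (k := k) (s := s) (x := 21) (p := 7)
    (st := (assign 12 (par 3 + 1)).run (params n L k s) st)
    (c := (seq (assign 1 (par 7 * (par 8 * par 0 * par 6) + var 21)) (seq tables search)))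
    (m := (2 * k + 4) * k + 2)
    (fun m s' => s'.arr 1 = c ∧ (∀ a < k, s'.arr 2 a = 2 ^ a) ∧
      Witness n L k s R (s'.var 12) (s'.var 13) (s'.var 14) ∧
      ∀ j < m, ∀ t < L + 2, ∀ v < n,
        topEntry (ZMod (((2 * k + 4) * k + 2) * ((k + 1) * n * (L + 2)) + j + 1)) n L k s R t v ≠ 0 →
          s'.var 12 ≤ t) rfl
    -- The initial best time `L + 1` is a witness vacuously.
    ⟨h1, h2, ⟨by simp, fun h => by simp at h⟩, by simp⟩ ?_
  · exact this.2.2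
  · rintro j hj s' ⟨g1, g2, g3, g4⟩
    set Q := ((2 * k + 4) * k + 2) * ((k + 1) * n * (L + 2)) + j with hQ
    rw [run_seq, run_seq]
    set s₁ := (assign 1 (par 7 * (par 8 * par 0 * par 6) + var 21)).run (params n L k s)
      (s'.setVar 21 j) with hs₁
    have v1 : s₁.var 1 = Q := by simp [hs₁, hQ]
    have v12 : s₁.var 12 = s'.var 12 := by simp [hs₁]
    have v13 : s₁.var 13 = s'.var 13 := by simp [hs₁]
    have v14 : s₁.var 14 = s'.var 14 := by simp [hs₁]
    have hT := (tables_run (L := L) (s := s) (st := s₁) hs v1 g1 g2 hc).2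
    set s₂ := tables.run (params n L k s) s₁ with hs₂
    have f : ∀ y, y ∉ tables.vars → s₂.var y = s₁.var y := fun y hy => run_var_of_notMem _ hy
    have w1 : s₂.var 1 = Q := by rw [f 1 (by decide), v1]
    have w12 : s₂.var 12 = s'.var 12 := by rw [f 12 (by decide), v12]
    obtain ⟨r1, r2, r3⟩ := search_run w1 hT
      (by rw [w12, f 13 (by decide), f 14 (by decide), v13, v14]; exact g3)
    refine ⟨?_, ?_, r1, fun i hi t ht v hv h => ?_⟩
    · rw [run_arr_of_notMem _ (by decide), hs₂, run_arr_of_notMem _ (by decide)]; exact g1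
    · rw [run_arr_of_notMem _ (by decide), hs₂, run_arr_of_notMem _ (by decide)]; exact g2
    · by_cases hij : i = j
      · subst hij; exact r3 t ht v hv h
      · exact (r2.trans w12.le).trans (g4 i (by omega) t ht v hv h)

/-- If `k` vertices can be visited in time `t`, then this can be seen modulo one of the moduli. -/
theorem le_place {R : ℕ → ℕ → ℕ → ℕ} {best : ℕ} (hs : s < n)
    (hR : ∀ t < L + 2, ∀ u < n, ∀ v < n, R t u v < L + 2)
    (h : ∀ j < (2 * k + 4) * k + 2, ∀ t < L + 2, ∀ v < n,
        topEntry (ZMod (((2 * k + 4) * k + 2) * ((k + 1) * n * (L + 2)) + j + 1)) n L k s R t v ≠ 0 →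
          best ≤ t)
    {l : List ℕ} (hl : l.Nodup) (hk : l.length = k) (hn : ∀ x ∈ l, x < n) :
    best ≤ (place R s l).1 := by
  obtain ⟨p1, p2⟩ := place_lt (by omega) hs hR l hn
  set t := (place R s l).1 with ht
  set v := (place R s l).2 with hv
  set X := (k + 1) * n * (L + 2) with hX
  have hXn : 1 ≤ X := Nat.mul_pos (Nat.mul_pos (by omega) (by omega)) (by omega)
  -- Over the integers all summands are squares or 0, and the one of `l` is positive.
  have hpos : 0 < topEntry ℤ n L k s R t v := by
    rw [topEntry, table_eq_sumSeq (by omega) hs hR _ _ _ _ _ p2]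
    refine lt_of_lt_of_le ?_ (le_sumSeq (fun l' => ?_) l hk hn)
    · rw [if_pos rfl]
      exact mul_self_pos.2 (minor_ne_zero hk hl)
    · split_ifs
      · exact mul_self_nonneg _
      · exact le_rfl
  -- `X` dominates each of `L + 2`, `n` and `k`, so one level contributes at most `X ^ (2 k + 4)`.
  have hle : topEntry ℤ n L k s R t v ≤ (X : ℤ) ^ ((2 * k + 4) * k) := by
    refine (le_abs_self _).trans ((abs_table_le _ _ _ _ _ p2).trans ?_)
    rw [pow_mul]
    refine pow_le_pow_left₀ (by positivity) ?_ k
    have h1 : L + 2 ≤ X := Nat.le_mul_of_pos_left _ (Nat.mul_pos (by omega) (by omega))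
    have h2 : n ≤ X := (Nat.le_mul_of_pos_left _ (by omega)).trans
      (Nat.le_mul_of_pos_right _ (by omega))
    have h3 : k ≤ X := (by omega : k ≤ k + 1).trans ((Nat.le_mul_of_pos_right _ (by omega)).trans
      (Nat.le_mul_of_pos_right _ (by omega)))
    have : (L + 2) * n * (k * k) * (n ^ k * n ^ k) ≤ X * X * (X * X) * (X ^ k * X ^ k) := by
      gcongr
    have e : X * X * (X * X) * (X ^ k * X ^ k) = X ^ (2 * k + 4) := by ring
    rw [e] at this
    exact_mod_cast this
  obtain ⟨j, hj, hd⟩ := exists_not_dvd hpos hXn hle (m := (2 * k + 4) * k + 2) (by omega)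
  refine h j hj t p1 v p2 fun h0 => hd ?_
  rw [add_right_comm, ← ZMod.intCast_zmod_eq_zero_iff_dvd]
  refine Eq.trans ?_ h0
  have := map_table (k := k) (n := n) (Θ := L + 2) (s := s) (R := R)
    (Int.castRingHom (ZMod (((2 * k + 4) * k + 2) * X + j + 1))) k t v (2 ^ k - 1) (2 ^ k - 1)
  rwa [eq_intCast] at this

end Verification

end TExp

/-! ### Backtracking by contracting linear functionals -/

namespace TExp
open ForProg ForProg.Expr ForProg.Cmd

section Functionals

variable {S : Type*} [CommRing S] {n L k s : ℕ}

/-- Evaluation of the linear functional with matrix `γ`. -/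
def pairing (k : ℕ) (γ H : ℕ → ℕ → S) : S :=
  ∑ A ∈ Finset.range (2 ^ k), ∑ B ∈ Finset.range (2 ^ k), γ A B * H A B

/-- The linear functional after expanding along the columns of `v`. -/
def contracted (k v : ℕ) (γ : ℕ → ℕ → S) (A' B' : ℕ) : S :=
  ∑ A ∈ Finset.range (2 ^ k), ∑ B ∈ Finset.range (2 ^ k), ∑ a ∈ Finset.range k,
    ∑ b ∈ Finset.range k, if A' = A - 2 ^ a ∧ B' = B - 2 ^ b then
      coef S v a A * coef S v b B * γ A B else 0

theorem sum_sum_comm (s₁ s₂ s₃ s₄ : Finset ℕ) (f : ℕ → ℕ → ℕ → ℕ → S) :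
    ∑ a ∈ s₁, ∑ b ∈ s₂, ∑ c ∈ s₃, ∑ d ∈ s₄, f a b c d =
      ∑ c ∈ s₃, ∑ d ∈ s₄, ∑ a ∈ s₁, ∑ b ∈ s₂, f a b c d := by
  have h := Finset.sum_comm (s := s₁ ×ˢ s₂) (t := s₃ ×ˢ s₄) (f := fun x y => f x.1 x.2 y.1 y.2)
  simpa only [Finset.sum_product] using h

/-- Contraction is the transpose of expanding both factors along the column of `v`. -/
theorem pairing_contracted (v : ℕ) (γ H : ℕ → ℕ → S) : pairing k (contracted k v γ) H =
    pairing k γ fun A B => ∑ a ∈ Finset.range k, ∑ b ∈ Finset.range k,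
      coef S v a A * coef S v b B * H (A - 2 ^ a) (B - 2 ^ b) := by
  have e : pairing k (contracted k v γ) H = ∑ A' ∈ Finset.range (2 ^ k),
      ∑ B' ∈ Finset.range (2 ^ k), ∑ A ∈ Finset.range (2 ^ k), ∑ B ∈ Finset.range (2 ^ k),
      ∑ a ∈ Finset.range k, ∑ b ∈ Finset.range k, if A' = A - 2 ^ a ∧ B' = B - 2 ^ b then
      coef S v a A * coef S v b B * γ A B * H A' B' else 0 := by
    simp only [pairing, contracted, Finset.sum_mul, ite_mul, zero_mul]
  rw [e, sum_sum_comm, pairing]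
  refine Finset.sum_congr rfl fun A hA => Finset.sum_congr rfl fun B hB => ?_
  rw [sum_sum_comm]
  simp only [Finset.mul_sum]
  refine Finset.sum_congr rfl fun a _ => Finset.sum_congr rfl fun b _ => ?_
  rw [Finset.sum_eq_single_of_mem (A - 2 ^ a), Finset.sum_eq_single_of_mem (B - 2 ^ b)]
  · rw [if_pos ⟨rfl, rfl⟩]; ring
  · exact Finset.mem_range.2 ((Nat.sub_le _ _).trans_lt (Finset.mem_range.1 hB))
  · intro B' _ h; rw [if_neg fun h' => h h'.2]
  · exact Finset.mem_range.2 ((Nat.sub_le _ _).trans_lt (Finset.mem_range.1 hA))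
  · intro A' _ h; exact Finset.sum_eq_zero fun B' _ => by rw [if_neg fun h' => h h'.1]

theorem pairing_minor (v : ℕ) (l : List ℕ) (γ : ℕ → ℕ → S) :
    pairing k (contracted k v γ) (fun A B => minor S k l A * minor S k l B) =
      pairing k γ fun A B => minor S k (v :: l) A * minor S k (v :: l) B := by
  rw [pairing_contracted]
  congr 1
  funext A B
  simp only [minor, Finset.sum_mul_sum]
  exact Finset.sum_congr rfl fun a _ => Finset.sum_congr rfl fun b _ => by ring

/-- The value of the functional splits into one contribution for each predecessor; the contracted
functional reads this contribution off the level below. -/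
theorem pairing_table {R : ℕ → ℕ → ℕ → ℕ} {Θ : ℕ} (p t v : ℕ) (γ : ℕ → ℕ → S) :
    pairing k γ (table S k n Θ s R (p + 1) t v) = ∑ t₀ ∈ Finset.range Θ, ∑ u ∈ Finset.range n,
      if R t₀ u v = t then pairing k (contracted k v γ) (table S k n Θ s R p t₀ u) else 0 := by
  simp only [pairing_contracted]
  rw [pairing]
  simp only [table, Finset.mul_sum]
  rw [sum_sum_comm]
  refine Finset.sum_congr rfl fun t₀ _ => Finset.sum_congr rfl fun u _ => ?_
  split_ifs
  · simp only [pairing, Finset.mul_sum]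
  · simp

/-- Level 0 is supported at time 0 in `s`, where it is the product of the empty minors; so
backtracking ends at the start. -/
theorem pairing_ne_zero_of_table_zero {R : ℕ → ℕ → ℕ → ℕ} {Θ t v : ℕ} {γ : ℕ → ℕ → S}
    (h : pairing k γ (table S k n Θ s R 0 t v) ≠ 0) : t = 0 ∧ v = s ∧
      pairing k γ (fun A B => minor S k [] A * minor S k [] B) ≠ 0 := by
  by_cases htv : t = 0 ∧ v = s
  · obtain ⟨rfl, rfl⟩ := htv
    refine ⟨rfl, rfl, fun h' => h (h'.symm ▸ ?_)⟩
    congr 1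
    funext A B
    simp only [table, minor, true_and]
    by_cases hA : A = 0 <;> by_cases hB : B = 0 <;> simp [hA, hB]
  · refine absurd ?_ h
    have : table S k n Θ s R 0 t v = fun _ _ => 0 := by
      funext A B
      simp only [table]
      rw [if_neg fun h => htv ⟨h.1, h.2.1⟩]
    simp [pairing, this]

end Functionals

section Verification

variable {n L k s : ℕ}

/-- The position of an entry of the functional. -/
def functionalAt (k j A B : ℕ) : ℕ := (j * 2 ^ k + A) * 2 ^ k + B

theorem functionalAt_inj {j A B j' A' B' : ℕ} (hA : A < 2 ^ k) (hB : B < 2 ^ k) (hA' : A' < 2 ^ k)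
    (hB' : B' < 2 ^ k) :
    functionalAt k j A B = functionalAt k j' A' B' ↔ (j = j' ∧ A = A') ∧ B = B' := by
  unfold functionalAt
  rw [flat_inj hB hB', flat_inj hA hA']

/-- Level `j` of the functional, modulo `Q + 1`. -/
def functional (k Q : ℕ) (st : St) (j A B : ℕ) : ZMod (Q + 1) := st.arr 5 (functionalAt k j A B)

/-- What the program relies on when it computes level `j + 1` of the functional. -/
structure ContractInv (n k Q j v : ℕ) (γ : ℕ → ℕ → ZMod (Q + 1)) (st : St) : Prop where
  modulus : st.var 1 = Q
  level : st.var 2 = j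
  vertex : st.var 16 = v
  pow : ∀ a < k, st.arr 2 a = 2 ^ a
  coef : CoefTable n k Q (st.arr 3)
  prev : ∀ A < 2 ^ k, ∀ B < 2 ^ k, functional k Q st j A B = γ A B

theorem ContractInv.setVar {Q j v : ℕ} {γ : ℕ → ℕ → ZMod (Q + 1)} {st : St}
    (h : ContractInv n k Q j v γ st) {x : ℕ} (i : ℕ) (h1 : x ≠ 1) (h2 : x ≠ 2) (h16 : x ≠ 16) :
    ContractInv n k Q j v γ (st.setVar x i) where
  modulus := by rw [setVar_var, if_neg h1.symm, h.modulus]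
  level := by rw [setVar_var, if_neg h2.symm, h.level]
  vertex := by rw [setVar_var, if_neg h16.symm, h.vertex]
  pow := h.pow
  coef := h.coef
  prev := h.prev

/-- The indices of the entries of the functional. -/
def FEntry (k : ℕ) : Type := {z : ℕ × ℕ × ℕ // z.2.1 < 2 ^ k ∧ z.2.2 < 2 ^ k}

theorem adds_contract {Q j v : ℕ} {γ : ℕ → ℕ → ZMod (Q + 1)} (hv : v < n) :
    Adds (params n L k s)
      (fun st (z : FEntry k) => functional k Q st z.1.1 z.1.2.1 z.1.2.2) contract
      (ContractInv n k Q j v γ)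
      (fun z => ∑ A ∈ Finset.range (2 ^ k), ∑ B ∈ Finset.range (2 ^ k), ∑ a ∈ Finset.range k,
        ∑ b ∈ Finset.range k, if z.1.1 = j + 1 ∧ z.1.2.1 = A - 2 ^ a ∧ z.1.2.2 = B - 2 ^ b then
          coef _ v a A * coef _ v b B * γ A B else 0) := by
  refine Adds.loop 6 5 (fun _ _ => rfl)
    (fun st i h => h.setVar i (by decide) (by decide) (by decide)) fun A hA => ?_
  refine Adds.loop 7 5 (fun _ _ => rfl) ?_ fun B hB => ?_
  · rintro st i ⟨h, h6⟩; exact ⟨h.setVar i (by decide) (by decide) (by decide), by simpa⟩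
  refine Adds.loop 8 4 (fun _ _ => rfl) ?_ fun a ha => ?_
  · rintro st i ⟨⟨h, h6⟩, h7⟩
    exact ⟨⟨h.setVar i (by decide) (by decide) (by decide), by simpa⟩, by simpa⟩
  refine Adds.loop 9 4 (fun _ _ => rfl) ?_ fun b hb => ?_
  · rintro st i ⟨⟨⟨h, h6⟩, h7⟩, h8⟩
    exact ⟨⟨⟨h.setVar i (by decide) (by decide) (by decide), by simpa⟩, by simpa⟩, by simpa⟩
  rintro st ⟨⟨⟨⟨hI, h6⟩, h7⟩, h8⟩, h9⟩
  have hA : A < 2 ^ k := hA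
  have hB : B < 2 ^ k := hB
  have hAa : A - 2 ^ a < 2 ^ k := (Nat.sub_le _ _).trans_lt hA
  have hBb : B - 2 ^ b < 2 ^ k := (Nat.sub_le _ _).trans_lt hB
  set X := st.arr 5 (functionalAt k (j + 1) (A - 2 ^ a) (B - 2 ^ b)) +
    st.arr 3 ((v * k + a) * 2 ^ k + A) * st.arr 3 ((v * k + b) * 2 ^ k + B) *
      st.arr 5 (functionalAt k j A B) with hX
  have hrun : contractBody.run (params n L k s) st =
      st.setArr 5 (functionalAt k (j + 1) (A - 2 ^ a) (B - 2 ^ b)) (X % (Q + 1)) := by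
    simp only [contractBody, run_store_of_ne, ne_eq, OfNat.ofNat_ne_zero,
      not_false_eq_true, eval_var, eval_ofNat, eval_modSucc, eval_mul, eval_load_of_ne, eval_sub,
      eval_par, eval_add, functionalIx, coefIx, hI.modulus, hI.level, hI.vertex, h6, h7, h8, h9,
      params_four, params_five, hI.pow a ha, hI.pow b hb, hX, functionalAt]
  have hne : ∀ (j' A' B' : ℕ), A' < 2 ^ k → B' < 2 ^ k →
      (st.setArr 5 (functionalAt k (j + 1) (A - 2 ^ a) (B - 2 ^ b)) (X % (Q + 1))).arr 5
        (functionalAt k j' A' B') = if (j' = j + 1 ∧ A' = A - 2 ^ a) ∧ B' = B - 2 ^ b then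
          X % (Q + 1) else st.arr 5 (functionalAt k j' A' B') := by
    intro j' A' B' h1 h2
    rw [setArr_arr, if_pos rfl]
    simp only [functionalAt_inj h1 h2 hAa hBb]
  rw [hrun]
  refine ⟨⟨⟨⟨⟨⟨hI.modulus, hI.level, hI.vertex, ?_, ?_, ?_⟩, h6⟩, h7⟩, h8⟩, h9⟩, ?_⟩
  · rw [setArr_arr_ne _ _ _ _ _ (by decide)]; exact hI.pow
  · rw [setArr_arr_ne _ _ _ _ _ (by decide)]; exact hI.coef
  · intro A' hA' B' hB'
    rw [functional, hne j A' B' hA' hB', if_neg (by omega)]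
    exact hI.prev A' hA' B' hB'
  · rintro ⟨⟨j', A', B'⟩, hA', hB'⟩
    simp only at hA' hB'
    simp only [functional]
    rw [hne j' A' B' hA' hB']
    by_cases h : j' = j + 1 ∧ A' = A - 2 ^ a ∧ B' = B - 2 ^ b
    · obtain ⟨rfl, rfl, rfl⟩ := h
      simp only [and_self, if_true]
      have hp := hI.prev A hA B hB
      rw [functional] at hp
      rw [ZMod.natCast_mod, hX]
      push_cast
      rw [hI.coef v hv a ha A hA, hI.coef v hv b hb B hB, hp]
    · rw [if_neg h, if_neg, add_zero]
      tauto

theorem contract_run {Q j v : ℕ} {γ : ℕ → ℕ → ZMod (Q + 1)} {st : St} (hv : v < n)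
    (hI : ContractInv n k Q j v γ st) {j' A B : ℕ} (hA : A < 2 ^ k) (hB : B < 2 ^ k) :
    functional k Q (contract.run (params n L k s) st) j' A B =
      functional k Q st j' A B + if j' = j + 1 then contracted k v γ A B else 0 := by
  refine ((adds_contract hv st hI).2 ⟨(j', A, B), hA, hB⟩).trans ?_
  dsimp only
  congr 1
  by_cases h : j' = j + 1
  · simp only [h, true_and, if_true, contracted]
  · simp [h]

theorem evaluate_run {Q j t u : ℕ} {st : St} {R : ℕ → ℕ → ℕ → ℕ} (h1 : st.var 1 = Q)
    (h2 : st.var 2 = j) (h3 : st.var 3 = t) (h4 : st.var 4 = u) (ht : t < L + 2) (hu : u < n)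
    (hT : TableFull n L k s Q R (st.arr 4)) :
    ((evaluate.run (params n L k s) st).var 19 : ZMod (Q + 1)) =
      pairing k (functional k Q st (j + 1)) (table _ k n (L + 2) s R (k - 1 - j) t u) := by
  have H : Adds (params n L k s) (fun st (_ : Unit) => (st.var 19 : ZMod (Q + 1)))
      (loop 6 5 (loop 7 5 (assign 19 (modSucc (var 19 +
        load 5 (functionalIx (var 2 + 1) (var 6) (var 7)) *
          load 4 (tableIx (par 4 - 1 - var 2) (var 3) (var 4) (var 6) (var 7))) (var 1)))))
      (fun s' => s'.arr = st.arr ∧ s'.var 1 = Q ∧ s'.var 2 = j ∧ s'.var 3 = t ∧ s'.var 4 = u)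
      (fun _ => ∑ A ∈ Finset.range (2 ^ k), ∑ B ∈ Finset.range (2 ^ k),
        functional k Q st (j + 1) A B * table _ k n (L + 2) s R (k - 1 - j) t u A B) := by
    refine Adds.loop 6 5 (fun _ _ => by simp) ?_ fun A hA => ?_
    · rintro s' i ⟨e0, e1, e2, e3, e4⟩; exact ⟨e0, by simpa, by simpa, by simpa, by simpa⟩
    refine Adds.loop 7 5 (fun _ _ => by simp) ?_ fun B hB => ?_
    · rintro s' i ⟨⟨e0, e1, e2, e3, e4⟩, e6⟩
      exact ⟨⟨e0, by simpa, by simpa, by simpa, by simpa⟩, by simpa⟩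
    rintro s' ⟨⟨⟨e0, e1, e2, e3, e4⟩, e6⟩, e7⟩
    refine ⟨⟨⟨⟨e0, by simpa, by simpa, by simpa, by simpa⟩, by simpa⟩, by simpa⟩, fun _ => ?_⟩
    have := hT (k - 1 - j) (by omega) t ht u hu A hA B hB
    simp only [run_assign, setVar_var, if_true, eval_modSucc, eval_add, eval_mul, eval_var,
      eval_load_of_ne, ne_eq, OfNat.ofNat_ne_zero, not_false_eq_true, functionalIx, tableIx, eval_sub,
      eval_par, eval_ofNat, e0, e1, e2, e3, e4, e6, e7, params_four, params_five, params_six,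
      params_zero, ZMod.natCast_mod]
    rw [Nat.cast_add, Nat.cast_mul, ← this]
    rfl
  have := (H ((assign 19 0).run (params n L k s) st)
    ⟨rfl, by simpa, by simpa, by simpa, by simpa⟩).2 ()
  refine this.trans ?_
  simp [pairing]

/-- The hypothesis `hex` excludes that the scan finds nothing; the invariant says that either no
pair so far is a hit or the stored pair is one. -/
theorem predecessor_run {Q j t v : ℕ} {st : St} {c : ℕ → ℕ}
    (h1 : st.var 1 = Q) (h2 : st.var 2 = j) (h15 : st.var 15 = t) (h16 : st.var 16 = v)
    (ha : st.arr 1 = c)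
    (hT : TableFull n L k s Q (fun t u v => c ((t * n + u) * n + v)) (st.arr 4))
    (hex : ∃ t₀ < L + 2, ∃ u < n, c ((t₀ * n + u) * n + v) = t ∧
      pairing k (functional k Q st (j + 1)) (table _ k n (L + 2) s
        (fun t u v => c ((t * n + u) * n + v)) (k - 1 - j) t₀ u) ≠ 0) :
    let st' := predecessor.run (params n L k s) st
    st'.var 17 < L + 2 ∧ st'.var 18 < n ∧ c ((st'.var 17 * n + st'.var 18) * n + v) = t ∧
      pairing k (functional k Q st (j + 1)) (table _ k n (L + 2) s
        (fun t u v => c ((t * n + u) * n + v)) (k - 1 - j) (st'.var 17) (st'.var 18)) ≠ 0 := by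
  intro st'
  set R : ℕ → ℕ → ℕ → ℕ := fun t u v => c ((t * n + u) * n + v)
  set Hit : ℕ → ℕ → Prop := fun t₀ u => t₀ < L + 2 ∧ u < n ∧ c ((t₀ * n + u) * n + v) = t ∧
      pairing k (functional k Q st (j + 1)) (table _ k n (L + 2) s R (k - 1 - j) t₀ u) ≠ 0 with hHit
  have := run_loop_params (n := n) (L := L) (k := k) (s := s) (x := 10) (p := 13) (st := st)
    (c := (seq (assign 3 (var 10 / par 0)) (seq (assign 4 (var 10 % par 0)) (seq evaluate
    (seq (assign 24 (selEq (load 1 (arrivalIx (var 3) (var 4) (var 16))) (var 15)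
        (modSucc (var 19) (var 1)) 0))
      (seq (assign 17 (sel 0 (var 24) (var 3) (var 17)))
        (assign 18 (sel 0 (var 24) (var 4) (var 18)))))))))
    (fun m s' => s'.var 1 = Q ∧ s'.var 2 = j ∧ s'.var 15 = t ∧ s'.var 16 = v ∧ s'.arr = st.arr ∧
      ((∀ z < m, ¬ Hit (z / n) (z % n)) ∨ Hit (s'.var 17) (s'.var 18))) rfl
    ⟨h1, h2, h15, h16, rfl, .inl (by simp)⟩ ?_
  · rcases this.2.2.2.2.2 with h | h
    · obtain ⟨t₀, ht₀, u, hu, h3, h4⟩ := hex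
      have := h (t₀ * n + u) (flat_lt ht₀ hu)
      rw [flat_div hu, flat_mod hu] at this
      exact absurd ⟨ht₀, hu, h3, h4⟩ this
    · exact h
  · rintro z hz s' ⟨e1, e2, e15, e16, ea, ih⟩
    have hz' : z < (L + 2) * n := hz
    have hn : 0 < n := Nat.pos_of_ne_zero (by rintro rfl; simp at hz')
    have ht : z / n < L + 2 := Nat.div_lt_of_lt_mul (by rwa [mul_comm])
    have hu : z % n < n := Nat.mod_lt _ hn
    rw [run_seq, run_seq, run_seq]
    set s₁ := (assign 4 (var 10 % par 0)).run (params n L k s)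
      ((assign 3 (var 10 / par 0)).run (params n L k s) (s'.setVar 10 z)) with hs₁
    have a1 : s₁.arr = st.arr := ea
    have v3 : s₁.var 3 = z / n := by simp [hs₁]
    have v4 : s₁.var 4 = z % n := by simp [hs₁]
    have v17 : s₁.var 17 = s'.var 17 := by simp [hs₁]
    have v18 : s₁.var 18 = s'.var 18 := by simp [hs₁]
    have hev := evaluate_run (st := s₁) (Q := Q) (j := j) (R := R) (by simp [hs₁, e1])
      (by simp [hs₁, e2]) v3 v4 ht hu (by rw [a1]; exact hT)
    set s₂ := evaluate.run (params n L k s) s₁ with hs₂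
    have f : ∀ y, y ∉ evaluate.vars → s₂.var y = s₁.var y := fun y hy => run_var_of_notMem _ hy
    have w1 : s₂.var 1 = Q := by rw [f 1 (by decide)]; simp [hs₁, e1]
    have w2 : s₂.var 2 = j := by rw [f 2 (by decide)]; simp [hs₁, e2]
    have w15 : s₂.var 15 = t := by rw [f 15 (by decide)]; simp [hs₁, e15]
    have w16 : s₂.var 16 = v := by rw [f 16 (by decide)]; simp [hs₁, e16]
    have w3 : s₂.var 3 = z / n := by rw [f 3 (by decide), v3]
    have w4 : s₂.var 4 = z % n := by rw [f 4 (by decide), v4]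
    have w17 : s₂.var 17 = s'.var 17 := by rw [f 17 (by decide), v17]
    have w18 : s₂.var 18 = s'.var 18 := by rw [f 18 (by decide), v18]
    have a2 : s₂.arr = st.arr := by
      rw [← a1]; funext i; exact run_arr_of_notMem _ (by simp [evaluate, Cmd.arrs])
    have hpos : 0 < s₂.var 19 % (Q + 1) ↔ pairing k (functional k Q st (j + 1))
        (table _ k n (L + 2) s R (k - 1 - j) (z / n) (z % n)) ≠ 0 := by
      rw [mod_pos_iff, hev]
      have : functional k Q s₁ (j + 1) = functional k Q st (j + 1) := by
        funext A B; simp only [functional, a1]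
      rw [this]
    have hcond : c ((z / n * n + z % n) * n + v) = t ∧ 0 < s₂.var 19 % (Q + 1) ↔
        Hit (z / n) (z % n) := by
      rw [hpos]; exact ⟨fun h => ⟨ht, hu, h⟩, fun h => h.2.2⟩
    simp only [run_seq, run_assign, eval_sel, eval_selEq, eval_var, eval_ofNat, eval_par,
      eval_modSucc, eval_load_of_ne, ne_eq, one_ne_zero, not_false_eq_true, arrivalIx,
      eval_add, eval_mul, setVar_var, setVar_arr, Nat.reduceEqDiff, if_true, if_false,
      OfNat.one_ne_ofNat, w1, w2, w15, w16, w3, w4, w17, w18, a2, ha, params_zero, true_and]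
    by_cases hh : Hit (z / n) (z % n)
    · obtain ⟨hc1, hc2⟩ := hcond.2 hh
      simp only [hc1, hc2, if_true]
      exact .inr hh
    · have hz0 : ¬ 0 < (if c ((z / n * n + z % n) * n + v) = t then s₂.var 19 % (Q + 1) else 0) := by
        split_ifs with h
        · exact fun h' => hh (hcond.1 ⟨h, h'⟩)
        · exact lt_irrefl 0
      simp only [hz0, if_false]
      refine ih.imp_left fun ih y hy => ?_
      by_cases hyz : y = z
      · rw [hyz]; exact hh
      · exact ih y (by omega)

theorem initFunctional_run (st : St) {Q j A B : ℕ} (hj : j ≤ k) (hA : A < 2 ^ k) (hB : B < 2 ^ k) :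
    functional k Q (initFunctional.run (params n L k s) st) j A B =
      if j = 0 ∧ A = 2 ^ k - 1 ∧ B = 2 ^ k - 1 then 1 else 0 := by
  have := run_loop_params (n := n) (L := L) (k := k) (s := s) (x := 10) (p := 12) (st := st)
    (c := store 5 (var 10) 0) (fun m s' => ∀ z < m, s'.arr 5 z = 0) rfl (by simp) ?_
  · have hK : 2 ^ k - 1 < 2 ^ k := Nat.sub_lt (by positivity) one_pos
    have h := this (functionalAt k j A B) (flat_lt (flat_lt (Nat.lt_succ_of_le hj) hA) hB)
    have e : (0 * 2 ^ k + (2 ^ k - 1)) * 2 ^ k + (2 ^ k - 1) =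
      functionalAt k 0 (2 ^ k - 1) (2 ^ k - 1) := rfl
    simp only [functional, initFunctional, run_seq, run_store_of_ne, ne_eq, OfNat.ofNat_ne_zero,
      not_false_eq_true, functionalIx, eval_add, eval_mul, eval_ofNat, eval_par, eval_sub,
      setArr_arr, params_five, if_true, e, h, functionalAt_inj hA hB hK hK]
    push_cast
    simp only [and_assoc]
  · intro z hz s' h y hy
    simp only [run_store_of_ne, ne_eq, OfNat.ofNat_ne_zero, not_false_eq_true, eval_var, eval_ofNat,
      setVar_var, setVar_arr, setArr_arr, if_true]
    split_ifs with h'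
    · rfl
    · exact h y (by omega)

/-- The array `V` holds distinct vertices that can be reached from `s` one after the other, and `T` holds
the arrival times. -/
structure Route (n L k s best : ℕ) (R : ℕ → ℕ → ℕ → ℕ) (T V : ℕ → ℕ) : Prop where
  time_zero : T 0 = 0
  vertex_zero : V 0 = s
  time_last : T k = best
  vertex_lt : ∀ p ≤ k, V p < n
  time_lt : ∀ p ≤ k, T p < L + 2
  step : ∀ p < k, R (T p) (V p) (V (p + 1)) = T (p + 1)
  nodup : ((List.range k).map fun i => V (k - i)).Nodup

/-- The part of the route from level `k - j` on, and the functional for the rest of it. -/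
structure BackInv (n L k s Q best : ℕ) (R : ℕ → ℕ → ℕ → ℕ) (j : ℕ) (st : St) : Prop where
  time_last : st.arr 6 k = best
  vertex_lt : ∀ p, k - j ≤ p → p ≤ k → st.arr 7 p < n
  time_lt : ∀ p, k - j ≤ p → p ≤ k → st.arr 6 p < L + 2
  step : ∀ p, k - j ≤ p → p < k → R (st.arr 6 p) (st.arr 7 p) (st.arr 7 (p + 1)) = st.arr 6 (p + 1)
  zero : ∀ j', j < j' → j' ≤ k → ∀ A < 2 ^ k, ∀ B < 2 ^ k, functional k Q st j' A B = 0
  minor : ∀ l, pairing k (functional k Q st j) (fun A B => minor _ k l A * minor _ k l B) =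
    minor _ k (((List.range j).map fun i => st.arr 7 (k - i)) ++ l) (2 ^ k - 1) *
      minor _ k (((List.range j).map fun i => st.arr 7 (k - i)) ++ l) (2 ^ k - 1)
  ne_zero : pairing k (functional k Q st j)
    (table _ k n (L + 2) s R (k - j) (st.arr 6 (k - j)) (st.arr 7 (k - j))) ≠ 0

theorem pairing_congr {S : Type*} [CommRing S] {γ γ' H : ℕ → ℕ → S}
    (h : ∀ A < 2 ^ k, ∀ B < 2 ^ k, γ A B = γ' A B) : pairing k γ H = pairing k γ' H :=
  Finset.sum_congr rfl fun A hA => Finset.sum_congr rfl fun B hB => by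
    rw [h A (Finset.mem_range.1 hA) B (Finset.mem_range.1 hB)]

/-- Two facts are maintained: the functional is nonzero on the current table entry, and on the
minors of any sequence `l` it gives the square of the full determinant of `l` extended by the
vertices already fixed. The first finds the next predecessor; at the end, the second shows that the
fixed vertices are distinct. -/
theorem backtrack_run {Q best : ℕ} {st : St} {c : ℕ → ℕ} (h1 : st.var 1 = Q) (ha : st.arr 1 = c)
    (h2 : ∀ a < k, st.arr 2 a = 2 ^ a) (hC : CoefTable n k Q (st.arr 3))
    (hT : TableFull n L k s Q (fun t u v => c ((t * n + u) * n + v)) (st.arr 4))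
    (h0 : BackInv n L k s Q best (fun t u v => c ((t * n + u) * n + v)) 0 st) :
    let st' := backtrack.run (params n L k s) st
    Route n L k s best (fun t u v => c ((t * n + u) * n + v)) (st'.arr 6) (st'.arr 7) := by
  intro st'
  set R : ℕ → ℕ → ℕ → ℕ := fun t u v => c ((t * n + u) * n + v) with hR
  have := run_loop_params (n := n) (L := L) (k := k) (s := s) (x := 2) (p := 4) (m := k) (st := st)
    (c := (seq (assign 15 (load 6 (par 4 - var 2))) (seq (assign 16 (load 7 (par 4 - var 2)))
    (seq contract (seq predecessor (seq (store 6 (par 4 - 1 - var 2) (var 17))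
      (store 7 (par 4 - 1 - var 2) (var 18))))))))
    (fun m s' => s'.var 1 = Q ∧ s'.arr 1 = c ∧ s'.arr 2 = st.arr 2 ∧ s'.arr 3 = st.arr 3 ∧
      s'.arr 4 = st.arr 4 ∧ BackInv n L k s Q best R m s') rfl ⟨h1, ha, rfl, rfl, rfl, h0⟩ ?_
  · obtain ⟨-, -, -, -, -, h⟩ := this
    have hne := h.ne_zero
    rw [Nat.sub_self] at hne
    obtain ⟨g1, g2, g3⟩ := pairing_ne_zero_of_table_zero hne
    refine ⟨g1, g2, h.time_last, fun p hp => h.vertex_lt p (by omega) hp,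
      fun p hp => h.time_lt p (by omega) hp, fun p hp => h.step p (by omega) hp, ?_⟩
    -- With `l = []` the nonzero value is the square of the determinant of the vertices found, which
    -- would be 0 if one of them were repeated.
    rw [h.minor, List.append_nil] at g3
    by_contra hnd
    have hz := minor_eq_zero (S := ZMod (Q + 1)) (A := 2 ^ k - 1) (k := k)
      (Nat.sub_lt (by positivity) one_pos) hnd
    exact g3 ((congrArg₂ (· * ·) hz hz).trans (zero_mul _))
  · rintro j hj s' ⟨e1, ea, e2, e3, e4, hB⟩
    rw [run_seq, run_seq, run_seq, run_seq]
    set s₁ := (assign 16 (load 7 (par 4 - var 2))).run (params n L k s)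
      ((assign 15 (load 6 (par 4 - var 2))).run (params n L k s) (s'.setVar 2 j)) with hs₁
    set t := s'.arr 6 (k - j) with ht
    set v := s'.arr 7 (k - j) with hv
    have a1 : s₁.arr = s'.arr := rfl
    have v1 : s₁.var 1 = Q := by simp [hs₁, e1]
    have v2 : s₁.var 2 = j := by simp [hs₁]
    have v15 : s₁.var 15 = t := by simp [hs₁, ht]
    have v16 : s₁.var 16 = v := by simp [hs₁, hv]
    have hvn : v < n := hB.vertex_lt _ le_rfl (by omega)
    have hI : ContractInv n k Q j v (functional k Q s' j) s₁ :=
      ⟨v1, v2, v16, by rw [a1, e2]; exact h2, by rw [a1, e3]; exact hC, fun _ _ _ _ => rfl⟩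
    have hcr := fun j' A B hA hB => contract_run (L := L) (s := s) hvn hI (j' := j') (A := A)
      (B := B) hA hB
    set s₂ := contract.run (params n L k s) s₁ with hs₂
    have f2 : ∀ y, y ∉ contract.vars → s₂.var y = s₁.var y := fun y hy => run_var_of_notMem _ hy
    have b2 : ∀ y, y ∉ contract.arrs → s₂.arr y = s'.arr y :=
      fun y hy => (run_arr_of_notMem _ hy).trans (congrFun a1 y)
    have hnew : ∀ A < 2 ^ k, ∀ B < 2 ^ k,
        functional k Q s₂ (j + 1) A B = contracted k v (functional k Q s' j) A B := by
      intro A hA B hB'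
      rw [hcr _ _ _ hA hB', if_pos rfl]
      have := hB.zero (j + 1) (by omega) (by omega) A hA B hB'
      rw [show functional k Q s₁ (j + 1) A B = functional k Q s' (j + 1) A B from rfl, this, zero_add]
    have hold : ∀ j' ≠ j + 1, ∀ A < 2 ^ k, ∀ B < 2 ^ k,
        functional k Q s₂ j' A B = functional k Q s' j' A B := by
      intro j' hj' A hA B hB'
      rw [hcr _ _ _ hA hB', if_neg hj', add_zero]
      rfl
    -- A nonzero sum over predecessors has a nonzero term.
    have hex : ∃ t₀ < L + 2, ∃ u < n, c ((t₀ * n + u) * n + v) = t ∧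
        pairing k (functional k Q s₂ (j + 1)) (table _ k n (L + 2) s R (k - 1 - j) t₀ u) ≠ 0 := by
      have hne := hB.ne_zero
      rw [show k - j = (k - 1 - j) + 1 by omega, pairing_table] at hne
      obtain ⟨t₀, ht₀, hne⟩ := Finset.exists_ne_zero_of_sum_ne_zero hne
      obtain ⟨u, hu, hne⟩ := Finset.exists_ne_zero_of_sum_ne_zero hne
      rw [← show k - j = (k - 1 - j) + 1 by omega] at hne
      refine ⟨t₀, Finset.mem_range.1 ht₀, u, Finset.mem_range.1 hu, ?_⟩
      rw [pairing_congr hnew]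
      by_cases h : R t₀ u v = t
      · rw [if_pos h] at hne; exact ⟨h, hne⟩
      · rw [if_neg h] at hne; exact absurd rfl hne
    have hpr := predecessor_run (st := s₂) (Q := Q) (j := j) (t := t) (v := v) (c := c)
      (by rw [f2 1 (by decide), v1]) (by rw [f2 2 (by decide), v2]) (by rw [f2 15 (by decide), v15])
      (by rw [f2 16 (by decide), v16]) (by rw [b2 1 (by decide), ea])
      (by rw [b2 4 (by decide), e4]; exact hT) hex
    set s₃ := predecessor.run (params n L k s) s₂ with hs₃
    obtain ⟨p1, p2, p3, p4⟩ := hpr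
    have f3 : ∀ y, y ∉ predecessor.vars → s₃.var y = s₂.var y := fun y hy => run_var_of_notMem _ hy
    have b3 : s₃.arr = s₂.arr := by
      funext i; exact run_arr_of_notMem _ (by simp [predecessor, evaluate, Cmd.arrs])
    have w1 : s₃.var 1 = Q := by rw [f3 1 (by decide), f2 1 (by decide), v1]
    have w2 : s₃.var 2 = j := by rw [f3 2 (by decide), f2 2 (by decide), v2]
    set t' := s₃.var 17 with ht'
    set u' := s₃.var 18 with hu'
    have hfin : (seq (store 6 (par 4 - 1 - var 2) (var 17))
        (store 7 (par 4 - 1 - var 2) (var 18))).run (params n L k s) s₃ =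
        (s₃.setArr 6 (k - 1 - j) t').setArr 7 (k - 1 - j) u' := by
      simp only [run_seq, run_store_of_ne, ne_eq, OfNat.ofNat_ne_zero, not_false_eq_true, eval_sub,
        eval_par, eval_var, eval_ofNat, setArr_var, w2, params_four, ht', hu']
    rw [hfin]
    set s₄ := (s₃.setArr 6 (k - 1 - j) t').setArr 7 (k - 1 - j) u' with hs₄
    have b4 : ∀ y, y ≠ 6 → y ≠ 7 → s₄.arr y = s₂.arr y := fun y h6 h7 => by
      rw [hs₄, setArr_arr_ne _ _ _ _ _ h7, setArr_arr_ne _ _ _ _ _ h6, b3]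
    have b6 : ∀ p, s₄.arr 6 p = if p = k - 1 - j then t' else s'.arr 6 p := fun p => by
      simp only [hs₄, setArr_arr, b3, b2 6 (by decide), Nat.reduceEqDiff, if_false, if_true]
    have b7 : ∀ p, s₄.arr 7 p = if p = k - 1 - j then u' else s'.arr 7 p := fun p => by
      simp only [hs₄, setArr_arr, b3, b2 7 (by decide), Nat.reduceEqDiff, if_false, if_true]
    have hfun : functional k Q s₄ = functional k Q s₂ := by
      funext j' A B; rw [functional, functional, b4 5 (by decide) (by decide)]
    refine ⟨w1, ?_, ?_, ?_, ?_, ?_⟩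
    · rw [b4 1 (by decide) (by decide), b2 1 (by decide), ea]
    · rw [b4 2 (by decide) (by decide), b2 2 (by decide), e2]
    · rw [b4 3 (by decide) (by decide), b2 3 (by decide), e3]
    · rw [b4 4 (by decide) (by decide), b2 4 (by decide), e4]
    · have hkj : k - (j + 1) = k - 1 - j := by omega
      constructor
      · rw [b6, if_neg (by omega), hB.time_last]
      · intro p hp hpk
        rw [b7]
        split_ifs
        · exact p2
        · exact hB.vertex_lt p (by omega) hpk
      · intro p hp hpk
        rw [b6]
        split_ifs
        · exact p1
        · exact hB.time_lt p (by omega) hpk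
      · intro p hp hpk
        rw [b6, b7, b7, b6, if_neg (c := p + 1 = k - 1 - j) (by omega),
          if_neg (c := p + 1 = k - 1 - j) (by omega)]
        by_cases hpe : p = k - 1 - j
        · rw [if_pos hpe, if_pos hpe, show p + 1 = k - j by omega]
          exact p3
        · rw [if_neg hpe, if_neg hpe]
          exact hB.step p (by omega) hpk
      · intro j' hj' hj'k A hA B hB'
        rw [hfun, hold j' (by omega) A hA B hB']
        exact hB.zero j' (by omega) hj'k A hA B hB'
      · intro l
        have e7 : ((List.range (j + 1)).map fun i => s₄.arr 7 (k - i)) =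
            ((List.range j).map fun i => s'.arr 7 (k - i)) ++ [v] := by
          rw [List.range_succ, List.map_append]
          congr 1
          · refine List.map_congr_left fun i hi => ?_
            have := List.mem_range.1 hi
            rw [b7, if_neg (by omega)]
          · simp only [List.map_cons, List.map_nil]
            rw [b7, if_neg (by omega)]
        rw [hfun, pairing_congr hnew, pairing_minor, hB.minor (v :: l), e7, List.append_assoc]
        rfl
      · rw [hfun, hkj, b6, b7, if_pos rfl, if_pos rfl]
        exact p4

/-- The tables in memory belong to the last modulus tried, so they are recomputed for the modulus of
the witness. The initial functional is evaluation at the pair of full masks. -/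
theorem solution_run {st : St} {c : ℕ → ℕ} (hs : s < n) (h1 : st.arr 1 = c)
    (h2 : ∀ a < k, st.arr 2 a = 2 ^ a)
    (hc : ∀ t < L + 2, ∀ u < n, ∀ v < n, c ((t * n + u) * n + v) < L + 2)
    (hw : Witness n L k s (fun t u v => c ((t * n + u) * n + v)) (st.var 12) (st.var 13) (st.var 14))
    (hb : st.var 12 ≤ L) :
    let st' := solution.run (params n L k s) st
    Route n L k s (st.var 12) (fun t u v => c ((t * n + u) * n + v)) (st'.arr 6) (st'.arr 7) := by
  intro st'
  obtain ⟨hvn, hne⟩ := hw.2 hb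
  set Q := st.var 14 with hQ
  set s₁ := (assign 1 (var 14)).run (params n L k s) st with hs₁
  obtain ⟨hC, hT⟩ := tables_run (L := L) (s := s) (st := s₁) (Q := Q) hs (by simp [hs₁, hQ]) h1 h2 hc
  set s₂ := tables.run (params n L k s) s₁ with hs₂
  set s₃ := initFunctional.run (params n L k s) s₂ with hs₃
  have f : ∀ y, y ≠ 1 → y ∉ tables.vars → y ∉ initFunctional.vars → s₃.var y = st.var y :=
    fun y h1 hy hy' => by
      rw [hs₃, run_var_of_notMem _ hy', hs₂, run_var_of_notMem _ hy]; simp [hs₁, h1]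
  have v1 : s₃.var 1 = Q := by
    rw [hs₃, run_var_of_notMem _ (by decide), hs₂, run_var_of_notMem _ (by decide)]; simp [hs₁, hQ]
  have b3 : ∀ y, y ∉ initFunctional.arrs → s₃.arr y = s₂.arr y := fun y hy => run_arr_of_notMem _ hy
  have b2 : ∀ y, y ∉ tables.arrs → s₂.arr y = st.arr y := fun y hy => run_arr_of_notMem _ hy
  have hrun : st' = backtrack.run (params n L k s)
      ((s₃.setArr 6 k (st.var 12)).setArr 7 k (st.var 13)) := by
    simp only [st', solution, run_seq]
    rw [← hs₁, ← hs₂, ← hs₃]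
    congr 1
    simp only [run_store_of_ne, ne_eq, OfNat.ofNat_ne_zero, not_false_eq_true, eval_par, eval_var,
      setArr_var, params_four, f 12 (by decide) (by decide) (by decide),
      f 13 (by decide) (by decide) (by decide)]
  rw [hrun]
  set s₄ := (s₃.setArr 6 k (st.var 12)).setArr 7 k (st.var 13) with hs₄
  have b4 : ∀ y, y ≠ 6 → y ≠ 7 → s₄.arr y = s₃.arr y := fun y h6 h7 => by
    rw [hs₄, setArr_arr_ne _ _ _ _ _ h7, setArr_arr_ne _ _ _ _ _ h6]
  have t6 : s₄.arr 6 k = st.var 12 := by simp [hs₄]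
  have t7 : s₄.arr 7 k = st.var 13 := by simp [hs₄]
  have hfun : functional k Q s₄ = functional k Q s₃ := by
    funext j' A B; rw [functional, functional, b4 5 (by decide) (by decide)]
  have hK : 2 ^ k - 1 < 2 ^ k := Nat.sub_lt (by positivity) one_pos
  have hpair : ∀ H : ℕ → ℕ → ZMod (Q + 1), pairing k (functional k Q s₄ 0) H =
      H (2 ^ k - 1) (2 ^ k - 1) := by
    intro H
    have : pairing k (functional k Q s₄ 0) H = pairing k
        (fun A B => if 0 = 0 ∧ A = 2 ^ k - 1 ∧ B = 2 ^ k - 1 then 1 else 0) H :=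
      pairing_congr fun A hA B hB => by
        rw [hfun]; exact initFunctional_run s₂ (Nat.zero_le k) hA hB
    rw [this, pairing, Finset.sum_eq_single_of_mem (2 ^ k - 1) (Finset.mem_range.2 hK),
      Finset.sum_eq_single_of_mem (2 ^ k - 1) (Finset.mem_range.2 hK)]
    · simp
    · intro B _ hB; simp [hB]
    · intro A _ hA; simp [hA]
  refine backtrack_run (Q := Q) (by simpa [hs₄] using v1) ?_ ?_ ?_ ?_ ⟨t6, ?_, ?_, ?_, ?_, ?_, ?_⟩
  · rw [b4 1 (by decide) (by decide), b3 1 (by decide), b2 1 (by decide), h1]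
  · rw [b4 2 (by decide) (by decide), b3 2 (by decide), b2 2 (by decide)]; exact h2
  · rw [b4 3 (by decide) (by decide), b3 3 (by decide)]; exact hC
  · rw [b4 4 (by decide) (by decide), b3 4 (by decide)]; exact hT
  · intro p h h'
    obtain rfl : p = k := by omega
    rw [t7]; exact hvn
  · intro p h h'
    obtain rfl : p = k := by omega
    rw [t6]; omega
  · intro p h h'; omega
  · intro j' hj' hj'k A hA B hB
    rw [hfun, hs₃, initFunctional_run s₂ hj'k hA hB, if_neg (by omega)]
  · intro l; rw [hpair]; rfl
  · rw [hpair, Nat.sub_zero, t6, t7]; exact hne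

end Verification

end TExp

/-! ### Writing out a walk along the foremost journeys -/

namespace TExp
open ForProg ForProg.Expr ForProg.Cmd

section Output

variable {n L k s : ℕ}

/-- The value `n` signals that no suitable neighbour exists. -/
theorem nextVertex_run {st : St} {i u v t : ℕ} (hi : i < L) (hu : u < n) (h21 : st.var 21 = i)
    (h20 : st.var 20 = u) (h5 : st.var 5 = v) (h3 : st.var 3 = t) :
    let x := (nextVertex.run (params n L k s) st).var 23
    let Good := fun y => 0 < st.arr 0 ((i * n + u) * n + y) ∧ st.arr 1 (((i + 1) * n + y) * n + v) = t
    x < n ∧ Good x ∨ x = n ∧ ∀ y < n, ¬ Good y := by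
  intro x Good
  have := run_loop_params (n := n) (L := L) (k := k) (s := s) (x := 22) (p := 0) (m := n)
    (st := (assign 23 (par 0)).run (params n L k s) st)
    (c := assign 23 (sel 0 (load 0 (arrivalIx (var 21) (var 20) (var 22)))
      (selEq (load 1 (arrivalIx (var 21 + 1) (var 22) (var 5))) (var 3) (var 22) (var 23)) (var 23)))
    (fun m s' => s'.arr = st.arr ∧ s'.var 21 = i ∧ s'.var 20 = u ∧ s'.var 5 = v ∧ s'.var 3 = t ∧
      (s'.var 23 < n ∧ Good (s'.var 23) ∨ s'.var 23 = n ∧ ∀ y < m, ¬ Good y))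
    rfl ⟨rfl, by simpa, by simpa, by simpa, by simpa, .inr ⟨by simp, by simp⟩⟩ ?_
  · exact this.2.2.2.2.2
  · rintro y hy s' ⟨ha, e21, e20, e5, e3, h⟩
    have hm := input_mod hi hu hy
    refine ⟨ha, by simpa, by simpa, by simpa, by simpa, ?_⟩
    have hval : ((assign 23 (sel 0 (load 0 (arrivalIx (var 21) (var 20) (var 22)))
      (selEq (load 1 (arrivalIx (var 21 + 1) (var 22) (var 5))) (var 3) (var 22) (var 23))
      (var 23))).run (params n L k s) (s'.setVar 22 y)).var 23 = if Good y then y else s'.var 23 := by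
      simp only [run_assign, eval_sel, eval_ofNat, eval_load_zero, arrivalIx, eval_add, eval_mul,
        eval_var, eval_par, setVar_var, setVar_arr, ha, e21, e20, e5, e3, params_zero, params_two, hm,
        ne_eq, one_ne_zero, not_false_eq_true, eval_load_of_ne, if_true, Nat.reduceEqDiff,
        if_false, eval_selEq, Good, ite_and]
    rw [hval]
    by_cases hg : Good y
    · rw [if_pos hg]; exact .inl ⟨hy, hg⟩
    · rw [if_neg hg]
      refine h.imp_right fun h => ⟨h.1, fun z hz => ?_⟩
      rcases Nat.lt_succ_iff_lt_or_eq.1 hz with hz | rfl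
      · exact h.2 z hz
      · exact hg

variable {G : TemporalGraph (Fin n) L} {R : ℕ → ℕ → ℕ → ℕ}

/-- Reaching a different vertex takes at least one time step. -/
theorem Foremost.eq_of_self (h : Foremost G R) {i : ℕ} (hi : i ≤ L) {u v : Fin n}
    (he : R i u v = i) : u = v := by
  by_contra huv
  rcases hi.lt_or_eq with hi | rfl
  · rcases h.cases i hi u v huv with e | ⟨x, _, e⟩
    · have := h.le (i := i + 1) (by omega) u v; omega
    · have := h.le (i := i + 1) (by omega) x v; omega
  · have := h.last u v huv; omega

/-- Strictly increasing time steps: with `finish_le` this bounds the length of a walk by `L`, hence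
the space for the output. -/
theorem length_add_le_finish (S : List (ℕ × Fin n)) : ∀ (v : Fin n) (τ : ℕ), G.IsSteps v τ S →
    S.length + τ ≤ (finish v τ S).1 := by
  induction S with
  | nil => intro v τ _; simp [finish]
  | cons a S ih =>
    intro v τ h
    have h1 := ih a.2 (a.1 + 1) h.2.2
    have h2 := h.1
    simp only [finish, List.length_cons]
    omega

/-- The walk with steps `S` visits `x`. -/
def Stops (s : Fin n) (S : List (ℕ × Fin n)) (x : ℕ) : Prop :=
  ∃ (y : Fin n) (τ : ℕ), (y : ℕ) = x ∧ (τ, y) ∈ (1, s) :: S.map (fun p => (p.1 + 1, p.2))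

theorem Stops.append {s : Fin n} {S : List (ℕ × Fin n)} {x : ℕ} (h : Stops s S x)
    (a : ℕ × Fin n) : Stops s (S ++ [a]) x := by
  obtain ⟨y, τ, hy, hm⟩ := h
  refine ⟨y, τ, hy, ?_⟩
  rw [List.map_append, ← List.cons_append]
  exact List.mem_append_left _ hm

theorem stops_finish (s : Fin n) (S : List (ℕ × Fin n)) : Stops s S (finish s 1 S).2 :=
  ⟨_, (finish s 1 S).1, rfl, by
    rw [Prod.mk.eta, ← getLast_stops S s 1]; exact List.getLast_mem _⟩

/-- The state holds the data of the instance and of the route, and the walk with steps `S`. -/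
structure OutputInv (G : TemporalGraph (Fin n) L) (s : Fin n) (c inp T V : ℕ → ℕ)
    (S : List (ℕ × Fin n)) (st : St) : Prop where
  arrivals : st.arr 1 = c
  times : st.arr 6 = T
  places : st.arr 7 = V
  input : ∀ a < L * n * n, st.arr 0 a = inp a
  length : st.var 0 = S.length
  fst : ∀ (i : ℕ) (hi : i < S.length), st.arr 0 (L * n * n + 2 * i) = S[i].1
  snd : ∀ (i : ℕ) (hi : i < S.length), st.arr 0 (L * n * n + 2 * i + 1) = S[i].2
  steps : G.IsSteps s 1 S
  place : st.var 20 = (finish s 1 S).2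

theorem OutputInv.length_le {s : Fin n} {c inp T V : ℕ → ℕ} {S : List (ℕ × Fin n)} {st : St}
    (h : OutputInv G s c inp T V S st) : S.length ≤ L := by
  have h1 := length_add_le_finish S s 1 h.steps
  have h2 := finish_le S s 1 h.steps (by omega)
  omega

/-- The effect of the code without its meaning: `x` is the candidate for the next vertex, about
which something is known only for `i < L` and which matters only if `go` is positive. -/
theorem outputStep_eq {s : Fin n} {c inp T V : ℕ → ℕ} {S : List (ℕ × Fin n)} {st : St} {i j : ℕ}
    (h : OutputInv G s c inp T V S st) (h21 : st.var 21 = i) (h2 : st.var 2 = j) :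
    ∃ x : ℕ, (i < L → (x < n ∧ 0 < st.arr 0 ((i * n + (finish s 1 S).2) * n + x) ∧
          c (((i + 1) * n + x) * n + V (j + 1)) = T (j + 1) ∨
        x = n ∧ ∀ y < n, ¬ (0 < st.arr 0 ((i * n + (finish s 1 S).2) * n + y) ∧
          c (((i + 1) * n + y) * n + V (j + 1)) = T (j + 1)))) ∧
    let go := if i < T j then 0 else if i < T (j + 1) then
        if c (((i + 1) * n + (finish s 1 S).2) * n + V (j + 1)) = T (j + 1) then 0 else 1 else 0
    let st' := outputStep.run (params n L k s) st
    st'.var 2 = j ∧ st'.arr 1 = c ∧ st'.arr 6 = T ∧ st'.arr 7 = V ∧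
    (∀ a, st'.arr 0 a = if a = L * n * n + 2 * S.length + 1 then x else
      if a = L * n * n + 2 * S.length then i + 1 else st.arr 0 a) ∧
    st'.var 0 = (if 0 < go then (S.length + 1) % (L + 1) else S.length) ∧
    st'.var 20 = if 0 < go then x else (finish s 1 S).2 := by
  set s₁ := (assign 5 (load 7 (var 2 + 1))).run (params n L k s) st with hs₁
  set s₂ := (assign 3 (load 6 (var 2 + 1))).run (params n L k s) s₁ with hs₂
  set s₃ := nextVertex.run (params n L k s) s₂ with hs₃
  have a2 : s₂.arr = st.arr := rfl
  have v5 : s₂.var 5 = V (j + 1) := by simp [hs₂, hs₁, h2, h.places]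
  have v3 : s₂.var 3 = T (j + 1) := by simp [hs₂, hs₁, h2, h.times]
  have v21 : s₂.var 21 = i := by simp [hs₂, hs₁, h21]
  have v20 : s₂.var 20 = (finish s 1 S).2 := by simp [hs₂, hs₁, h.place]
  have a3 : ∀ j, s₃.arr j = st.arr j := fun j => (run_arr_of_notMem s₂ (by simp [nextVertex, Cmd.arrs])).trans rfl
  have f : ∀ y, y ≠ 22 → y ≠ 23 → s₃.var y = s₂.var y := fun y h1 h2 =>
    run_var_of_notMem s₂ (by simp [nextVertex, Cmd.vars, h1, h2])
  have w5 := (f 5 (by decide) (by decide)).trans v5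
  have w3 := (f 3 (by decide) (by decide)).trans v3
  have w21 := (f 21 (by decide) (by decide)).trans v21
  have w20 := (f 20 (by decide) (by decide)).trans v20
  have w2 : s₃.var 2 = j := (f 2 (by decide) (by decide)).trans (by simp [hs₂, hs₁, h2])
  have w0 : s₃.var 0 = S.length := (f 0 (by decide) (by decide)).trans (by simp [hs₂, hs₁, h.length])
  have hl := h.length_le
  have m1 : (L * n * n + 2 * S.length) % (L * n * n + 2 * L + 2) = L * n * n + 2 * S.length :=
    Nat.mod_eq_of_lt (by omega)
  have m2 : (L * n * n + 2 * S.length + 1) % (L * n * n + 2 * L + 2) = L * n * n + 2 * S.length + 1 :=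
    Nat.mod_eq_of_lt (by omega)
  refine ⟨s₃.var 23, fun hi => ?_, ?_⟩
  · have := nextVertex_run (k := k) (s := s) hi (finish s 1 S).2.isLt v21 v20 v5 v3
    rw [a2, h.arrivals] at this
    exact this
  · have hrun : outputStep.run (params n L k s) st = (seq (assign 25 (sel (var 21) (load 6 (var 2)) 0
      (sel (var 21) (var 3)
      (selEq (load 1 (arrivalIx (var 21 + 1) (var 20) (var 5))) (var 3) 0 1) 0)))
      (seq (store 0 (par 3 * par 0 * par 0 + 2 * var 0) (var 21 + 1))
      (seq (store 0 (par 3 * par 0 * par 0 + 2 * var 0 + 1) (var 23))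
      (seq (assign 0 (sel 0 (var 25) (modSucc (var 0 + 1) (par 3)) (var 0)))
        (assign 20 (sel 0 (var 25) (var 23) (var 20))))))).run (params n L k s) s₃ := rfl
    intro go st'
    have hgo : (sel (var 21) (load 6 (var 2)) 0 (sel (var 21) (var 3)
      (selEq (load 1 (arrivalIx (var 21 + 1) (var 20) (var 5))) (var 3) 0 1) 0)).eval
        (params n L k s) s₃ = go := by
      simp only [eval_sel, eval_selEq, eval_var, eval_ofNat, eval_add, eval_mul, eval_par, arrivalIx, ne_eq,
        OfNat.ofNat_ne_zero, not_false_eq_true, eval_load_of_ne, w21, w2, w20, w5, w3, a3,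
        h.arrivals, h.times, params_zero, one_ne_zero, go]
    have hst : st' = _ := hrun
    rw [run_seq, run_assign, hgo] at hst
    simp only [run_seq, run_assign, run_store_zero, eval_add, eval_mul, eval_par, eval_var, eval_ofNat,
      eval_sel, eval_modSucc, setVar_var, setArr_var, params_zero, params_two, params_three, w21, w0,
      w20, Nat.reduceEqDiff, if_false, if_true, m1, m2, OfNat.ofNat_ne_zero, OfNat.zero_ne_ofNat] at hst
    rw [hst]
    refine ⟨by simp [w2], ?_, ?_, ?_, ?_, ?_, ?_⟩
    · rw [setVar_arr, setVar_arr, setArr_arr_ne _ _ _ _ _ (by decide), setArr_arr_ne _ _ _ _ _ (by decide),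
        setVar_arr, a3, h.arrivals]
    · rw [setVar_arr, setVar_arr, setArr_arr_ne _ _ _ _ _ (by decide), setArr_arr_ne _ _ _ _ _ (by decide),
        setVar_arr, a3, h.times]
    · rw [setVar_arr, setVar_arr, setArr_arr_ne _ _ _ _ _ (by decide), setArr_arr_ne _ _ _ _ _ (by decide),
        setVar_arr, a3, h.places]
    · intro a
      simp [a3]
    · simp
    · simp

/-- The time `max (T j) (min i (T (j + 1)))` is `i` clipped to the leg from `T j` to `T (j + 1)`.
The invariant is that from the current vertex at that time the next vertex of the route is still
reached at time `T (j + 1)`. Outside the leg nothing happens; inside, one waits if waiting preserves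
the invariant and otherwise moves to a neighbour that preserves it. -/
theorem outputStep_run {s : Fin n} {c inp T V : ℕ → ℕ} {S : List (ℕ × Fin n)} {st : St} {i j : ℕ}
    (hR : Foremost G fun t u v => c ((t * n + u) * n + v))
    (hadj : ∀ (i : Fin L) (u v : Fin n), 0 < inp ((i * n + u) * n + v) ↔ (G.layer i).Adj u v)
    (hV : V (j + 1) < n) (hT : T j ≤ T (j + 1)) (hi : i < L)
    (h : OutputInv G s c inp T V S st) (h21 : st.var 21 = i) (h2 : st.var 2 = j)
    (hf : (finish s 1 S).1 ≤ max (T j) (min i (T (j + 1))) + 1)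
    (hc : c ((max (T j) (min i (T (j + 1))) * n + (finish s 1 S).2) * n + V (j + 1)) = T (j + 1)) :
    let st' := outputStep.run (params n L k s) st
    st'.var 2 = j ∧ ∃ S', (∀ x, Stops s S x → Stops s S' x) ∧ OutputInv G s c inp T V S' st' ∧
      (finish s 1 S').1 ≤ max (T j) (min (i + 1) (T (j + 1))) + 1 ∧
      c ((max (T j) (min (i + 1) (T (j + 1))) * n + (finish s 1 S').2) * n + V (j + 1)) = T (j + 1) := by
  intro st'
  obtain ⟨x, hx, r2, r1, r6, r7, r0, rl, rp⟩ := outputStep_eq (k := k) h h21 h2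
  refine ⟨r2, ?_⟩
  have hl := h.length_le
  have hin : ∀ a < L * n * n, st'.arr 0 a = inp a := fun a ha => by
    rw [r0, if_neg (by omega), if_neg (by omega), h.input a ha]
  by_cases hgo : i < T j ∨ T (j + 1) ≤ i ∨
      c (((i + 1) * n + (finish s 1 S).2) * n + V (j + 1)) = T (j + 1)
  · have hg : ¬ (0 < if i < T j then 0 else if i < T (j + 1) then
        if c (((i + 1) * n + (finish s 1 S).2) * n + V (j + 1)) = T (j + 1) then 0 else 1 else 0) := by
      split_ifs <;> omega
    rw [if_neg hg] at rl rp
    refine ⟨S, fun _ h => h, ⟨r1, r6, r7, hin, rl, fun i hi => ?_, fun i hi => ?_, h.steps, rp⟩,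
      by omega, ?_⟩
    · rw [r0, if_neg (by omega), if_neg (by omega), h.fst i hi]
    · rw [r0, if_neg (by omega), if_neg (by omega), h.snd i hi]
    · rcases hgo with hgo | hgo | hgo
      · rw [show max (T j) (min (i + 1) (T (j + 1))) = max (T j) (min i (T (j + 1))) by omega]
        exact hc
      · rw [show max (T j) (min (i + 1) (T (j + 1))) = max (T j) (min i (T (j + 1))) by omega]
        exact hc
      · by_cases h1 : i < T j
        · rw [show max (T j) (min (i + 1) (T (j + 1))) = max (T j) (min i (T (j + 1))) by omega]
          exact hc
        · by_cases h3 : T (j + 1) ≤ i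
          · rw [show max (T j) (min (i + 1) (T (j + 1))) = max (T j) (min i (T (j + 1))) by omega]
            exact hc
          · rw [show max (T j) (min (i + 1) (T (j + 1))) = i + 1 by omega]
            exact hgo
  · push Not at hgo
    obtain ⟨g1, g2, g3⟩ := hgo
    rw [if_neg (not_lt.2 g1), if_pos g2, if_neg g3] at rl rp
    rw [show max (T j) (min i (T (j + 1))) = i by omega] at hf hc
    rw [show max (T j) (min (i + 1) (T (j + 1))) = i + 1 by omega]
    have hlen := length_add_le_finish S s 1 h.steps
    rw [if_pos one_pos, Nat.mod_eq_of_lt (by omega)] at rl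
    rw [if_pos one_pos] at rp
    -- At the target the arrival time would be `i`, but `i < T (j + 1)`.
    have hne : (finish s 1 S).2 ≠ ⟨V (j + 1), hV⟩ := by
      intro e
      have := hR.self i hi.le (finish s 1 S).2
      have e' : ((finish s 1 S).2 : ℕ) = V (j + 1) := congrArg Fin.val e
      nth_rewrite 2 [e'] at this
      omega
    -- Since waiting does not preserve the arrival time, the recursion for `R` provides a neighbour
    -- that does.
    obtain ⟨hxn, hxa, hxc⟩ : x < n ∧ 0 < st.arr 0 ((i * n + (finish s 1 S).2) * n + x) ∧
        c (((i + 1) * n + x) * n + V (j + 1)) = T (j + 1) := by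
      refine (hx hi).resolve_right fun ⟨_, hno⟩ => ?_
      rcases hR.cases i hi _ _ hne with e | ⟨y, hy, e⟩
      · exact g3 (e.symm.trans hc)
      · refine hno y y.isLt ⟨?_, e.symm.trans hc⟩
        rw [h.input _ (arrival_lt hi (Fin.isLt _) y.isLt)]
        exact (hadj ⟨i, hi⟩ _ y).2 hy
    rw [h.input _ (arrival_lt hi (Fin.isLt _) hxn)] at hxa
    have hxa : (G.layer ⟨i, hi⟩).Adj (finish s 1 S).2 ⟨x, hxn⟩ := (hadj ⟨i, hi⟩ _ ⟨x, hxn⟩).1 hxa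
    have hfin : finish s 1 (S ++ [(i + 1, ⟨x, hxn⟩)]) = (i + 1 + 1, ⟨x, hxn⟩) := finish_append _ _ _ _ _
    refine ⟨S ++ [(i + 1, ⟨x, hxn⟩)], fun _ h => h.append _,
      ⟨r1, r6, r7, hin, by simpa using rl, fun m hm => ?_, fun m hm => ?_,
        isSteps_append (i + 1) ⟨x, hxn⟩ _ _ _ h.steps hf
          ⟨⟨by omega, by omega⟩, by simpa only [Nat.add_sub_cancel] using hxa⟩, by rw [hfin]; exact rp⟩,
      by rw [hfin], by rw [hfin]; exact hxc⟩
    all_goals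
      rw [List.length_append, List.length_singleton] at hm
      rw [r0]
      rcases Nat.lt_succ_iff_lt_or_eq.1 hm with hm | rfl
    · rw [if_neg (by omega), if_neg (by omega), h.fst m hm, List.getElem_append_left hm]
    · rw [if_neg (by omega), if_pos rfl, List.getElem_append_right le_rfl]
      simp
    · rw [if_neg (by omega), if_neg (by omega), h.snd m hm, List.getElem_append_left hm]
    · rw [if_pos rfl, List.getElem_append_right le_rfl]
      simp

theorem Route.mono {best : ℕ} {c T V : ℕ → ℕ}
    (hR : Foremost G fun t u v => c ((t * n + u) * n + v))
    (h : Route n L k s best (fun t u v => c ((t * n + u) * n + v)) T V) {p : ℕ} (hp : p < k) :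
    T p ≤ T (p + 1) := by
  have h1 := h.step p hp
  have h2 := h.time_lt p hp.le
  rw [← h1]
  exact hR.le (by omega) ⟨_, h.vertex_lt p hp.le⟩ ⟨_, h.vertex_lt (p + 1) hp⟩

theorem Route.le_best {best : ℕ} {c T V : ℕ → ℕ}
    (hR : Foremost G fun t u v => c ((t * n + u) * n + v))
    (h : Route n L k s best (fun t u v => c ((t * n + u) * n + v)) T V) {p : ℕ} (hp : p ≤ k) :
    T p ≤ best := by
  rw [← h.time_last]
  have : ∀ d, p + d ≤ k → T p ≤ T (p + d) := by
    intro d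
    induction d with
    | zero => exact fun _ => le_rfl
    | succ d ih => exact fun hd => (ih (by omega)).trans (h.mono hR (by omega))
  simpa [Nat.add_sub_cancel' hp] using this (k - p) (by omega)

theorem output_run {s : Fin n} {best : ℕ} {c inp T V : ℕ → ℕ} {st : St}
    (hR : Foremost G fun t u v => c ((t * n + u) * n + v))
    (hadj : ∀ (i : Fin L) (u v : Fin n), 0 < inp ((i * n + u) * n + v) ↔ (G.layer i).Adj u v)
    (h : Route n L k s best (fun t u v => c ((t * n + u) * n + v)) T V) (hb : best ≤ L)
    (h0 : st.arr 0 = inp) (h1 : st.arr 1 = c) (h6 : st.arr 6 = T) (h7 : st.arr 7 = V) :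
    ∃ S, OutputInv G s c inp T V S (output.run (params n L k s) st) ∧
      (finish s 1 S).1 ≤ best + 1 ∧ ∀ p, 1 ≤ p → p ≤ k → Stops s S (V p) := by
  set s₁ := (assign 0 0).run (params n L k s) ((assign 20 (par 1)).run (params n L k s) st) with hs₁
  have base : OutputInv G s c inp T V [] s₁ :=
    ⟨h1, h6, h7, fun a _ => congrFun h0 a, by simp [hs₁], by simp, by simp, trivial,
      by simp [hs₁, finish]⟩
  have := run_loop_params (n := n) (L := L) (k := k) (s := s) (x := 2) (p := 4) (m := k) (st := s₁)
    (c := loop 21 3 outputStep)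
    (fun j s' => ∃ S, OutputInv G s c inp T V S s' ∧ (finish s 1 S).1 ≤ T j + 1 ∧
      ((finish s 1 S).2 : ℕ) = V j ∧ ∀ p, 1 ≤ p → p ≤ j → Stops s S (V p))
    rfl ⟨[], base, by simp [finish], h.vertex_zero.symm, fun p h1 h2 => by omega⟩ ?_
  · obtain ⟨S, hS, hf, -, hst⟩ := this
    rw [h.time_last] at hf
    refine ⟨S, ?_, hf, hst⟩
    obtain ⟨i1, i2, i3, i4, i5, i6, i7, i8, i9⟩ := hS
    exact ⟨i1, i2, i3, i4, by rw [← i5]; simp [output, hs₁], i6, i7, i8, by rw [← i9]; simp [output, hs₁]⟩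
  · rintro j hj s' ⟨S, hS, hf, hv, hst⟩
    have hmono := h.mono hR hj
    have hVj := h.vertex_lt (j + 1) hj
    have hTb := h.le_best hR (p := j + 1) hj
    have := run_loop_params (n := n) (L := L) (k := k) (s := s) (x := 21) (p := 3) (m := L)
      (st := s'.setVar 2 j) (c := outputStep)
      (fun i s'' => s''.var 2 = j ∧ ∃ S, OutputInv G s c inp T V S s'' ∧
        (finish s 1 S).1 ≤ max (T j) (min i (T (j + 1))) + 1 ∧
        c ((max (T j) (min i (T (j + 1))) * n + (finish s 1 S).2) * n + V (j + 1)) = T (j + 1) ∧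
        ∀ p, 1 ≤ p → p ≤ j → Stops s S (V p))
      rfl ⟨by simp, S, ⟨hS.1, hS.2, hS.3, hS.4, by simp [hS.5], hS.6, hS.7, hS.8, by simp [hS.9]⟩,
        by simpa using hf, ?_, hst⟩ ?_
    · obtain ⟨-, S', hS', hf', hc', hst'⟩ := this
      rw [show max (T j) (min L (T (j + 1))) = T (j + 1) by omega] at hf' hc'
      -- After the leg, the invariant says that the target is reached without any delay, so it is
      -- the current vertex.
      have he : (finish s 1 S').2 = ⟨V (j + 1), hVj⟩ := hR.eq_of_self (hTb.trans hb) hc'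
      have he' : ((finish s 1 S').2 : ℕ) = V (j + 1) := congrArg Fin.val he
      refine ⟨S', hS', hf', he', fun p hp1 hp2 => ?_⟩
      rcases Nat.le_succ_iff.1 hp2 with hp | rfl
      · exact hst' p hp1 hp
      · rw [← he']; exact stops_finish s S'
    · rw [hv, show max (T j) (min 0 (T (j + 1))) = T j by omega]
      exact h.step j hj
    · rintro i hi s'' ⟨e2, S, hS, hf, hc, hst⟩
      obtain ⟨g2, S', hsub, g3, g4, g5⟩ := outputStep_run (k := k) hR hadj hVj hmono hi
        (st := s''.setVar 21 i)
        ⟨hS.1, hS.2, hS.3, hS.4, by simp [hS.5], hS.6, hS.7, hS.8, by simp [hS.9]⟩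
        (by simp) (by simp [e2]) hf hc
      exact ⟨g2, S', g3, g4, g5, fun p h1 h2 => hsub _ (hst p h1 h2)⟩

end Output

end TExp

/-! ### Correctness of the algorithm -/

namespace TExp
open ForProg ForProg.Expr ForProg.Cmd

section Correctness

variable {n L k : ℕ} {G : TemporalGraph (Fin n) L} {s : Fin n}

/-- The algorithm solves the instance whose adjacency matrices are in array `0`. -/
theorem algorithm_correct (hL : 1 ≤ L) {st : St}
    (hadj : ∀ (i : Fin L) (u v : Fin n), 0 < st.arr 0 ((i * n + u) * n + v) ↔ (G.layer i).Adj u v) :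
    let st' := algorithm.run (params n L k s) st
    (st'.var 26 = 1 ∧ ∃ W : StrictWalk G, IsOptimalSolution G s k W ∧ st'.var 0 = W.steps.length ∧
      ∀ (i : ℕ) (hi : i < W.steps.length), st'.arr 0 (L * n * n + 2 * i) = W.steps[i].1 ∧
        st'.arr 0 (L * n * n + 2 * i + 1) = W.steps[i].2) ∨
    (st'.var 26 = 0 ∧ ¬ KArbitraryTEXP G s k) := by
  intro st'
  set ρ := params n L k s with hρ
  set s₁ := arrivals.run ρ st with hs₁
  set s₂ := powers.run ρ s₁ with hs₂
  set s₃ := optimum.run ρ s₂ with hs₃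
  set s₄ := solution.run ρ s₃ with hs₄
  set c := s₁.arr 1 with hc
  have hst' : st' = output.run ρ s₄ := rfl
  have hR : Foremost G fun t u v => c ((t * n + u) * n + v) := foremost_arrivals hadj
  have hlt : ∀ t < L + 2, ∀ u < n, ∀ v < n, c ((t * n + u) * n + v) < L + 2 := fun t ht u hu v hv =>
    Nat.lt_succ_of_le (hR.le_top (i := t) (by omega) ⟨u, hu⟩ ⟨v, hv⟩)
  have a12 : s₂.arr 1 = c := run_arr_of_notMem s₁ (by decide)
  have a13 : s₃.arr 1 = c := (run_arr_of_notMem s₂ (by decide)).trans a12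
  have a14 : s₄.arr 1 = c := (run_arr_of_notMem s₃ (by decide)).trans a13
  have p2 : ∀ a < k, s₂.arr 2 a = 2 ^ a := powers_run s₁
  have p3 : ∀ a < k, s₃.arr 2 a = 2 ^ a := fun a ha => by
    rw [hs₃, run_arr_of_notMem s₂ (by decide), p2 a ha]
  have a04 : s₄.arr 0 = st.arr 0 := by
    rw [hs₄, run_arr_of_notMem s₃ (by decide), hs₃, run_arr_of_notMem s₂ (by decide), hs₂,
      run_arr_of_notMem s₁ (by decide), hs₁, run_arr_of_notMem st (by decide)]
  have v4 : s₄.var 12 = s₃.var 12 := run_var_of_notMem s₃ (by decide)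
  obtain ⟨hw, hopt⟩ := optimum_run s.isLt a12 p2 hlt
  have hmin : ∀ l : List (Fin n), l.Nodup → l.length = k →
      s₃.var 12 ≤ (place (fun t u v => c ((t * n + u) * n + v)) s (l.map Fin.val)).1 :=
    fun l hl hk => le_place s.isLt hlt hopt (hl.map Fin.val_injective) (by simpa using hk)
      (by simp)
  have h26 : st'.var 26 = if s₃.var 12 < L + 1 then 1 else 0 := by
    have : (output.run ρ s₄).var 26 = if ((loop 2 4 (loop 21 3 outputStep)).run ρ ((assign 0 0).run ρ
      ((assign 20 (par 1)).run ρ s₄))).var 12 < L + 1 then 1 else 0 := by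
      simp [output, hρ]
    rw [hst', this, run_var_of_notMem _ (by decide), ← v4]
    simp
  by_cases hb : s₃.var 12 ≤ L
  · left
    refine ⟨by rw [h26, if_pos (by omega)], ?_⟩
    have hroute := solution_run s.isLt a13 p3 hlt hw hb
    obtain ⟨S, hS, hf, hstops⟩ := output_run hR hadj hroute hb a04 a14 rfl rfl
    have hV : ∀ p : Fin k, s₄.arr 7 (p + 1) < n := fun p => hroute.vertex_lt _ p.isLt
    -- The visited set consists of the places `1, …, k` of the route; place 0 is the start and need
    -- not count. The list in `Route.nodup` runs backwards, hence the indices `k - (p + 1)`.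
    have hinj : Function.Injective fun p : Fin k => (⟨s₄.arr 7 (p + 1), hV p⟩ : Fin n) := by
      intro p q hpq
      have e : s₄.arr 7 (p + 1) = s₄.arr 7 (q + 1) := congrArg Fin.val hpq
      have h := List.inj_on_of_nodup_map hroute.nodup (x := k - (p + 1)) (y := k - (q + 1))
        (List.mem_range.2 (by have := p.isLt; omega)) (List.mem_range.2 (by have := q.isLt; omega))
        (by rw [Nat.sub_sub_self p.isLt, Nat.sub_sub_self q.isLt]; exact e)
      ext; omega
    refine ⟨_, hR.isOptimalSolution hmin hL hS.steps hf
      (X := Finset.univ.map ⟨_, hinj⟩) (by simp) ?_, hS.length, fun i hi => ⟨hS.fst i hi, hS.snd i hi⟩⟩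
    intro x hx
    obtain ⟨p, -, rfl⟩ := Finset.mem_map.1 hx
    obtain ⟨y, τ, hy, hm⟩ := hstops (p + 1) (by omega) (by omega)
    have e : y = ⟨s₄.arr 7 (p + 1), hV p⟩ := Fin.ext hy
    rw [e] at hm
    exact ⟨τ, hm⟩
  · right
    refine ⟨by rw [h26, if_neg (by omega)], hR.not_kArbitraryTEXP fun l hl hk => ?_⟩
    exact (by omega : L + 1 ≤ s₃.var 12).trans (hmin l hl hk)

end Correctness

end TExp

/-! ### Setting up the parameters on the machine -/

namespace ForProg
open WordRAM

/-- Setting several parameters one after the other. -/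
def setPars : List (ℕ × Expr) → Prog
  | [] => .skip
  | (p, e) :: l => .seq (.seq (e.comp 0) (move (3 * p) 2 1)) (setPars l)

/-- The parameters afterwards. -/
def parsAfter (st : St) (ρ : ℕ → ℕ) : List (ℕ × Expr) → ℕ → ℕ
  | [] => ρ
  | (p, e) :: l => parsAfter st (Function.update ρ p (e.eval ρ st)) l

theorem setPars_runs {Δ : Degs} {N D w : ℕ} (hN : 2 ≤ N) (hw : N ^ D = 2 ^ w) (hw4 : 4 < w) {st : St} :
    ∀ (l : List (ℕ × Expr)) {ρ : ℕ → ℕ} {σ : State}, Bdd Δ N ρ st → Match ρ st σ →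
      (∀ x ∈ l, x.1 ≠ 2 ∧ x.2.ok Δ D = true ∧ x.2.deg Δ ≤ Δ.par x.1) →
      ∃ σ', Runs w (setPars l) σ ((l.map fun x => x.2.cost + 2).sum + 1) σ' ∧
        Match (parsAfter st ρ l) st σ' ∧ Bdd Δ N (parsAfter st ρ l) st := by
  intro l
  induction l with
  | nil => exact fun hb hm _ => ⟨_, .of_exec (.skip _), hm, hb⟩
  | cons x l ih =>
    intro ρ σ hb hm h
    obtain ⟨⟨h1, h2, h3⟩, h4⟩ := List.forall_mem_cons.1 h
    obtain ⟨σ₁, r1, m1, b1⟩ := setPar_runs hN hw hw4 hb hm x.1 h1 x.2 h2 h3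
    obtain ⟨σ₂, r2, m2, b2⟩ := ih b1 m1 h4
    exact ⟨σ₂, (r1.seq r2).mono (by simp only [List.map_cons, List.sum_cons]; omega), m2, b2⟩

/-- Doubling register `15` until register `8` has reached the value `k` of register `12`. -/
theorem runs_loop_double {w k : ℕ} (hk : k < 2 ^ w) (hk2 : 2 ^ k < 2 ^ w) (d : ℕ) :
    ∀ {i : ℕ} {σ : State}, i + d = k → σ.reg 8 = i → σ.reg 12 = k → σ.reg 15 = 2 ^ i → σ.reg 5 = 1 →
      Runs w (.loop 8 12 (.seq (.arith .add 15 15 15) (.arith .add 8 8 5))) σ (3 * d + 1)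
        ⟨Function.update (Function.update σ.reg 15 (2 ^ k)) 8 k, σ.mem⟩ := by
  induction d with
  | zero =>
    intro i σ hi h8 h12 h15 h5
    obtain rfl : i = k := hi
    have e : (⟨Function.update (Function.update σ.reg 15 (2 ^ i)) 8 i, σ.mem⟩ : State) = σ := by
      rw [← h15, ← h8, Function.update_eq_self, Function.update_eq_self]
    rw [e]
    exact ⟨1, by omega, .loop_false (by omega)⟩
  | succ d ih =>
    intro i σ hi h8 h12 h15 h5
    have hp : 2 ^ (i + 1) ≤ 2 ^ k := Nat.pow_le_pow_right two_pos (by omega)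
    have r1 := Runs.arith (w := w) σ .add 15 15 15 h15 h15
      (show 2 ^ i + 2 ^ i < 2 ^ w by rw [← two_mul, ← pow_succ']; omega)
    have r2 := Runs.arith (w := w) (σ.setReg 15 (2 ^ i + 2 ^ i)) .add 8 8 5
      ((setReg_reg_ne _ _ (by decide)).trans h8) ((setReg_reg_ne _ _ (by decide)).trans h5)
      (show i + 1 < 2 ^ w by omega)
    obtain ⟨T, hT, r⟩ := r1.seq r2
    obtain ⟨T', hT', r'⟩ := ih (i := i + 1) (σ := (σ.setReg 15 (2 ^ i + 2 ^ i)).setReg 8 (i + 1)) (by omega)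
      (setReg_reg_self _ _ _)
      (by rw [setReg_reg_ne _ _ (by decide), setReg_reg_ne _ _ (by decide), h12])
      (by rw [setReg_reg_ne _ _ (by decide), setReg_reg_self, pow_succ]; ring)
      (by rw [setReg_reg_ne _ _ (by decide), setReg_reg_ne _ _ (by decide), h5])
    refine ⟨T + T' + 1, by omega, ?_⟩
    have e : (⟨Function.update (Function.update σ.reg 15 (2 ^ k)) 8 k, σ.mem⟩ : State) =
        ⟨Function.update (Function.update ((σ.setReg 15 (2 ^ i + 2 ^ i)).setReg 8 (i + 1)).reg 15
          (2 ^ k)) 8 k, ((σ.setReg 15 (2 ^ i + 2 ^ i)).setReg 8 (i + 1)).mem⟩ := by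
      simp only [State.setReg, State.mk.injEq, and_true]
      funext r
      simp only [Function.update_apply]
      split_ifs <;> rfl
    rw [e]
    exact .loop_true (by rw [h8, h12]; omega) r r'

end ForProg

namespace TExp
open ForProg ForProg.Expr ForProg.Cmd WordRAM

/-- Putting `L`, `k`, `2 ^ k` and `L n ^ 2 + 2 L + 2` into their registers. -/
def prologue : Prog :=
  .seq (move 9 1 1) (.seq (move 12 2 1) (.seq (.const 15 1) (.seq (.const 5 1)
    (.seq (.loop 8 12 (.seq (.arith .add 15 15 15) (.arith .add 8 8 5)))
    (.seq (.arith .mul 6 9 0) (.seq (.arith .mul 6 6 0) (.seq (.arith .add 6 6 9)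
      (.seq (.arith .add 6 6 9) (.seq (.arith .add 6 6 5) (.arith .add 6 6 5))))))))))

/-- The other parameters. -/
def otherParams : List (ℕ × Expr) :=
  [(6, par 3 + 2), (7, (2 * par 4 + 4) * par 4 + 2), (8, par 4 + 1), (9, par 0 * par 0),
    (10, par 0 * par 4 * par 5), (11, par 8 * par 6 * par 0 * par 5 * par 5),
    (12, par 8 * par 5 * par 5), (13, par 6 * par 0)]

/-- Putting the answer and the address of the walk into their registers. -/
def epilogue : Prog :=
  .seq (.arith .mul 2 9 0) (.seq (.arith .mul 2 2 0) (move 0 79 1))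

theorem otherParams_ok : ∀ x ∈ otherParams, x.1 ≠ 2 ∧ x.2.ok degs 100 = true ∧
    x.2.deg degs ≤ degs.par x.1 := by decide +kernel

def firstParams (n L k s : ℕ) : ℕ → ℕ
  | 0 => n
  | 1 => s
  | 2 => L * n * n + 2 * L + 2
  | 3 => L
  | 4 => k
  | 5 => 2 ^ k
  | _ => 0

theorem parsAfter_otherParams (n L k s : ℕ) (st : St) :
    parsAfter st (firstParams n L k s) otherParams = params n L k s := by
  funext p
  simp only [parsAfter, otherParams]
  rcases p with _|_|_|_|_|_|_|_|_|_|_|_|_|_|p <;>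
    simp [firstParams, params]

end TExp

/-! ### Input and output conventions of the machine -/

namespace TExp
open ForProg ForProg.Expr ForProg.Cmd WordRAM

section Machine

variable {n L k : ℕ}

/-- The fourth base is `k + 1` rather than `k`, so that all bases are positive even for `k = 0`. -/
theorem params_le_limits {s : ℕ} (hs : s < n) (hL : 1 ≤ L) (p : ℕ) : params n L k s p ≤
    (limits p).val ⟨n, L, 2 ^ k, k + 1, by omega, hL, Nat.one_le_two_pow, by omega⟩ := by
  have hLn : L ≤ n ^ 2 * L := Nat.le_mul_of_pos_left _ (Nat.pow_pos (by omega))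
  have hL3 : L + 2 ≤ 3 * L := by omega
  rcases p with _|_|_|_|_|_|_|_|_|_|_|_|_|_|p <;>
    simp only [limits, params, Mono.val, List.getD_cons_zero, List.getD_cons_succ, List.getD_nil,
      pow_zero, pow_one, mul_one, one_mul, le_refl, zero_add, Nat.reduceAdd]
  · omega
  · nlinarith
  · omega
  · omega
  · exact le_of_eq (by ring)
  · exact le_of_eq (by ring)
  · calc n * k * 2 ^ k ≤ n * (k + 1) * 2 ^ k := by gcongr; omega
      _ = _ := by ring
  · calc (k + 1) * (L + 2) * n * 2 ^ k * 2 ^ k ≤ (k + 1) * (3 * L) * n * 2 ^ k * 2 ^ k := by gcongr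
      _ = _ := by ring
  · exact le_of_eq (by ring)
  · calc (L + 2) * n ≤ 3 * L * n := by gcongr
      _ = _ := by ring

/-- The initial state of the variables and arrays. -/
def initialSt (L : ℕ) (mem : ℕ → ℕ) : St where
  -- Variable 0 lives in register 1, where the input has put `L`.
  var i := if i = 0 then L else 0
  arr j i := if j = 0 then mem i else 0

theorem inputState_mem_eq_zero {G : TemporalGraph (Fin n) L} {s : Fin n} {a : ℕ} (ha : L * n * n ≤ a) :
    (inputState G s k).mem a = 0 := by
  refine if_neg ?_
  rintro ⟨i, u, v, rfl, -⟩
  exact absurd (arrival_lt i.isLt u.isLt v.isLt) (by omega)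

theorem inputState_mem_pos {G : TemporalGraph (Fin n) L} {s : Fin n} (i : Fin L) (u v : Fin n) :
    0 < (inputState G s k).mem ((i * n + u) * n + v) ↔ (G.layer i).Adj u v := by
  simp only [inputState]
  split_ifs with h
  · obtain ⟨i', u', v', he, ha⟩ := h
    obtain ⟨h1, h2⟩ := (flat_inj v.isLt v'.isLt).1 he
    obtain ⟨h3, h4⟩ := (flat_inj u.isLt u'.isLt).1 h1
    rw [Fin.ext h3, Fin.ext h4, Fin.ext h2]
    simpa using ha
  · simp only [lt_irrefl, false_iff]
    exact fun ha => h ⟨i, u, v, rfl, ha⟩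

/-- The numbers `n` and `s` are already in registers 0 and 3, those of parameters 0 and 1. Registers
5 and 8 belong to temporaries and are free as scratch space; the zeros behind the input represent
the empty arrays. -/
theorem prologue_runs {w : ℕ} (G : TemporalGraph (Fin n) L) (s : Fin n) (hk : 2 ^ k < 2 ^ w)
    (hM : L * n * n + 2 * L + 2 < 2 ^ w) :
    ∃ σ, Runs w prologue (inputState G s k) (3 * k + 13) σ ∧
      Match (firstParams n L k s) (initialSt L (inputState G s k).mem) σ := by
  have hkw : k < 2 ^ w := Nat.lt_two_pow_self.trans hk
  have hn : 1 ≤ n := by have := s.isLt; omega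
  have hLn : L * n ≤ L * n * n := Nat.le_mul_of_pos_right _ hn
  set σ := inputState G s k with hσ
  have r0 : σ.reg 0 = n := rfl
  have r1 : σ.reg 1 = L := rfl
  have r2 : σ.reg 2 = k := rfl
  have r8 : σ.reg 8 = 0 := rfl
  have m1 := move_runs (w := w) σ 9 1 1 (by decide) (by rw [r1]; omega)
  rw [r1] at m1
  set σ₁ := (σ.setReg 5 0).setReg 9 L with hσ₁
  have m2 := move_runs (w := w) σ₁ 12 2 1 (by decide) (show k < _ by omega)
  rw [show σ₁.reg 2 = k from rfl] at m2
  set σ₂ := (σ₁.setReg 5 0).setReg 12 k with hσ₂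
  have m3 := Runs.const (w := w) σ₂ 15 1 (by omega)
  set σ₃ := σ₂.setReg 15 1 with hσ₃
  have m4 := Runs.const (w := w) σ₃ 5 1 (by omega)
  set σ₄ := σ₃.setReg 5 1 with hσ₄
  have m5 := runs_loop_double hkw hk k (i := 0) (σ := σ₄) (zero_add k) rfl rfl rfl rfl
  set σ₅ : State := ⟨Function.update (Function.update σ₄.reg 15 (2 ^ k)) 8 k, σ₄.mem⟩ with hσ₅
  have m6 := Runs.arith (w := w) σ₅ .mul 6 9 0 (x := L) (y := n) rfl rfl (show L * n < _ by omega)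
  set σ₆ := σ₅.setReg 6 (L * n) with hσ₆
  have m7 := Runs.arith (w := w) σ₆ .mul 6 6 0 (x := L * n) (y := n) rfl rfl (show L * n * n < _ by omega)
  set σ₇ := σ₆.setReg 6 (L * n * n) with hσ₇
  have m8 := Runs.arith (w := w) σ₇ .add 6 6 9 (x := L * n * n) (y := L) rfl rfl
    (show L * n * n + L < _ by omega)
  set σ₈ := σ₇.setReg 6 (L * n * n + L) with hσ₈
  have m9 := Runs.arith (w := w) σ₈ .add 6 6 9 (x := L * n * n + L) (y := L) rfl rfl
    (show L * n * n + L + L < _ by omega)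
  set σ₉ := σ₈.setReg 6 (L * n * n + L + L) with hσ₉
  have m10 := Runs.arith (w := w) σ₉ .add 6 6 5 (x := L * n * n + L + L) (y := 1) rfl rfl
    (show L * n * n + L + L + 1 < _ by omega)
  set σ₁₀ := σ₉.setReg 6 (L * n * n + L + L + 1) with hσ₁₀
  have m11 := Runs.arith (w := w) σ₁₀ .add 6 6 5 (x := L * n * n + L + L + 1) (y := 1) rfl rfl
    (show L * n * n + L + L + 1 + 1 < _ by omega)
  set σ₁₁ := σ₁₀.setReg 6 (L * n * n + L + L + 1 + 1) with hσ₁₁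
  refine ⟨σ₁₁, (m1.seq (m2.seq (m3.seq (m4.seq (m5.seq (m6.seq (m7.seq (m8.seq (m9.seq
    (m10.seq m11)))))))))).mono (by omega), ?_⟩
  have hreg : ∀ r, r ≠ 6 → r ≠ 8 → r ≠ 15 → r ≠ 5 → r ≠ 12 → r ≠ 9 → σ₁₁.reg r = σ.reg r := by
    intro r h1 h2 h3 h4 h5 h6
    simp [hσ₁₁, hσ₁₀, hσ₉, hσ₈, hσ₇, hσ₆, hσ₅, hσ₄, hσ₃, hσ₂, hσ₁, State.setReg,
      h1, h2, h3, h4, h5, h6]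
  refine ⟨fun p => ?_, fun x => ?_, fun j hj i => ?_⟩
  · rcases p with _|_|_|_|_|_|p
    · rfl
    · rfl
    · show L * n * n + L + L + 1 + 1 = L * n * n + 2 * L + 2
      omega
    · rfl
    · rfl
    · rfl
    · refine (hreg _ (by omega) (by omega) (by omega) (by omega) (by omega) (by omega)).trans ?_
      simp only [hσ, inputState]
      rw [if_neg (by omega), if_neg (by omega), if_neg (by omega), if_neg (by omega)]
      rfl
  · refine (hreg _ (by omega) (by omega) (by omega) (by omega) (by omega) (by omega)).trans ?_
    rcases x with _|x
    · rfl
    · simp only [hσ, inputState, initialSt]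
      rw [if_neg (by omega), if_neg (by omega), if_neg (by omega), if_neg (by omega),
        if_neg (by omega)]
  · show σ.mem _ = _
    simp only [addr, ix, initialSt, firstParams]
    split_ifs with h0
    · rfl
    · exact inputState_mem_eq_zero (by omega)

theorem epilogue_runs {w a : ℕ} {ρ : ℕ → ℕ} {st : St} {σ : State} (hm : Match ρ st σ)
    (h0 : ρ 0 = n) (h3 : ρ 3 = L) (ha : st.var 26 = a) (haw : a < 2 ^ w) (hn : 1 ≤ n)
    (hw : L * n * n < 2 ^ w) :
    ∃ σ', Runs w epilogue σ 4 σ' ∧ σ'.reg 0 = a ∧ σ'.reg 1 = st.var 0 ∧ σ'.reg 2 = L * n * n ∧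
      σ'.mem = σ.mem := by
  have hLn : L * n ≤ L * n * n := Nat.le_mul_of_pos_right _ hn
  have r0 : σ.reg 0 = n := (hm.par 0).trans h0
  have r9 : σ.reg 9 = L := (hm.par 3).trans h3
  have r79 : σ.reg 79 = a := (hm.var 26).trans ha
  have r1 : σ.reg 1 = st.var 0 := hm.var 0
  have m1 := Runs.arith (w := w) σ .mul 2 9 0 r9 r0 (show L * n < _ by omega)
  have m2 := Runs.arith (w := w) (σ.setReg 2 (L * n)) .mul 2 2 0 (setReg_reg_self _ _ _)
    ((setReg_reg_ne _ _ (by decide)).trans r0) (show L * n * n < _ by omega)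
  have e79 : ((σ.setReg 2 (L * n)).setReg 2 (L * n * n)).reg 79 = a := r79
  have m3 := move_runs (w := w) ((σ.setReg 2 (L * n)).setReg 2 (L * n * n)) 0 79 1 (by decide)
    (by rwa [e79])
  exact ⟨_, m1.seq (m2.seq m3), e79, r1, rfl, rfl⟩

end Machine

end TExp

/-! ### The time bound and the final program -/

namespace TExp
open ForProg ForProg.Expr ForProg.Cmd WordRAM

section Time

/-- For `2 ≤ k` one has `k + 1 ≤ 2 k`, which costs the factor `32 = 2 ^ 5`, and `10 log k ≥ 10 log 2
> 5`. For `k ≤ 1` the power on the right is 1. -/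
theorem pow_five_le (k : ℕ) : ((k : ℝ) + 1) ^ 5 ≤ 32 * (k : ℝ) ^ (((10 : ℕ) : ℝ) * Real.log k) := by
  rcases Nat.lt_or_ge k 2 with hk | hk
  · interval_cases k <;> norm_num
  · have hk' : (2 : ℝ) ≤ k := by exact_mod_cast hk
    have h1 : (5 : ℝ) ≤ ((10 : ℕ) : ℝ) * Real.log k := by
      have := Real.log_le_log (by norm_num) hk'
      have := Real.log_two_gt_d9
      push_cast
      linarith
    calc ((k : ℝ) + 1) ^ 5 ≤ (2 * k) ^ 5 := by gcongr; linarith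
      _ = 32 * (k : ℝ) ^ (5 : ℝ) := by
        rw [mul_pow, ← Real.rpow_natCast (k : ℝ) 5]; norm_num
      _ ≤ _ := by gcongr; linarith

theorem four_pow_le (k : ℕ) : (4 : ℝ) ^ k ≤ (2 * Real.exp 1) ^ k := by
  have := Real.add_one_le_exp 1
  gcongr
  linarith

theorem time_le {n L k C T : ℕ} (hn : 1 ≤ n) (h : T ≤ C * (n ^ 3 * L * 4 ^ k * (k + 1) ^ 5)) :
    (T : ℝ) ≤ (64 * C : ℕ) * (2 * Real.exp 1) ^ k * (k : ℝ) ^ (((10 : ℕ) : ℝ) * Real.log k) *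
      L * (n : ℝ) ^ 3 * Real.log (n + 1) := by
  -- Valid already for `n = 1`, as `log 2 > 1 / 2`; together with the 32 of `pow_five_le` this gives
  -- 64.
  have hlog : (1 : ℝ) ≤ 2 * Real.log (n + 1) := by
    have h1 : (1 : ℝ) ≤ n := by exact_mod_cast hn
    have := Real.log_le_log (by norm_num) (show (2 : ℝ) ≤ n + 1 by linarith)
    have := Real.log_two_gt_d9
    linarith
  have hX : (0 : ℝ) ≤ (k : ℝ) ^ (((10 : ℕ) : ℝ) * Real.log k) := by positivity
  have h5 := pow_five_le k
  have h4 := four_pow_le k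
  have h' : (T : ℝ) ≤ C * ((n : ℝ) ^ 3 * L * 4 ^ k * ((k : ℝ) + 1) ^ 5) := by exact_mod_cast h
  set X := (k : ℝ) ^ (((10 : ℕ) : ℝ) * Real.log k)
  calc (T : ℝ) ≤ C * ((n : ℝ) ^ 3 * L * 4 ^ k * ((k : ℝ) + 1) ^ 5) * 1 := by rw [mul_one]; exact h'
    _ ≤ C * ((n : ℝ) ^ 3 * L * (2 * Real.exp 1) ^ k * (32 * X)) * (2 * Real.log (n + 1)) := by gcongr
    _ = _ := by push_cast; ring

end Time

/-- The machine program that solves the problem. -/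
def solver : Prog :=
  .seq prologue (.seq (setPars otherParams) (.seq (algorithm.comp 0) epilogue))

theorem firstParams_bdd {n L k N : ℕ} {s : Fin n} {G : TemporalGraph (Fin n) L} (hN : 2 ≤ N) (hn : n ≤ N)
    (hL : L ≤ N) (hk : k ≤ N) (hk2 : 2 ^ k ≤ N) :
    Bdd degs N (firstParams n L k s) (initialSt L (inputState G s k).mem) := by
  have pos : ∀ d, 1 ≤ N ^ d := fun d => Nat.one_le_pow _ _ (by omega)
  refine ⟨fun i => ?_, fun i => ?_, fun j i => ?_⟩
  · rcases i with _|_|_|_|_|_|i <;>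
      simp only [firstParams, degs, List.getD_cons_zero, List.getD_cons_succ, pow_one, zero_le]
    · exact hn
    · exact s.isLt.le.trans hn
    · have h1 : L * n * n ≤ N * N * N := by gcongr
      have h2 : N * 4 ≤ N * (N * N) := Nat.mul_le_mul_left _ (Nat.mul_le_mul hN hN)
      have h3 : 2 ^ 3 ≤ N ^ 3 := Nat.pow_le_pow_left hN 3
      calc L * n * n + 2 * L + 2 ≤ 2 ^ 3 * N ^ 3 := by nlinarith
        _ ≤ N ^ 3 * N ^ 3 := by gcongr
        _ = N ^ 6 := by ring
    · exact hL
    · exact hk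
    · exact hk2
  · simp only [initialSt]
    split_ifs
    · exact hL.trans (Nat.le_self_pow (by simp only [degs]; split_ifs <;> omega) _)
    · exact Nat.zero_le _
  · simp only [initialSt, inputState]
    split_ifs
    · exact pos _
    · exact Nat.zero_le _
    · exact Nat.zero_le _

/-- With `N = 2 ^ q` all of `n`, `L`, `k` and `2 ^ k` are at most `N`, so words of `100 q` bits hold
exactly the numbers below `N ^ 100`, the bound checked by `algorithm_ok`. The 20 covers the `3 k +
18` steps outside the algorithm and the setting of `otherParams`. -/
theorem solver_runs {n L k : ℕ} (G : TemporalGraph (Fin n) L) (s : Fin n) (hL : 1 ≤ L) :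
    ∃ σ, Runs (100 * (k + Nat.log 2 n + Nat.log 2 L + 1)) solver (inputState G s k)
      (((algorithm.cost limits).c + (otherParams.map fun x => x.2.cost + 2).sum + 20) *
        (n ^ 3 * L * 4 ^ k * (k + 1) ^ 5)) σ ∧ CorrectOutput G s k σ := by
  set q := k + Nat.log 2 n + Nat.log 2 L + 1 with hq
  set N := 2 ^ q with hNdef
  have hn1 : 1 ≤ n := by have := s.isLt; omega
  have hw : N ^ 100 = 2 ^ (100 * q) := by rw [hNdef, ← pow_mul, mul_comm]
  have le_N : ∀ {m}, m ≤ q → 2 ^ m ≤ N := fun h => Nat.pow_le_pow_right two_pos h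
  have hN : 2 ≤ N := le_N (m := 1) (by omega)
  have hn : n ≤ N := (Nat.lt_pow_succ_log_self one_lt_two n).le.trans (le_N (by omega))
  have hLN : L ≤ N := (Nat.lt_pow_succ_log_self one_lt_two L).le.trans (le_N (by omega))
  have hk2 : 2 ^ k ≤ N := le_N (by omega)
  have hk : k ≤ N := Nat.lt_two_pow_self.le.trans hk2
  have hb := firstParams_bdd (s := s) (G := G) hN hn hLN hk hk2
  have lt : ∀ {x d}, x ≤ N ^ d → d < 100 → x < 2 ^ (100 * q) := fun h h' => by
    rw [← hw]; exact h.trans_lt (Nat.pow_lt_pow_right hN h')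
  have hM : L * n * n + 2 * L + 2 < 2 ^ (100 * q) := lt (hb.par 2) (by decide)
  have hw4 : 4 < 100 * q := by omega
  obtain ⟨σ₁, r1, m1⟩ := prologue_runs G s (lt (hb.par 5) (by decide)) hM
  obtain ⟨σ₂, r2, m2, b2⟩ := setPars_runs hN hw hw4 otherParams hb m1 otherParams_ok
  rw [parsAfter_otherParams] at m2 b2
  set b : Bases := ⟨n, L, 2 ^ k, k + 1, hn1, hL, Nat.one_le_two_pow, by omega⟩ with hbdef
  obtain ⟨σ₃, r3, m3, -, -⟩ := algorithm.comp_runs hN hw hw4 (ρ := params n L k s)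
    (by rw [params_two]; omega) b (params_le_limits s.isLt hL) 0 _ σ₂ algorithm_ok b2 m2
  set st' := algorithm.run (params n L k s) (initialSt L (inputState G s k).mem) with hst'
  have hcorrect := algorithm_correct (k := k) (s := s) (G := G) hL
    (st := initialSt L (inputState G s k).mem) (inputState_mem_pos (k := k) (s := s))
  have h26 : st'.var 26 < 2 ^ (100 * q) := by
    rcases hcorrect with ⟨h, -⟩ | ⟨h, -⟩ <;> rw [h] <;> omega
  obtain ⟨σ₄, r4, e0, e1, e2, em⟩ := epilogue_runs (n := n) (L := L) m3 rfl rfl rfl h26 hn1 (by omega)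
  refine ⟨σ₄, (r1.seq (r2.seq (r3.seq r4))).mono ?_, ?_⟩
  · set X := n ^ 3 * L * 4 ^ k * (k + 1) ^ 5 with hX
    have hcost : (algorithm.cost limits).val b ≤ (algorithm.cost limits).c * X := by
      obtain ⟨c1, c2, c3, c4⟩ := algorithm_cost
      have := Mono.val_le_of_le b (m := algorithm.cost limits)
        (m' := ⟨(algorithm.cost limits).c, 3, 1, 2, 5⟩) le_rfl c1 c2 c3 c4
      refine this.trans (le_of_eq ?_)
      simp only [Mono.val, hbdef, hX]
      rw [← pow_mul, mul_comm k 2, pow_mul]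
      ring
    have hX1 : k + 1 ≤ X := by
      calc k + 1 ≤ (k + 1) ^ 5 := Nat.le_self_pow (by decide) _
        _ ≤ n ^ 3 * L * 4 ^ k * (k + 1) ^ 5 := Nat.le_mul_of_pos_left _ (by positivity)
    set a := (algorithm.cost limits).c
    set d := (otherParams.map fun x => x.2.cost + 2).sum
    have hd : d ≤ d * X := Nat.le_mul_of_pos_right _ (by omega)
    calc _ ≤ a * X + d * X + 20 * X := by omega
      _ = _ := by ring
  · rcases hcorrect with ⟨h1, W, hW, hlen, hmem⟩ | ⟨h1, hno⟩
    · refine ⟨fun _ => ⟨e0.trans h1, W, hW, e1.trans hlen, fun i hi => ?_⟩,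
        fun hno => absurd ⟨W, hW.choose, hW.choose_spec.1, hW.choose_spec.2.1⟩ hno⟩
      have hWL : W.steps.length ≤ L := by
        have h2 := length_add_le_finish W.steps _ _ W.isSteps
        have h3 := finish_le W.steps _ _ W.isSteps (by have := W.startTime_le; omega)
        have := W.one_le_startTime
        omega
      -- The output lies in array 0, whose cells are not displaced, so it can be read directly from
      -- the memory.
      have hread : ∀ x, x < L * n * n + 2 * L + 2 → σ₄.mem x = st'.arr 0 x := fun x hx => by
        have := m3.mem 0 (by decide) x
        simp only [addr, ix, if_true, params_two, Nat.mod_eq_of_lt hx] at this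
        rw [em, this]
      rw [e2, hread _ (by omega), hread _ (by omega)]
      exact hmem i hi
    · exact ⟨fun h => absurd h hno, fun _ => e0.trans h1⟩

end TExp

theorem theorem5 :
    ∃ (P : WordRAM.Prog) (A c d : ℕ), 0 < d ∧
      ∀ (n L k : ℕ) (G : TExp.TemporalGraph (Fin n) L) (s : Fin n), 1 ≤ L →
        ∃ (T : ℕ) (σ : WordRAM.State),
          WordRAM.Exec (d * (k + Nat.log 2 n + Nat.log 2 L + 1)) P (TExp.inputState G s k) T σ ∧
          (T : ℝ) ≤ A * (2 * Real.exp 1) ^ k * (k : ℝ) ^ ((c : ℝ) * Real.log k) *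
            L * (n : ℝ) ^ 3 * Real.log (n + 1) ∧
          TExp.CorrectOutput G s k σ := by
  refine ⟨TExp.solver, 64 * ((TExp.algorithm.cost TExp.limits).c +
    (TExp.otherParams.map fun x => x.2.cost + 2).sum + 20), 10, 100, by decide, ?_⟩
  intro n L k G s hL
  obtain ⟨σ, ⟨T, hT, hexec⟩, hσ⟩ := TExp.solver_runs (k := k) G s hL
  exact ⟨T, σ, hexec, TExp.time_le (by have := s.isLt; omega) hT, hσ⟩
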